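/- Let $n,m\ge 2$ and let $I$ be a real-valued image on the grid $V=\{0,\dots,n-1\}\times\{0,\dots,m-1\}$ with pairwise distinct values. Let $R$ be its bilinear interpolation on $D=[0,n-1]\times[0,m-1]$, which on each unit square (pixel) with corners in $V$ is the bilinear function with the given corner values. *Saddles.* A point $p\in D$ is a saddle if in arbitrarily small discs around $p$ there are curves in $D$, running in the disc and ending on its boundary circle, from $p$ to $p_1$ and from $p$ to $p_2$, and from $p_3$ to $p$ and from $p_4$ to $p$, along each of which $R$ is strictly increasing, with $p_1,p_4,p_2,p_3$ in clockwise order on the circle. A pixel is split if its interior contains a saddle; a mix point is a saddle in $V$. For $p\in V$ let $n(p)$ be the set of the (up to eight) grid neighbors of $p$, without those joined to $p$ by a diagonal of a split pixel. A node $p$ is a local minimum if $I(p)<I(q)$ for all $q\in n(p)$. *Steepest graph.* A steepest graph is a directed graph on $V$ built as follows. (1) For every split pixel, its four sides are added, and (2) for every mix point, the four pixel sides meeting at it are added, each oriented towards the greater value. (3) For every $p$ that has a neighbor in $n(p)$ of greater value, the edge from $p$ to the point of greatest value in $n(p)$ is added. (4) As long as there is a node $p$ without incoming edges that is not a local minimum,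 such a $p$ is chosen and the edge $(p_L,p)$ is added, where $p_L$ has the least value among the points of $n(p)$ that are not joined to $p$ by a diagonal crossing an edge already present (and $I(p_L)<I(p)$). *Regions.* A min-max path is a directed path of this graph that no edge enters at its first node and no edge leaves at its last node. A region (more precisely its non-collapsed part, since the parts where the two delimiting paths coincide with nothing between them lie on the min-max paths) is a connected component $C$ of $D$ minus the union of all min-max paths, drawn as polylines. Its perimeter is its topological boundary $\partial C$ in the plane. The region is monotonic if $C\setminus\partial C$ contains no saddle. Two neighboring grid nodes (horizontally, vertically or diagonally) are consecutive on the perimeter if the segment joining them is contained in $\partial C$. **Claim.** For every steepest graph of $I$ and every monotonic region $C$ there is exactly one node on the perimeter of $C$ whose value is smaller than the values at all nodes consecutive to it on the perimeter, and exactly one node on the perimeter whose value is greater than the values at all nodes consecutive to it on the perimeter. -/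

import Mathlib

open Set

namespace ImageGraph

/-- Integer points of the plane. -/
abbrev Pt := ℤ × ℤ

/-- The integer points of an image with `n` columns and `m` rows: `0 ≤ i ≤ n - 1`, `0 ≤ j ≤ m - 1`.
An image is a function `I : Pt → ℝ`; only its values on `grid n m` are ever used. -/
def grid (n m : ℕ) : Set Pt :=
  {p | 0 ≤ p.1 ∧ p.1 < (n : ℤ) ∧ 0 ≤ p.2 ∧ p.2 < (m : ℤ)}

/-- The image domain `[0, n - 1] × [0, m - 1]` in the plane. -/
def domain (n m : ℕ) : Set (ℝ × ℝ) :=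
  {x | 0 ≤ x.1 ∧ x.1 ≤ (n : ℝ) - 1 ∧ 0 ≤ x.2 ∧ x.2 ≤ (m : ℝ) - 1}

/-- An integer point as a point of the plane. -/
def toPlane (p : Pt) : ℝ × ℝ := ((p.1 : ℝ), (p.2 : ℝ))

/-- The bilinear interpolation `R` of the image `I`. On the right and upper border of the domain
the offset is `0`, so that values of `I` outside the grid get the factor `0`. -/
noncomputable def interp (I : Pt → ℝ) (x : ℝ × ℝ) : ℝ :=
  let i := ⌊x.1⌋
  let j := ⌊x.2⌋
  let z := Int.fract x.1
  let w := Int.fract x.2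
  let a := I (i, j)
  let b := I (i + 1, j)
  let c := I (i, j + 1)
  let d := I (i + 1, j + 1)
  a + (b - a) * z + (c - a) * w + (d + a - b - c) * (z * w)

/-! ### Saddles -/

/-- `γ`, parametrized by `[0, 1]`, is a continuous monotonic increasing path (for `R = interp I`)
from `a` to `b` inside the set `S`. -/
def IsIncreasingPath (I : Pt → ℝ) (S : Set (ℝ × ℝ)) (a b : ℝ × ℝ) (γ : ℝ → ℝ × ℝ) : Prop :=
  ContinuousOn γ (Icc 0 1) ∧ γ 0 = a ∧ γ 1 = b ∧ (∀ t ∈ Icc (0 : ℝ) 1, γ t ∈ S) ∧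
    StrictMonoOn (fun t => interp I (γ t)) (Icc 0 1)

/-- The closed Euclidean disc. -/
def disc (p : ℝ × ℝ) (r : ℝ) : Set (ℝ × ℝ) :=
  {x | (x.1 - p.1) ^ 2 + (x.2 - p.2) ^ 2 ≤ r ^ 2}

/-- The point at angle `θ` on the circle of radius `r` around `p`. -/
noncomputable def onCircle (p : ℝ × ℝ) (r θ : ℝ) : ℝ × ℝ :=
  (p.1 + r * Real.cos θ, p.2 + r * Real.sin θ)

/-- `p` is a saddle: two curves through `p`, delimited by `p₁, p₂` and by `p₃, p₄`, such that the
sub-curves from `p` to `p₁`, from `p` to `p₂`, from `p₃` to `p` and from `p₄` to `p` are monotonic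
increasing paths, and `p₁, p₄, p₂, p₃` appear in clockwise order around `p`.
For the clockwise order to be that of the curves at `p`, the curves are trimmed: they run in a disc
around `p`, as small as one likes, and end on its boundary circle. -/
def IsSaddle (n m : ℕ) (I : Pt → ℝ) (p : ℝ × ℝ) : Prop :=
  ∀ ε > (0 : ℝ), ∃ r : ℝ, 0 < r ∧ r < ε ∧
    ∃ θ₁ θ₂ θ₃ θ₄ : ℝ, θ₁ > θ₄ ∧ θ₄ > θ₂ ∧ θ₂ > θ₃ ∧ θ₃ > θ₁ - 2 * Real.pi ∧
    ∃ γ₁ γ₂ γ₃ γ₄ : ℝ → ℝ × ℝ,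
      IsIncreasingPath I (domain n m ∩ disc p r) p (onCircle p r θ₁) γ₁ ∧
      IsIncreasingPath I (domain n m ∩ disc p r) p (onCircle p r θ₂) γ₂ ∧
      IsIncreasingPath I (domain n m ∩ disc p r) (onCircle p r θ₃) p γ₃ ∧
      IsIncreasingPath I (domain n m ∩ disc p r) (onCircle p r θ₄) p γ₄

/-- The pixel with lower left corner `p` is a split pixel: its interior contains a saddle. -/
def IsSplitPixel (n m : ℕ) (I : Pt → ℝ) (p : Pt) : Prop :=
  ∃ x : ℝ × ℝ, (p.1 : ℝ) < x.1 ∧ x.1 < (p.1 : ℝ) + 1 ∧ (p.2 : ℝ) < x.2 ∧ x.2 < (p.2 : ℝ) + 1 ∧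
    IsSaddle n m I x

/-- A mix point: a saddle at an integer point. -/
def IsMixPoint (n m : ℕ) (I : Pt → ℝ) (p : Pt) : Prop :=
  p ∈ grid n m ∧ IsSaddle n m I (toPlane p)

/-! ### Neighborhoods and local extrema -/

/-- The 8-neighborhood within the image. -/
def n8 (n m : ℕ) (p : Pt) : Set Pt :=
  {q | q ∈ grid n m ∧ q ≠ p ∧ |q.1 - p.1| ≤ 1 ∧ |q.2 - p.2| ≤ 1}

/-- For 8-neighbors `p`, `q`: the segment from `p` to `q` is a diagonal of a pixel. -/
def IsDiagonal (p q : Pt) : Prop := p.1 ≠ q.1 ∧ p.2 ≠ q.2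

/-- The neighborhood `n(p)`: the 8-neighbors, without the diagonals that cross a split pixel. -/
def nbr (n m : ℕ) (I : Pt → ℝ) (p : Pt) : Set Pt :=
  {q | q ∈ n8 n m p ∧ ¬ (IsDiagonal p q ∧ IsSplitPixel n m I (min p.1 q.1, min p.2 q.2))}

/-- `p` is a local minimum of the image (with respect to the neighborhood `n`). -/
def IsImageLocalMin (n m : ℕ) (I : Pt → ℝ) (p : Pt) : Prop :=
  p ∈ grid n m ∧ ∀ q ∈ nbr n m I p, I p < I q

/-! ### The steepest graph -/

/-- A set of directed edges. -/
abbrev Edges := Set (Pt × Pt)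

/-- The edges of `S` if `P` holds, and the reversed edges otherwise. -/
def orientBy (P : Prop) (S : Edges) : Edges :=
  {e | (P ∧ e ∈ S) ∨ (¬ P ∧ e.swap ∈ S)}

/-- Step 1: the four sides of every split pixel. -/
def splitEdges (n m : ℕ) (I : Pt → ℝ) : Edges :=
  {e | ∃ i j : ℤ, IsSplitPixel n m I (i, j) ∧
    e ∈ orientBy (I (i, j) < I (i + 1, j))
      {((i, j), (i + 1, j)), ((i, j), (i, j + 1)),
        ((i + 1, j + 1), (i + 1, j)), ((i + 1, j + 1), (i, j + 1))}}

/-- Step 2: the four pixel sides that meet at a mix point. -/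
def mixEdges (n m : ℕ) (I : Pt → ℝ) : Edges :=
  {e | ∃ i j : ℤ, IsMixPoint n m I (i, j) ∧
    e ∈ orientBy (I (i, j) < I (i + 1, j))
      {((i, j), (i + 1, j)), ((i, j), (i - 1, j)),
        ((i, j - 1), (i, j)), ((i, j + 1), (i, j))}}

/-- A step of a discrete steepest path: `q` is a neighbor of `p` with a greater value, and no
neighbor of `p` has a value greater than that of `q`. -/
def IsSteepestStep (n m : ℕ) (I : Pt → ℝ) (p q : Pt) : Prop :=
  q ∈ nbr n m I p ∧ I p < I q ∧ ¬ ∃ p' ∈ nbr n m I p, I q < I p'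

/-- A discrete (increasing) steepest path. -/
def IsSteepestPath (n m : ℕ) (I : Pt → ℝ) (P : List Pt) : Prop :=
  (∀ p ∈ P, p ∈ grid n m) ∧ P.IsChain (IsSteepestStep n m I)

/-- Step 3: the edges of all discrete steepest paths. -/
def steepestEdges (n m : ℕ) (I : Pt → ℝ) : Edges :=
  {e | ∃ P : List Pt, IsSteepestPath n m I P ∧ [e.1, e.2] <:+: P}

/-- The neighborhood `n'(p)` relative to the edges `E` present so far: the points of `n(p)` without
the diagonals that cross a diagonal edge of `E`. -/
def nbrFree (n m : ℕ) (I : Pt → ℝ) (E : Edges) (p : Pt) : Set Pt :=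
  {q | q ∈ nbr n m I p ∧
    ¬ (IsDiagonal p q ∧
      (((p.1, q.2), (q.1, p.2)) ∈ E ∨ ((q.1, p.2), (p.1, q.2)) ∈ E))}

/-- The node `p` has no incoming edge. -/
def NoIncoming (E : Edges) (p : Pt) : Prop := ¬ ∃ q, (q, p) ∈ E

/-- One execution of step 4: a node `p` without incoming edges that is not a local minimum is
joined to its lowest neighbor among those in `n'(p)`. -/
def JoinStep (n m : ℕ) (I : Pt → ℝ) (E E' : Edges) : Prop :=
  ∃ p ∈ grid n m, NoIncoming E p ∧ ¬ IsImageLocalMin n m I p ∧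
    ∃ pL ∈ nbrFree n m I E p, I pL < I p ∧ (¬ ∃ p' ∈ nbrFree n m I E p, I p' < I pL) ∧
      E' = insert (pL, p) E

/-- `E` is the edge set of a steepest graph of the image `I` (with node set `grid n m`): it is
obtained from the edges of steps 1, 2 and 3 by executing step 4, in some order, until every node
without incoming edges is a local minimum. -/
def IsSteepestGraph (n m : ℕ) (I : Pt → ℝ) (E : Edges) : Prop :=
  Relation.ReflTransGen (JoinStep n m I)
      (splitEdges n m I ∪ mixEdges n m I ∪ steepestEdges n m I) E ∧
    ∀ p ∈ grid n m, NoIncoming E p → IsImageLocalMin n m I p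

/-! ### Min-max paths and regions -/

/-- A min-max path: a maximal directed path of the graph; no edge enters its first node and no edge
leaves its last node. -/
def IsMinMaxPath (n m : ℕ) (E : Edges) (P : List Pt) : Prop :=
  P ≠ [] ∧ (∀ p ∈ P, p ∈ grid n m) ∧ P.IsChain (fun p q => (p, q) ∈ E) ∧
    (∀ p ∈ P.head?, ¬ ∃ q, (q, p) ∈ E) ∧ (∀ p ∈ P.getLast?, ¬ ∃ q, (p, q) ∈ E)

/-- The union, in the plane, of the polylines of all min-max paths. -/
def minMaxLines (n m : ℕ) (E : Edges) : Set (ℝ × ℝ) :=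
  {x | ∃ P : List Pt, IsMinMaxPath n m E P ∧
    ((∃ p ∈ P, x = toPlane p) ∨
      ∃ p q : Pt, [p, q] <:+: P ∧ x ∈ segment ℝ (toPlane p) (toPlane q))}

/-- `C` is (the non-collapsed part of) a region of the partition of the image domain by the min-max
paths: a connected component of the complement of these paths in the domain. The collapsed part of
a region, where the two min-max paths that delimit it coincide and nothing lies between them, is
contained in the min-max paths and so belongs to no component. -/
def IsRegion (n m : ℕ) (E : Edges) (C : Set (ℝ × ℝ)) : Prop :=
  ∃ x ∈ domain n m \ minMaxLines n m E,
    C = connectedComponentIn (domain n m \ minMaxLines n m E) x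

/-- The perimeter of a region: its topological boundary in the plane. It is made of graph edges and,
for a region that reaches the border of the image, of sides of pixels on that border. -/
def perimeter (C : Set (ℝ × ℝ)) : Set (ℝ × ℝ) := frontier C

/-- A region is monotonic if, excluding its perimeter, it contains no saddles. -/
def IsMonotonicRegion (n m : ℕ) (I : Pt → ℝ) (C : Set (ℝ × ℝ)) : Prop :=
  ∀ x ∈ C \ perimeter C, ¬ IsSaddle n m I x

/-- The nodes on the perimeter of `C`. -/
def perimeterNodes (n m : ℕ) (C : Set (ℝ × ℝ)) : Set Pt :=
  {p | p ∈ grid n m ∧ toPlane p ∈ perimeter C}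

/-- `p` and `q` are consecutive nodes of the perimeter of `C`. -/
def PerimeterAdj (n m : ℕ) (C : Set (ℝ × ℝ)) (p q : Pt) : Prop :=
  p ∈ grid n m ∧ q ∈ n8 n m p ∧ segment ℝ (toPlane p) (toPlane q) ⊆ perimeter C

/-- The node `p` is a minimum of the image values along the perimeter of `C`. -/
def IsPerimeterMin (n m : ℕ) (I : Pt → ℝ) (C : Set (ℝ × ℝ)) (p : Pt) : Prop :=
  p ∈ perimeterNodes n m C ∧ ∀ q, PerimeterAdj n m C p q → I p < I q

/-- The node `p` is a maximum of the image values along the perimeter of `C`. -/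
def IsPerimeterMax (n m : ℕ) (I : Pt → ℝ) (C : Set (ℝ × ℝ)) (p : Pt) : Prop :=
  p ∈ perimeterNodes n m C ∧ ∀ q, PerimeterAdj n m C p q → I q < I p

end ImageGraph

namespace ImageGraph

/-! ### Sign patterns on a circle -/

/-! The proof is a discrete Gauss–Bonnet count. Every pixel is cut into two triangles, along the
diagonal edge of the graph if there is one. Up to points on the graph, a region is a union of such
triangles (cells), glued along common sides that are not edges. Since the region is connected, so is
the graph whose vertices are its cells and whose edges are the glued pairs
(`IsComponent.glued_graph_connected`).

At a node p, each of the eight directions carries the sign of I(q) - I(p), and a direction is a wall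
if it is an edge or lies on the image border. Let e(p) be the number of walls minus the number of
sign changes, both taken over the sectors of the region at p, where a sector owns the wall at which
it starts.

Globally, a triangle with three distinct values has a sign change only at its middle corner, so two
of its three corners have none. Each glued side is seen from its two ends. Hence the sum of e(p) is
2 (cells - glued pairs), which is at most 2 because a connected graph has at most one vertex more
than edges (`pixel_count`, `sum_weights`, `sum_weights_le`). Only this inequality is needed, so
nothing has to be known about holes of the region. The count of a pixel fails only if its corner
values alternate. Such a pixel is split (`isSplitPixel_of_alternating`), its diagonals are not
edges, and its saddle would lie in the interior of the region (`not_split_of_monotonic`).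

Locally, e(p) ≥ 0 at every node, and e(p) ≥ 1 at an extremum of the perimeter
(`NodeFan.card_changes_le`, `NodeFan.card_changes_lt`). Both follow from `NodeFan.not_two_changes`:
between consecutive walls the sign changes at most once. Two changes would enclose a run of
directions of one sign. A node with a greater (smaller) neighbor has an edge to a greater (smaller)
node, so a wall of this sign exists outside the run. Then there are four changes around p, the axes
alternate, p is a mix point, and all axes are walls, also the one in the run.

So there are at most two extrema (`not_three_extrema`). The least and the greatest perimeter node
are extrema, and they differ because every perimeter node has a consecutive one
(`exists_perimeterAdj`).

The analytic part only translates saddles into inequalities between grid values: mix points have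
alternating axis neighbors, split pixels have alternating corners. What is needed of the graph is
collected in `IsWellJoined`. -/

/-- Four points in cyclic order on which the sign of a periodic function alternates: on every
half-open period there is a positive value between two negative ones. -/
theorem exists_neg_pos_neg {g : ℝ → ℝ} (hg : ∀ (x : ℝ) (k : ℤ), g (x - k * (2 * Real.pi)) = g x)
    {θ₁ θ₂ θ₃ θ₄ : ℝ} (h14 : θ₁ > θ₄) (h42 : θ₄ > θ₂) (h23 : θ₂ > θ₃) (h31 : θ₃ > θ₁ - 2 * Real.pi)
    (g1 : 0 < g θ₁) (g2 : 0 < g θ₂) (g3 : g θ₃ < 0) (g4 : g θ₄ < 0) (τ : ℝ) :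
    ∃ x y z, τ ≤ x ∧ x < y ∧ y < z ∧ z < τ + 2 * Real.pi ∧ g x < 0 ∧ 0 < g y ∧ g z < 0 := by
  have hp := Real.pi_pos
  have hfl : ∀ θ : ℝ, ∃ k : ℤ,
      τ ≤ θ - k * (2 * Real.pi) ∧ θ - k * (2 * Real.pi) < τ + 2 * Real.pi := by
    intro θ
    refine ⟨⌊(θ - τ) / (2 * Real.pi)⌋, ?_, ?_⟩
    · have := Int.floor_le ((θ - τ) / (2 * Real.pi))
      rw [le_div_iff₀ (by positivity)] at this
      linarith
    · have := Int.lt_floor_add_one ((θ - τ) / (2 * Real.pi))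
      rw [div_lt_iff₀ (by positivity)] at this
      linarith
  have key : ∀ {a b : ℝ} {k l : ℤ}, a - k * (2 * Real.pi) < τ + 2 * Real.pi →
      τ ≤ b - l * (2 * Real.pi) → b < a → l ≤ k := by
    intro a b k l h1 h2 h3
    by_contra h
    have : (k : ℝ) + 1 ≤ l := by exact_mod_cast not_le.mp h
    nlinarith
  obtain ⟨k1, a1, b1⟩ := hfl θ₁
  obtain ⟨k2, a2, b2⟩ := hfl θ₂
  obtain ⟨k3, a3, b3⟩ := hfl θ₃
  obtain ⟨k4, a4, b4⟩ := hfl θ₄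
  -- The numbers of turns satisfy k1 ≥ k4 ≥ k2 ≥ k3 ≥ k1 - 1, so they drop at most once. The place
  -- of the drop determines the order of the shifted angles in the window.
  have e41 := key b1 a4 h14
  have e24 := key b4 a2 h42
  have e32 := key b2 a3 h23
  have e13 : k1 - 1 ≤ k3 := by
    refine key (a := θ₃) (b := θ₁ - 2 * Real.pi) b3 ?_ h31
    push_cast
    linarith
  rw [← hg _ k1] at g1
  rw [← hg _ k2] at g2
  rw [← hg _ k3] at g3
  rw [← hg _ k4] at g4
  by_cases c1 : k4 = k1
  · by_cases c2 : k2 = k4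
    · by_cases c3 : k3 = k2
      · subst c1 c2 c3
        exact ⟨_, _, _, a3, by linarith, by linarith, b4, g3, g2, g4⟩
      · have hk : k3 = k2 - 1 := by omega
        subst c1 c2 hk
        push_cast at *
        exact ⟨_, _, _, a4, by linarith, by linarith, b3, g4, g1, g3⟩
    · have hk2 : k2 = k4 - 1 := by omega
      have hk3 : k3 = k4 - 1 := by omega
      subst c1 hk2 hk3
      push_cast at *
      exact ⟨_, _, _, a4, by linarith, by linarith, b3, g4, g1, g3⟩
  · have hk4 : k4 = k1 - 1 := by omega
    have hk2 : k2 = k1 - 1 := by omega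
    have hk3 : k3 = k1 - 1 := by omega
    subst hk4 hk2 hk3
    push_cast at *
    exact ⟨_, _, _, a3, by linarith, by linarith, b4, g3, g2, g4⟩

/-- On a quarter circle, a function with positive derivative along the first axis and negative
derivative along the second one is decreasing. -/
theorem quarter_anti {a b c φ ψ : ℝ} (h0 : 0 ≤ φ) (h : φ < ψ) (h1 : ψ ≤ Real.pi / 2)
    (ha : |c| < a) (hb : |c| < -b) :
    a * Real.cos ψ + b * Real.sin ψ + c * (Real.cos ψ * Real.sin ψ) <
      a * Real.cos φ + b * Real.sin φ + c * (Real.cos φ * Real.sin φ) := by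
  have hp := Real.pi_pos
  have hc : Real.cos ψ < Real.cos φ :=
    Real.cos_lt_cos_of_nonneg_of_le_pi (by linarith) (by linarith) h
  have hs : Real.sin φ < Real.sin ψ :=
    Real.sin_lt_sin_of_lt_of_le_pi_div_two (by linarith) (by linarith) h
  have hc0 : 0 ≤ Real.cos ψ := Real.cos_nonneg_of_mem_Icc ⟨by linarith, by linarith⟩
  have hs0 : 0 ≤ Real.sin φ := Real.sin_nonneg_of_nonneg_of_le_pi (by linarith) (by linarith)
  have hc1 := Real.cos_le_one φ
  have hs1 := Real.sin_le_one ψ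
  obtain ⟨hc2, hc3⟩ := abs_le.mp (le_refl |c|)
  set x := Real.cos φ
  set x' := Real.cos ψ
  set y := Real.sin φ
  set y' := Real.sin ψ
  -- Changing one factor at a time, x y - x' y' = y' (x - x') - x (y' - y), so the difference of the
  -- two sides is the sum of two products. The mixed term is too small to change the sign of `a` or
  -- `b`.
  have e1 : 0 < (a + c * y') * (x - x') := by
    apply mul_pos _ (by linarith)
    have : |c| * y' ≤ |c| := by nlinarith [abs_nonneg c]
    nlinarith
  have e2 : 0 < (-b - c * x) * (y' - y) := by
    apply mul_pos _ (by linarith)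
    have : |c| * x ≤ |c| := by nlinarith [abs_nonneg c]
    nlinarith
  nlinarith

theorem quarter_pos {a b c φ : ℝ} (h0 : 0 ≤ φ) (h1 : φ ≤ Real.pi / 2)
    (ha : |c| < a) (hb : |c| < b) :
    0 < a * Real.cos φ + b * Real.sin φ + c * (Real.cos φ * Real.sin φ) := by
  have hp := Real.pi_pos
  have hc0 : 0 ≤ Real.cos φ := Real.cos_nonneg_of_mem_Icc ⟨by linarith, by linarith⟩
  have hs0 : 0 ≤ Real.sin φ := Real.sin_nonneg_of_nonneg_of_le_pi (by linarith) (by linarith)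
  have hc1 := Real.cos_le_one φ
  have h2 := Real.sin_sq_add_cos_sq φ
  have hcc := neg_abs_le c
  have hca := abs_nonneg c
  set x := Real.cos φ
  set y := Real.sin φ
  have e : -(|c| * y) ≤ c * (x * y) := by
    have : x * y ≤ y := by nlinarith
    have h3 : 0 ≤ x * y := by positivity
    nlinarith
  rcases hs0.eq_or_lt with h | h
  · have : x = 1 := by nlinarith
    rw [← h, this]
    linarith
  · have : 0 ≤ a * x := by
      apply mul_nonneg _ hc0
      linarith
    nlinarith

/-! ### Functions on the circle that are monotone or of one sign on each quarter. -/

/-- Description of a function on the circle by its four quarters: `A k` is the derivative along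
the axis `k` and `c k` the mixed term in the quarter between the axes `k` and `k + 1`. -/
structure QuarterForm (g : ℝ → ℝ) (A c : ℤ → ℝ) : Prop where
  eq : ∀ (k : ℤ) (φ : ℝ), 0 ≤ φ → φ ≤ Real.pi / 2 → g (k * (Real.pi / 2) + φ) =
    A k * Real.cos φ + A (k + 1) * Real.sin φ + c k * (Real.cos φ * Real.sin φ)
  left : ∀ k, |c k| < |A k|
  right : ∀ k, |c k| < |A (k + 1)|

namespace QuarterForm
variable {g : ℝ → ℝ} {A c : ℤ → ℝ}

theorem neg (h : QuarterForm g A c) :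
    QuarterForm (fun x => - g x) (fun k => - A k) (fun k => - c k) where
  eq k φ h0 h1 := by
    simp only [h.eq k φ h0 h1]
    ring
  left k := by simpa using h.left k
  right k := by simpa using h.right k

theorem pos_of (h : QuarterForm g A c) {k : ℤ} {x : ℝ} (hx : k * (Real.pi / 2) ≤ x)
    (hx' : x ≤ k * (Real.pi / 2) + Real.pi / 2) (h1 : 0 < A k) (h2 : 0 < A (k + 1)) : 0 < g x := by
  have e := h.eq k (x - k * (Real.pi / 2)) (by linarith) (by linarith)
  rw [add_sub_cancel] at e
  rw [e]
  have l := h.left k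
  have r := h.right k
  rw [abs_of_pos h1] at l
  rw [abs_of_pos h2] at r
  exact quarter_pos (by linarith) (by linarith) l r

theorem anti_of (h : QuarterForm g A c) {k : ℤ} {x y : ℝ} (hx : k * (Real.pi / 2) ≤ x)
    (hxy : x < y) (hy : y ≤ k * (Real.pi / 2) + Real.pi / 2) (h1 : 0 < A k) (h2 : A (k + 1) < 0) :
    g y < g x := by
  have e := h.eq k (x - k * (Real.pi / 2)) (by linarith) (by linarith)
  have e' := h.eq k (y - k * (Real.pi / 2)) (by linarith) (by linarith)
  rw [add_sub_cancel] at e e'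
  rw [e, e']
  have l := h.left k
  have r := h.right k
  rw [abs_of_pos h1] at l
  rw [abs_of_neg h2] at r
  exact quarter_anti (by linarith) (by linarith) (by linarith) l r

theorem neg_of (h : QuarterForm g A c) {k : ℤ} {x : ℝ} (hx : k * (Real.pi / 2) ≤ x)
    (hx' : x ≤ k * (Real.pi / 2) + Real.pi / 2) (h1 : A k < 0) (h2 : A (k + 1) < 0) : g x < 0 := by
  have := h.neg.pos_of hx hx' (by simpa using h1) (by simpa using h2)
  linarith

theorem mono_of (h : QuarterForm g A c) {k : ℤ} {x y : ℝ} (hx : k * (Real.pi / 2) ≤ x)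
    (hxy : x < y) (hy : y ≤ k * (Real.pi / 2) + Real.pi / 2) (h1 : A k < 0) (h2 : 0 < A (k + 1)) :
    g x < g y := by
  have := h.neg.anti_of hx hxy hy (by simpa using h1) (by simpa using h2)
  linarith

/-- If the function is positive along two subsequent axes, then it is not positive between two
negative values of the period that starts at the second one of these axes. -/
theorem not_neg_pos_neg (h : QuarterForm g A c) (hper : ∀ k, A (k + 4) = A k) {k : ℤ}
    (hk : 0 < A k) (hk1 : 0 < A (k + 1)) {x y z : ℝ}
    (hx : (k + 1 : ℤ) * (Real.pi / 2) ≤ x) (hxy : x < y) (hyz : y < z)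
    (hz : z < (k + 1 : ℤ) * (Real.pi / 2) + 2 * Real.pi)
    (gx : g x < 0) (gy : 0 < g y) (gz : g z < 0) : False := by
  have hne : ∀ j, A j ≠ 0 := fun j h0 => by
    have := h.left j
    rw [h0, abs_zero] at this
    exact absurd this (not_lt.mpr (abs_nonneg _))
  have t2 : ((k + 1 + 1 : ℤ) : ℝ) * (Real.pi / 2) = (k + 1 : ℤ) * (Real.pi / 2) + Real.pi / 2 := by
    push_cast; ring
  have t3 : ((k + 1 + 1 + 1 : ℤ) : ℝ) * (Real.pi / 2) = (k + 1 : ℤ) * (Real.pi / 2) + Real.pi := by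
    push_cast; ring
  have t4 : ((k + 1 + 1 + 1 + 1 : ℤ) : ℝ) * (Real.pi / 2) =
      (k + 1 : ℤ) * (Real.pi / 2) + 3 * (Real.pi / 2) := by
    push_cast; ring
  set τ := ((k + 1 : ℤ) : ℝ) * (Real.pi / 2)
  have hk4 : 0 < A (k + 1 + 1 + 1 + 1) := by
    rw [show k + 1 + 1 + 1 + 1 = k + 4 by ring, hper]; exact hk
  have hk5 : 0 < A (k + 1 + 1 + 1 + 1 + 1) := by
    rw [show k + 1 + 1 + 1 + 1 + 1 = k + 1 + 4 by ring, hper]; exact hk1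
  -- The last quarter of the period lies between the two positive axes, so the function is positive
  -- there.
  have hz4 : z < τ + 3 * (Real.pi / 2) := by
    by_contra hcon
    have := h.pos_of (k := k + 1 + 1 + 1 + 1) (x := z) (by linarith) (by linarith) hk4 hk5
    linarith
  -- On the other three quarters the signs of the two remaining axes decide: the function is of one
  -- sign between axes of equal sign and monotone between axes of opposite sign. Starting and ending
  -- positive, it has room for only one negative stretch.
  rcases (hne (k + 1 + 1)).lt_or_gt with h2 | h2 <;>
  rcases (hne (k + 1 + 1 + 1)).lt_or_gt with h3 | h3
  · -- positive, negative, negative, positive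
    rcases le_or_gt y (τ + Real.pi / 2) with hy | hy
    · have := h.anti_of (k := k + 1) (x := x) (y := y) hx hxy hy hk1 h2
      linarith
    · rcases le_or_gt y (τ + Real.pi) with hy' | hy'
      · have := h.neg_of (k := k + 1 + 1) (x := y) (by linarith) (by linarith) h2 h3
        linarith
      · have := h.mono_of (k := k + 1 + 1 + 1) (x := y) (y := z) (by linarith) hyz (by linarith)
          h3 hk4
        linarith
  · rcases le_or_gt y (τ + Real.pi / 2) with hy | hy
    · have := h.anti_of (k := k + 1) (x := x) (y := y) hx hxy hy hk1 h2
      linarith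
    · rcases le_or_gt z (τ + Real.pi) with hy' | hy'
      · have := h.mono_of (k := k + 1 + 1) (x := y) (y := z) (by linarith) hyz (by linarith) h2 h3
        linarith
      · have := h.pos_of (k := k + 1 + 1 + 1) (x := z) (by linarith) (by linarith) h3 hk4
        linarith
  · rcases le_or_gt y (τ + Real.pi) with hy | hy
    · rcases le_or_gt x (τ + Real.pi / 2) with hx' | hx'
      · have := h.pos_of (k := k + 1) (x := x) hx hx' hk1 h2
        linarith
      · have := h.anti_of (k := k + 1 + 1) (x := x) (y := y) (by linarith) hxy (by linarith) h2 h3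
        linarith
    · have := h.mono_of (k := k + 1 + 1 + 1) (x := y) (y := z) (by linarith) hyz (by linarith)
        h3 hk4
      linarith
  · rcases le_or_gt x (τ + Real.pi / 2) with hx' | hx'
    · have := h.pos_of (k := k + 1) (x := x) hx hx' hk1 h2
      linarith
    · rcases le_or_gt x (τ + Real.pi) with hx'' | hx''
      · have := h.pos_of (k := k + 1 + 1) (x := x) (by linarith) (by linarith) h2 h3
        linarith
      · have := h.pos_of (k := k + 1 + 1 + 1) (x := x) (by linarith) (by linarith) h3 hk4
        linarith

/-- If the sign of the function alternates on the circle, then it alternates along the axes. -/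
theorem alternates (h : QuarterForm g A c) (hper : ∀ k, A (k + 4) = A k)
    (hg : ∀ (x : ℝ) (k : ℤ), g (x - k * (2 * Real.pi)) = g x)
    {θ₁ θ₂ θ₃ θ₄ : ℝ} (h14 : θ₁ > θ₄) (h42 : θ₄ > θ₂) (h23 : θ₂ > θ₃) (h31 : θ₃ > θ₁ - 2 * Real.pi)
    (g1 : 0 < g θ₁) (g2 : 0 < g θ₂) (g3 : g θ₃ < 0) (g4 : g θ₄ < 0) (k : ℤ) :
    (0 < A k ∧ A (k + 1) < 0) ∨ (A k < 0 ∧ 0 < A (k + 1)) := by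
  have hne : ∀ j, A j ≠ 0 := fun j h0 => by
    have := h.left j
    rw [h0, abs_zero] at this
    exact absurd this (not_lt.mpr (abs_nonneg _))
  rcases (hne k).lt_or_gt with h1 | h1 <;> rcases (hne (k + 1)).lt_or_gt with h2 | h2
  · exfalso
    -- Two negative axes are two positive ones for the negated function. The positive points then
    -- have to come first, so the four angles move on by one place and θ₁ is taken one turn earlier.
    have g1' := hg θ₁ 1
    push_cast at g1'
    rw [one_mul] at g1'
    obtain ⟨x, y, z, hx, hxy, hyz, hz, gx, gy, gz⟩ := exists_neg_pos_neg (g := fun x => - g x)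
      (fun x k => by simp only [hg]) (θ₁ := θ₄) (θ₄ := θ₂) (θ₂ := θ₃) (θ₃ := θ₁ - 2 * Real.pi)
      h42 h23 h31 (by linarith) (by simpa using g4) (by simpa using g3)
      (by simpa [g1'] using g1) (by simpa using g2) ((k + 1 : ℤ) * (Real.pi / 2))
    exact h.neg.not_neg_pos_neg (fun j => by simp only [hper]) (k := k) (by simpa using h1)
      (by simpa using h2) hx hxy hyz hz gx gy gz
  · exact Or.inr ⟨h1, h2⟩
  · exact Or.inl ⟨h1, h2⟩
  · exfalso
    obtain ⟨x, y, z, hx, hxy, hyz, hz, gx, gy, gz⟩ := exists_neg_pos_neg hg h14 h42 h23 h31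
      g1 g2 g3 g4 ((k + 1 : ℤ) * (Real.pi / 2))
    exact h.not_neg_pos_neg hper h1 h2 hx hxy hyz hz gx gy gz

end QuarterForm

/-! ### Functions that are bilinear on each quadrant. -/

/-- A function that is bilinear on each of the four quadrants, with value `0` at the origin. -/
noncomputable def quadrantForm (A c : ZMod 4 → ℝ) (u v : ℝ) : ℝ :=
  A 0 * max u 0 + A 1 * max v 0 + A 2 * max (-u) 0 + A 3 * max (-v) 0 +
    (c 0 * (max u 0 * max v 0) + c 1 * (max (-u) 0 * max v 0) +
      c 2 * (max (-u) 0 * max (-v) 0) + c 3 * (max u 0 * max (-v) 0))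

/-- A quarter turn shifts the indices by one, so only the residue of `k` modulo 4 matters. In each
quarter two of the four truncations vanish. The factor `r` is left over from scaling a circle of
radius `r` to the unit circle. -/
theorem quadrantForm_quarterForm {A c : ZMod 4 → ℝ} {r : ℝ} (hr : 0 < r)
    (h1 : ∀ k l, |c k| * r < |A l|) :
    QuarterForm (fun θ => quadrantForm A (fun k => c k * r) (Real.cos θ) (Real.sin θ))
      (fun k => A k) (fun k => c k * r) where
  left k := by
    have := h1 k k
    simp only [abs_mul, abs_of_pos hr]
    exact this
  right k := by
    have := h1 k (k + 1 : ℤ)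
    simp only [abs_mul, abs_of_pos hr]
    exact this
  eq k φ h0 h2 := by
    have hp := Real.pi_pos
    have hc0 : 0 ≤ Real.cos φ := Real.cos_nonneg_of_mem_Icc ⟨by linarith, by linarith⟩
    have hs0 : 0 ≤ Real.sin φ := Real.sin_nonneg_of_nonneg_of_le_pi (by linarith) (by linarith)
    have hdiv := Int.emod_add_mul_ediv k 4
    have hk : ∀ q j : ℤ, k = j + 4 * q → (k : ℝ) * (Real.pi / 2) + φ =
        (φ + j * (Real.pi / 2)) + q * (2 * Real.pi) := by
      intro q j h
      rw [h]
      push_cast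
      ring
    have hz : ∀ q j : ℤ, k = j + 4 * q → (k : ZMod 4) = j := by
      intro q j h
      rw [h]
      push_cast
      have : (4 : ZMod 4) = 0 := rfl
      rw [this]
      ring
    have hj : k % 4 = 0 ∨ k % 4 = 1 ∨ k % 4 = 2 ∨ k % 4 = 3 := by omega
    simp only [quadrantForm]
    push_cast
    rcases hj with hj | hj | hj | hj <;> rw [hj] at hdiv
    · rw [hk _ _ hdiv.symm, hz _ _ hdiv.symm, Real.cos_add_int_mul_two_pi,
        Real.sin_add_int_mul_two_pi]
      have e : (((0 : ℤ) : ZMod 4) + 1) = 1 := by decide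
      rw [e]
      push_cast
      rw [zero_mul, add_zero, max_eq_left hc0, max_eq_left hs0, max_eq_right (neg_nonpos.mpr hc0),
        max_eq_right (neg_nonpos.mpr hs0)]
      ring
    · rw [hk _ _ hdiv.symm, hz _ _ hdiv.symm, Real.cos_add_int_mul_two_pi,
        Real.sin_add_int_mul_two_pi]
      have e : (((1 : ℤ) : ZMod 4) + 1) = 2 := by decide
      have e' : ((1 : ℤ) : ZMod 4) = 1 := by decide
      rw [e, e']
      push_cast
      rw [one_mul, Real.cos_add_pi_div_two, Real.sin_add_pi_div_two, neg_neg, max_eq_left hc0,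
        max_eq_left hs0, max_eq_right (neg_nonpos.mpr hc0), max_eq_right (neg_nonpos.mpr hs0)]
      ring
    · rw [hk _ _ hdiv.symm, hz _ _ hdiv.symm, Real.cos_add_int_mul_two_pi,
        Real.sin_add_int_mul_two_pi]
      have e : (((2 : ℤ) : ZMod 4) + 1) = 3 := by decide
      have e' : ((2 : ℤ) : ZMod 4) = 2 := by decide
      rw [e, e']
      push_cast
      rw [show φ + 2 * (Real.pi / 2) = φ + Real.pi by ring, Real.cos_add_pi, Real.sin_add_pi,
        neg_neg, neg_neg, max_eq_left hc0,
        max_eq_left hs0, max_eq_right (neg_nonpos.mpr hc0), max_eq_right (neg_nonpos.mpr hs0)]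
      ring
    · rw [hk _ _ hdiv.symm, hz _ _ hdiv.symm, Real.cos_add_int_mul_two_pi,
        Real.sin_add_int_mul_two_pi]
      have e : (((3 : ℤ) : ZMod 4) + 1) = 0 := by decide
      have e' : ((3 : ℤ) : ZMod 4) = 3 := by decide
      rw [e, e']
      push_cast
      rw [show φ + 3 * (Real.pi / 2) = φ + Real.pi / 2 + Real.pi by ring, Real.cos_add_pi,
        Real.sin_add_pi, Real.cos_add_pi_div_two, Real.sin_add_pi_div_two,
        neg_neg, neg_neg, max_eq_left hc0,
        max_eq_left hs0, max_eq_right (neg_nonpos.mpr hc0), max_eq_right (neg_nonpos.mpr hs0)]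
      ring

/-! ### The interpolation on a pixel -/

/-- The bilinear function that interpolates the values at the corners of the pixel `(i, j)`. -/
noncomputable def bilin (I : Pt → ℝ) (i j : ℤ) (x : ℝ × ℝ) : ℝ :=
  I (i, j) + (I (i + 1, j) - I (i, j)) * (x.1 - i) + (I (i, j + 1) - I (i, j)) * (x.2 - j) +
    (I (i + 1, j + 1) + I (i, j) - I (i + 1, j) - I (i, j + 1)) * ((x.1 - i) * (x.2 - j))

/-- The point is in the closed pixel. On its right or upper side the floor already belongs to the
next pixel, but the fractional part is 0 there, and both formulas reduce to the interpolation along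
the common side. -/
theorem interp_eq_bilin (I : Pt → ℝ) {i j : ℤ} {x : ℝ × ℝ} (h1 : (i : ℝ) ≤ x.1)
    (h2 : x.1 ≤ (i : ℝ) + 1) (h3 : (j : ℝ) ≤ x.2) (h4 : x.2 ≤ (j : ℝ) + 1) :
    interp I x = bilin I i j x := by
  have e1 : (⌊x.1⌋ = i ∧ Int.fract x.1 = x.1 - i) ∨
      (⌊x.1⌋ = i + 1 ∧ Int.fract x.1 = 0 ∧ x.1 = i + 1) := by
    rcases h2.lt_or_eq with h | h
    · have : ⌊x.1⌋ = i := Int.floor_eq_iff.mpr ⟨h1, h⟩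
      exact Or.inl ⟨this, by rw [Int.fract, this]⟩
    · have : x.1 = ((i + 1 : ℤ) : ℝ) := by push_cast; exact h
      exact Or.inr ⟨by rw [this, Int.floor_intCast], by rw [this, Int.fract_intCast], h⟩
  have e2 : (⌊x.2⌋ = j ∧ Int.fract x.2 = x.2 - j) ∨
      (⌊x.2⌋ = j + 1 ∧ Int.fract x.2 = 0 ∧ x.2 = j + 1) := by
    rcases h4.lt_or_eq with h | h
    · have : ⌊x.2⌋ = j := Int.floor_eq_iff.mpr ⟨h3, h⟩
      exact Or.inl ⟨this, by rw [Int.fract, this]⟩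
    · have : x.2 = ((j + 1 : ℤ) : ℝ) := by push_cast; exact h
      exact Or.inr ⟨by rw [this, Int.floor_intCast], by rw [this, Int.fract_intCast], h⟩
  unfold interp bilin
  rcases e1 with ⟨a, b⟩ | ⟨a, b, c⟩ <;> rcases e2 with ⟨a', b'⟩ | ⟨a', b', c'⟩
  · simp only [a, b, a', b']
  · simp only [a, b, a', b']; rw [c']; ring
  · simp only [a, b, a', b']; rw [c]; ring
  · simp only [a, b, a', b']; rw [c, c']; ring

/-- The interpolation near a grid point, by quadrants. -/
theorem interp_near_node (I : Pt → ℝ) (i j : ℤ) {u v : ℝ} (hu : |u| ≤ 1) (hv : |v| ≤ 1) :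
    interp I (i + u, j + v) = I (i, j) +
      ((I (i + 1, j) - I (i, j)) * max u 0 + (I (i, j + 1) - I (i, j)) * max v 0 +
        (I (i - 1, j) - I (i, j)) * max (-u) 0 + (I (i, j - 1) - I (i, j)) * max (-v) 0 +
      ((I (i + 1, j + 1) + I (i, j) - I (i + 1, j) - I (i, j + 1)) * (max u 0 * max v 0) +
        (I (i - 1, j + 1) + I (i, j) - I (i - 1, j) - I (i, j + 1)) * (max (-u) 0 * max v 0) +
        (I (i - 1, j - 1) + I (i, j) - I (i - 1, j) - I (i, j - 1)) * (max (-u) 0 * max (-v) 0) +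
        (I (i + 1, j - 1) + I (i, j) - I (i + 1, j) - I (i, j - 1)) *
          (max u 0 * max (-v) 0))) := by
  obtain ⟨u1, u2⟩ := abs_le.mp hu
  obtain ⟨v1, v2⟩ := abs_le.mp hv
  rcases le_total 0 u with hu0 | hu0 <;> rcases le_total 0 v with hv0 | hv0
  · rw [interp_eq_bilin I (i := i) (j := j) (by simpa using hu0) (by simpa using u2)
      (by simpa using hv0) (by simpa using v2), max_eq_left hu0, max_eq_left hv0,
      max_eq_right (neg_nonpos.mpr hu0), max_eq_right (neg_nonpos.mpr hv0)]
    simp only [bilin]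
    ring
  · rw [interp_eq_bilin I (i := i) (j := j - 1) (by simpa using hu0) (by simpa using u2)
      (by push_cast; linarith) (by push_cast; linarith), max_eq_left hu0, max_eq_right hv0,
      max_eq_right (neg_nonpos.mpr hu0), max_eq_left (neg_nonneg.mpr hv0)]
    simp only [bilin, sub_add_cancel]
    push_cast
    ring
  · rw [interp_eq_bilin I (i := i - 1) (j := j) (by push_cast; linarith) (by push_cast; linarith)
      (by simpa using hv0) (by simpa using v2), max_eq_right hu0, max_eq_left hv0,
      max_eq_left (neg_nonneg.mpr hu0), max_eq_right (neg_nonpos.mpr hv0)]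
    simp only [bilin, sub_add_cancel]
    push_cast
    ring
  · rw [interp_eq_bilin I (i := i - 1) (j := j - 1) (by push_cast; linarith)
      (by push_cast; linarith) (by push_cast; linarith) (by push_cast; linarith),
      max_eq_right hu0, max_eq_right hv0,
      max_eq_left (neg_nonneg.mpr hu0), max_eq_left (neg_nonneg.mpr hv0)]
    simp only [bilin, sub_add_cancel]
    push_cast
    ring

/-! ### Saddles from straight rays -/

theorem onCircle_mem_disc (p : ℝ × ℝ) {t r : ℝ} (ht : 0 ≤ t) (h : t ≤ r) (θ : ℝ) :
    onCircle p t θ ∈ disc p r := by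
  simp only [onCircle, disc, mem_ofPred_eq, add_sub_cancel_left]
  have e : (t * Real.cos θ) ^ 2 + (t * Real.sin θ) ^ 2 = t ^ 2 := by
    linear_combination t ^ 2 * Real.sin_sq_add_cos_sq θ
  rw [e]
  exact pow_le_pow_left₀ ht h 2

/-- All saddles that have to be constructed have straight increasing and decreasing rays. A ray that
is monotone on one disc can be cut off at any smaller radius, and a decreasing ray is run through
backwards. -/
theorem isSaddle_of_rays {n m : ℕ} {I : Pt → ℝ} {p : ℝ × ℝ} {δ : ℝ} (hδ : 0 < δ)
    {θ₁ θ₂ θ₃ θ₄ : ℝ} (h14 : θ₁ > θ₄) (h42 : θ₄ > θ₂) (h23 : θ₂ > θ₃) (h31 : θ₃ > θ₁ - 2 * Real.pi)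
    (hdom : ∀ t ∈ Icc 0 δ, ∀ θ, onCircle p t θ ∈ domain n m)
    (h1 : StrictMonoOn (fun t => interp I (onCircle p t θ₁)) (Icc 0 δ))
    (h2 : StrictMonoOn (fun t => interp I (onCircle p t θ₂)) (Icc 0 δ))
    (h3 : StrictAntiOn (fun t => interp I (onCircle p t θ₃)) (Icc 0 δ))
    (h4 : StrictAntiOn (fun t => interp I (onCircle p t θ₄)) (Icc 0 δ)) :
    IsSaddle n m I p := by
  intro ε hε
  have hr : 0 < min δ (ε / 2) := lt_min hδ (by linarith)
  have hrδ : min δ (ε / 2) ≤ δ := min_le_left _ _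
  have hrε : min δ (ε / 2) ≤ ε / 2 := min_le_right _ _
  set r := min δ (ε / 2)
  have hmem : ∀ t ∈ Icc (0 : ℝ) 1, t * r ∈ Icc 0 δ := fun t ht =>
    ⟨mul_nonneg ht.1 hr.le, by nlinarith [ht.2]⟩
  have up : ∀ θ, StrictMonoOn (fun t => interp I (onCircle p t θ)) (Icc 0 δ) →
      IsIncreasingPath I (domain n m ∩ disc p r) p (onCircle p r θ)
        (fun t => onCircle p (t * r) θ) := by
    intro θ hθ
    refine ⟨?_, ?_, ?_, ?_, ?_⟩
    · unfold onCircle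
      fun_prop
    · simp [onCircle]
    · simp [onCircle]
    · intro t ht
      exact ⟨hdom _ (hmem t ht) θ, onCircle_mem_disc p (hmem t ht).1 (by nlinarith [ht.2]) θ⟩
    · intro s hs t ht hst
      exact hθ (hmem s hs) (hmem t ht) (by nlinarith)
  have down : ∀ θ, StrictAntiOn (fun t => interp I (onCircle p t θ)) (Icc 0 δ) →
      IsIncreasingPath I (domain n m ∩ disc p r) (onCircle p r θ) p
        (fun t => onCircle p ((1 - t) * r) θ) := by
    intro θ hθ
    have hm : ∀ t ∈ Icc (0 : ℝ) 1, (1 - t) ∈ Icc (0 : ℝ) 1 := fun t ht =>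
      ⟨by linarith [ht.2], by linarith [ht.1]⟩
    refine ⟨?_, ?_, ?_, ?_, ?_⟩
    · unfold onCircle
      fun_prop
    · simp [onCircle]
    · simp [onCircle]
    · intro t ht
      have ht' := hm t ht
      exact ⟨hdom _ (hmem _ ht') θ, onCircle_mem_disc p (hmem _ ht').1 (by nlinarith [ht'.2]) θ⟩
    · intro s hs t ht hst
      exact hθ (hmem _ (hm t ht)) (hmem _ (hm s hs)) (by nlinarith)
  exact ⟨r, hr, by linarith, θ₁, θ₂, θ₃, θ₄, h14, h42, h23, h31, _, _, _, _,
    up _ h1, up _ h2, down _ h3, down _ h4⟩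

/-- The signs around a saddle, on arbitrarily small circles. -/
theorem IsSaddle.exists_signs {n m : ℕ} {I : Pt → ℝ} {p : ℝ × ℝ} (h : IsSaddle n m I p)
    {ε : ℝ} (hε : 0 < ε) : ∃ r, 0 < r ∧ r < ε ∧ ∃ θ₁ θ₂ θ₃ θ₄ : ℝ,
      θ₁ > θ₄ ∧ θ₄ > θ₂ ∧ θ₂ > θ₃ ∧ θ₃ > θ₁ - 2 * Real.pi ∧ p ∈ domain n m ∧
      onCircle p r θ₁ ∈ domain n m ∧ onCircle p r θ₂ ∈ domain n m ∧
      onCircle p r θ₃ ∈ domain n m ∧ onCircle p r θ₄ ∈ domain n m ∧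
      interp I p < interp I (onCircle p r θ₁) ∧ interp I p < interp I (onCircle p r θ₂) ∧
      interp I (onCircle p r θ₃) < interp I p ∧ interp I (onCircle p r θ₄) < interp I p := by
  obtain ⟨r, h0, h1, θ₁, θ₂, θ₃, θ₄, h14, h42, h23, h31, γ₁, γ₂, γ₃, γ₄, i1, i2, i3, i4⟩ := h ε hε
  have key : ∀ {a b γ}, IsIncreasingPath I (domain n m ∩ disc p r) a b γ →
      a ∈ domain n m ∧ b ∈ domain n m ∧ interp I a < interp I b := by
    rintro a b γ ⟨-, rfl, rfl, hS, hm⟩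
    have m0 : (0 : ℝ) ∈ Icc (0 : ℝ) 1 := ⟨le_rfl, zero_le_one⟩
    have m1 : (1 : ℝ) ∈ Icc (0 : ℝ) 1 := ⟨zero_le_one, le_rfl⟩
    exact ⟨(hS 0 m0).1, (hS 1 m1).1, hm m0 m1 zero_lt_one⟩
  exact ⟨r, h0, h1, θ₁, θ₂, θ₃, θ₄, h14, h42, h23, h31, (key i1).1, (key i1).2.1, (key i2).2.1,
    (key i3).1, (key i4).1, (key i1).2.2, (key i2).2.2, (key i3).2.2, (key i4).2.2⟩

/-! ### Mix points -/

/-- The corner values `a, b, d, c` of a pixel, in cyclic order, alternate. -/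
def Alternating (a b d c : ℝ) : Prop :=
  (b < a ∧ c < a ∧ b < d ∧ c < d) ∨ (a < b ∧ a < c ∧ d < b ∧ d < c)

theorem abs_mul_cos_le {r : ℝ} (h0 : 0 ≤ r) (h1 : r ≤ 1) (θ : ℝ) : |r * Real.cos θ| ≤ 1 := by
  rw [abs_mul, abs_of_nonneg h0]
  exact mul_le_one₀ h1 (abs_nonneg _) (Real.abs_cos_le_one θ)

theorem abs_mul_sin_le {r : ℝ} (h0 : 0 ≤ r) (h1 : r ≤ 1) (θ : ℝ) : |r * Real.sin θ| ≤ 1 := by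
  rw [abs_mul, abs_of_nonneg h0]
  exact mul_le_one₀ h1 (abs_nonneg _) (Real.abs_sin_le_one θ)

/-- The axis terms have degree one and the mixed terms degree two, so on small circles the mixed
terms become negligible against the axis terms. -/
theorem quadrantForm_mul (A c : ZMod 4 → ℝ) {r : ℝ} (hr : 0 ≤ r) (u v : ℝ) :
    quadrantForm A c (r * u) (r * v) = r * quadrantForm A (fun k => c k * r) u v := by
  have e : ∀ x : ℝ, max (r * x) 0 = r * max x 0 := fun x => by
    rw [mul_max_of_nonneg _ _ hr, mul_zero]
  simp only [quadrantForm, ← mul_neg, e]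
  ring

theorem exists_pos_radius (A c : ZMod 4 → ℝ) (hA : ∀ k, A k ≠ 0) :
    ∃ ε : ℝ, 0 < ε ∧ ε ≤ 1 ∧ ∀ r, 0 < r → r < ε → ∀ k l, |c k| * r < |A l| := by
  have : ∀ k l, ∃ ε : ℝ, 0 < ε ∧ ∀ r, 0 < r → r < ε → |c k| * r < |A l| := by
    intro k l
    have hp : 0 < |A l| := abs_pos.mpr (hA l)
    refine ⟨|A l| / (|c k| + 1), by positivity, fun r h0 h1 => ?_⟩
    rw [lt_div_iff₀ (by positivity)] at h1
    nlinarith [abs_nonneg (c k)]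
  choose e he he' using this
  have hne : (Finset.univ : Finset (ZMod 4 × ZMod 4)).Nonempty := ⟨(0, 0), Finset.mem_univ _⟩
  refine ⟨min 1 (Finset.univ.inf' hne fun q => e q.1 q.2), ?_, min_le_left _ _, ?_⟩
  · refine lt_min one_pos ?_
    rw [Finset.lt_inf'_iff]
    exact fun q _ => he _ _
  · intro r h0 h1 k l
    refine he' k l r h0 (h1.trans_le ((min_le_right _ _).trans ?_))
    exact Finset.inf'_le (fun q : ZMod 4 × ZMod 4 => e q.1 q.2) (Finset.mem_univ (k, l))

/-- If the signs of a piecewise bilinear function alternate on small circles, then they alternate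
along the axes. -/
theorem quadrantForm_alternates {A c : ZMod 4 → ℝ} {r : ℝ} (hr : 0 < r)
    (h : ∀ k l, |c k| * r < |A l|)
    {θ₁ θ₂ θ₃ θ₄ : ℝ} (h14 : θ₁ > θ₄) (h42 : θ₄ > θ₂) (h23 : θ₂ > θ₃) (h31 : θ₃ > θ₁ - 2 * Real.pi)
    (g1 : 0 < quadrantForm A c (r * Real.cos θ₁) (r * Real.sin θ₁))
    (g2 : 0 < quadrantForm A c (r * Real.cos θ₂) (r * Real.sin θ₂))
    (g3 : quadrantForm A c (r * Real.cos θ₃) (r * Real.sin θ₃) < 0)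
    (g4 : quadrantForm A c (r * Real.cos θ₄) (r * Real.sin θ₄) < 0) :
    (0 < A 0 ∧ A 1 < 0 ∧ 0 < A 2 ∧ A 3 < 0) ∨ (A 0 < 0 ∧ 0 < A 1 ∧ A 2 < 0 ∧ 0 < A 3) := by
  rw [quadrantForm_mul A c hr.le] at g1 g2 g3 g4
  have hq := quadrantForm_quarterForm hr h
  have key := hq.alternates
    (fun k => by push_cast; rw [show (4 : ZMod 4) = 0 from rfl, add_zero])
    (fun x k => by simp only [Real.cos_sub_int_mul_two_pi, Real.sin_sub_int_mul_two_pi])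
    h14 h42 h23 h31 (pos_of_mul_pos_right g1 hr.le) (pos_of_mul_pos_right g2 hr.le)
    (neg_of_mul_neg_right g3 hr.le) (neg_of_mul_neg_right g4 hr.le)
  have k0 := key 0
  have k1 := key 1
  have k2 := key 2
  push_cast at k0 k1 k2
  rcases k0 with k0 | k0 <;> rcases k1 with k1 | k1 <;> rcases k2 with k2 | k2
  · linarith [k0.2, k1.1]
  · linarith [k0.2, k1.1]
  · exact Or.inl ⟨k0.1, k0.2, k1.2, k2.2⟩
  · linarith [k1.2, k2.1]
  · linarith [k1.2, k2.1]
  · exact Or.inr ⟨k0.1, k0.2, k1.2, k2.2⟩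
  · linarith [k0.2, k1.1]
  · linarith [k0.2, k1.1]

theorem forall_zmod_four {P : ZMod 4 → Prop} (h0 : P 0) (h1 : P 1) (h2 : P 2) (h3 : P 3) (k) :
    P k := by
  change Fin 4 at k
  fin_cases k <;> assumption

/-- The signs of the image along the four axes at `(i, j)` alternate. -/
def MixSigns (I : Pt → ℝ) (i j : ℤ) : Prop :=
  (I (i, j) < I (i + 1, j) ∧ I (i, j) < I (i - 1, j) ∧ I (i, j + 1) < I (i, j) ∧
      I (i, j - 1) < I (i, j)) ∨
    (I (i + 1, j) < I (i, j) ∧ I (i - 1, j) < I (i, j) ∧ I (i, j) < I (i, j + 1) ∧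
      I (i, j) < I (i, j - 1))

/-- Near a node the interpolation minus the node value is a `quadrantForm` whose axis coefficients
are the differences to the four axis neighbors. These are nonzero as the values are distinct, so
alternation on a small circle forces alternation along the axes. -/
theorem mixSigns_of_isMixPoint {n m : ℕ} (hn : 2 ≤ n) (hm : 2 ≤ m) {I : Pt → ℝ}
    (hI : InjOn I (grid n m)) {i j : ℤ} (h : IsMixPoint n m I (i, j)) :
    0 < i ∧ i + 1 < n ∧ 0 < j ∧ j + 1 < m ∧ MixSigns I i j := by
  obtain ⟨⟨hi0, hi1, hj0, hj1⟩, hs⟩ := h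
  simp only at hi0 hi1 hj0 hj1
  have hne : ∀ {k l : ℤ}, 0 ≤ k → k < n → 0 ≤ l → l < m → (k ≠ i ∨ l ≠ j) →
      I (k, l) - I (i, j) ≠ 0 := by
    intro k l h1 h2 h3 h4 h5 h6
    have := hI (x₁ := (k, l)) (x₂ := (i, j)) ⟨h1, h2, h3, h4⟩ ⟨hi0, hi1, hj0, hj1⟩
      (sub_eq_zero.mp h6)
    rw [Prod.mk.injEq] at this
    omega
  have hnz : ∀ a : ℝ, a ≠ 0 → -a ≠ 0 := fun a h => neg_ne_zero.mpr h
  have a0 : i + 1 < n → I (i + 1, j) - I (i, j) ≠ 0 := fun h =>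
    hne (by omega) h hj0 hj1 (by omega)
  have a2 : 0 < i → I (i - 1, j) - I (i, j) ≠ 0 := fun h =>
    hne (by omega) (by omega) hj0 hj1 (by omega)
  have a1 : j + 1 < m → I (i, j + 1) - I (i, j) ≠ 0 := fun h =>
    hne hi0 hi1 (by omega) h (by omega)
  have a3 : 0 < j → I (i, j - 1) - I (i, j) ≠ 0 := fun h =>
    hne hi0 hi1 (by omega) (by omega) (by omega)
  classical
  set E := I (i + 1, j) - I (i, j)
  set N := I (i, j + 1) - I (i, j)
  set W := I (i - 1, j) - I (i, j)
  set S := I (i, j - 1) - I (i, j)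
  -- A coefficient pointing out of the domain is multiplied by 0 at points of the domain and can be
  -- chosen freely. The negated opposite difference is nonzero and gives opposite axes opposite
  -- signs, so the axes of a border node cannot alternate.
  let A : ZMod 4 → ℝ := fun k => (![if i + 1 < n then E else -W, if j + 1 < m then N else -S,
    if 0 < i then W else -E, if 0 < j then S else -N] : Fin 4 → ℝ) k
  let c : ZMod 4 → ℝ := fun k =>
    (![I (i + 1, j + 1) + I (i, j) - I (i + 1, j) - I (i, j + 1),
      I (i - 1, j + 1) + I (i, j) - I (i - 1, j) - I (i, j + 1),
      I (i - 1, j - 1) + I (i, j) - I (i - 1, j) - I (i, j - 1),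
      I (i + 1, j - 1) + I (i, j) - I (i + 1, j) - I (i, j - 1)] : Fin 4 → ℝ) k
  have A0 : A 0 = if i + 1 < n then E else -W := rfl
  have A1 : A 1 = if j + 1 < m then N else -S := rfl
  have A2 : A 2 = if 0 < i then W else -E := rfl
  have A3 : A 3 = if 0 < j then S else -N := rfl
  have hA : ∀ k, A k ≠ 0 := by
    refine forall_zmod_four ?_ ?_ ?_ ?_
    · rw [A0]; split_ifs with h; exacts [a0 h, hnz _ (a2 (by omega))]
    · rw [A1]; split_ifs with h; exacts [a1 h, hnz _ (a3 (by omega))]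
    · rw [A2]; split_ifs with h; exacts [a2 h, hnz _ (a0 (by omega))]
    · rw [A3]; split_ifs with h; exacts [a3 h, hnz _ (a1 (by omega))]
  obtain ⟨ε, hε0, hε1, hε⟩ := exists_pos_radius A c hA
  obtain ⟨r, hr0, hr, θ₁, θ₂, θ₃, θ₄, h14, h42, h23, h31, hp, d1, d2, d3, d4, g1, g2, g3, g4⟩ :=
    hs.exists_signs hε0
  have key : ∀ θ, onCircle (toPlane (i, j)) r θ ∈ domain n m →
      interp I (onCircle (toPlane (i, j)) r θ) = I (i, j) +
        quadrantForm A c (r * Real.cos θ) (r * Real.sin θ) := by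
    intro θ hθ
    obtain ⟨k1, k2, k3, k4⟩ := hθ
    simp only [onCircle, toPlane] at k1 k2 k3 k4 ⊢
    rw [interp_near_node I i j (abs_mul_cos_le hr0.le (by linarith) θ)
      (abs_mul_sin_le hr0.le (by linarith) θ)]
    set u := r * Real.cos θ
    set v := r * Real.sin θ
    have e0 : E * max u 0 = A 0 * max u 0 := by
      rw [A0]
      split_ifs with h
      · rfl
      · have : (n : ℝ) ≤ i + 1 := by exact_mod_cast not_lt.mp h
        rw [max_eq_right (by linarith)]; simp
    have e1 : N * max v 0 = A 1 * max v 0 := by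
      rw [A1]
      split_ifs with h
      · rfl
      · have : (m : ℝ) ≤ j + 1 := by exact_mod_cast not_lt.mp h
        rw [max_eq_right (by linarith)]; simp
    have e2 : W * max (-u) 0 = A 2 * max (-u) 0 := by
      rw [A2]
      split_ifs with h
      · rfl
      · have : (i : ℝ) ≤ 0 := by exact_mod_cast not_lt.mp h
        rw [max_eq_right (by linarith)]; simp
    have e3 : S * max (-v) 0 = A 3 * max (-v) 0 := by
      rw [A3]
      split_ifs with h
      · rfl
      · have : (j : ℝ) ≤ 0 := by exact_mod_cast not_lt.mp h
        rw [max_eq_right (by linarith)]; simp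
    rw [e0, e1, e2, e3]
    rfl
  have hv : interp I (toPlane (i, j)) = I (i, j) := by
    have := interp_near_node I i j (u := 0) (v := 0) (by simp) (by simp)
    simpa [toPlane] using this
  rw [hv, key _ d1] at g1
  rw [hv, key _ d2] at g2
  rw [hv, key _ d3] at g3
  rw [hv, key _ d4] at g4
  have alt := quadrantForm_alternates hr0 (hε r hr0 hr) h14 h42 h23 h31
    (by linarith) (by linarith) (by linarith) (by linarith)
  rw [A0, A1, A2, A3] at alt
  have hi : 0 < i ∧ i + 1 < n := by
    by_contra hcon
    split_ifs at alt <;> first | omega | (rcases alt with alt | alt <;> linarith [alt.1, alt.2.2.1])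
  have hj : 0 < j ∧ j + 1 < m := by
    by_contra hcon
    split_ifs at alt <;>
      first | omega | (rcases alt with alt | alt <;> linarith [alt.2.1, alt.2.2.2])
  rw [if_pos hi.1, if_pos hi.2, if_pos hj.1, if_pos hj.2] at alt
  refine ⟨hi.1, hi.2, hj.1, hj.2, ?_⟩
  rcases alt with ⟨h1, h2, h3, h4⟩ | ⟨h1, h2, h3, h4⟩
  · exact Or.inl ⟨sub_pos.mp h1, sub_pos.mp h3, sub_neg.mp h2, sub_neg.mp h4⟩
  · exact Or.inr ⟨sub_neg.mp h1, sub_neg.mp h3, sub_pos.mp h2, sub_pos.mp h4⟩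

/-- Along the axes the interpolation is linear, so the four axis rays witness the saddle. -/
theorem isMixPoint_of_mixSigns {n m : ℕ} {I : Pt → ℝ} {i j : ℤ}
    (hi0 : 0 < i) (hi1 : i + 1 < n) (hj0 : 0 < j) (hj1 : j + 1 < m) (h : MixSigns I i j) :
    IsMixPoint n m I (i, j) := by
  have hp := Real.pi_pos
  refine ⟨⟨hi0.le, by omega, hj0.le, by omega⟩, ?_⟩
  have r1 : (1 : ℝ) ≤ i := by exact_mod_cast hi0
  have r2 : (i : ℝ) + 1 ≤ n - 1 := by
    have : i + 1 + 1 ≤ (n : ℤ) := by omega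
    have : (i : ℝ) + 1 + 1 ≤ n := by exact_mod_cast this
    linarith
  have r3 : (1 : ℝ) ≤ j := by exact_mod_cast hj0
  have r4 : (j : ℝ) + 1 ≤ m - 1 := by
    have : j + 1 + 1 ≤ (m : ℤ) := by omega
    have : (j : ℝ) + 1 + 1 ≤ m := by exact_mod_cast this
    linarith
  have hdom : ∀ t ∈ Icc (0 : ℝ) 1, ∀ θ, onCircle (toPlane (i, j)) t θ ∈ domain n m := by
    intro t ht θ
    have c := abs_le.mp (abs_mul_cos_le ht.1 ht.2 θ)
    have s := abs_le.mp (abs_mul_sin_le ht.1 ht.2 θ)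
    refine ⟨?_, ?_, ?_, ?_⟩ <;> simp only [onCircle, toPlane] <;> linarith [c.1, c.2, s.1, s.2]
  have near : ∀ t ∈ Icc (0 : ℝ) 1, ∀ θ, interp I (onCircle (toPlane (i, j)) t θ) = _ :=
    fun t ht θ => interp_near_node I i j (abs_mul_cos_le ht.1 ht.2 θ) (abs_mul_sin_le ht.1 ht.2 θ)
  have f0 : ∀ t ∈ Icc (0 : ℝ) 1, interp I (onCircle (toPlane (i, j)) t 0) =
      I (i, j) + (I (i + 1, j) - I (i, j)) * t := fun t ht => by
    rw [near t ht]
    simp [ht.1]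
  have f1 : ∀ t ∈ Icc (0 : ℝ) 1, interp I (onCircle (toPlane (i, j)) t (Real.pi / 2)) =
      I (i, j) + (I (i, j + 1) - I (i, j)) * t := fun t ht => by
    rw [near t ht]
    simp [ht.1]
  have f2 : ∀ t ∈ Icc (0 : ℝ) 1, interp I (onCircle (toPlane (i, j)) t (-Real.pi)) =
      I (i, j) + (I (i - 1, j) - I (i, j)) * t := fun t ht => by
    rw [near t ht]
    simp [ht.1]
  have f3 : ∀ t ∈ Icc (0 : ℝ) 1, interp I (onCircle (toPlane (i, j)) t (-(Real.pi / 2))) =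
      I (i, j) + (I (i, j - 1) - I (i, j)) * t := fun t ht => by
    rw [near t ht]
    simp [ht.1]
  -- The upward ray again, one turn earlier: the four angles must be decreasing within one turn.
  have f1' : ∀ t ∈ Icc (0 : ℝ) 1, interp I (onCircle (toPlane (i, j)) t (-(Real.pi + Real.pi / 2)))
      = I (i, j) + (I (i, j + 1) - I (i, j)) * t := fun t ht => by
    rw [← f1 t ht]
    congr 1
    have e : -(Real.pi + Real.pi / 2) = Real.pi / 2 - 2 * Real.pi := by ring
    simp only [onCircle, e, Real.cos_sub_two_pi, Real.sin_sub_two_pi]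
  have mono : ∀ {θ a}, (∀ t ∈ Icc (0 : ℝ) 1, interp I (onCircle (toPlane (i, j)) t θ) =
      I (i, j) + (a - I (i, j)) * t) → I (i, j) < a →
      StrictMonoOn (fun t => interp I (onCircle (toPlane (i, j)) t θ)) (Icc 0 1) := by
    intro θ a h ha s hs t ht hst
    simp only [h s hs, h t ht]
    nlinarith
  have anti : ∀ {θ a}, (∀ t ∈ Icc (0 : ℝ) 1, interp I (onCircle (toPlane (i, j)) t θ) =
      I (i, j) + (a - I (i, j)) * t) → a < I (i, j) →
      StrictAntiOn (fun t => interp I (onCircle (toPlane (i, j)) t θ)) (Icc 0 1) := by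
    intro θ a h ha s hs t ht hst
    simp only [h s hs, h t ht]
    nlinarith
  rcases h with ⟨h1, h2, h3, h4⟩ | ⟨h1, h2, h3, h4⟩
  · exact isSaddle_of_rays one_pos (θ₁ := 0) (θ₄ := -(Real.pi / 2)) (θ₂ := -Real.pi)
      (θ₃ := -(Real.pi + Real.pi / 2)) (by linarith) (by linarith) (by linarith) (by linarith)
      hdom (mono f0 h1) (mono f2 h2) (anti f1' h3) (anti f3 h4)
  · exact isSaddle_of_rays one_pos (θ₁ := Real.pi / 2) (θ₄ := 0) (θ₂ := -(Real.pi / 2))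
      (θ₃ := -Real.pi) (by linarith) (by linarith) (by linarith) (by linarith)
      hdom (mono f1 h3) (mono f3 h4) (anti f2 h2) (anti f0 h1)

/-! ### Split pixels -/

/-- All corners of the pixel with lower left corner `p` are grid points. -/
def PixelIn (n m : ℕ) (p : Pt) : Prop := 0 ≤ p.1 ∧ p.1 + 1 < n ∧ 0 ≤ p.2 ∧ p.2 + 1 < m

/-- The sine has only one positive and one negative half period: once it is negative in the period
starting at 0, it stays negative up to its end. -/
theorem not_alternates_sin (ψ : ℝ) {θ₁ θ₂ θ₃ θ₄ : ℝ} (h14 : θ₁ > θ₄) (h42 : θ₄ > θ₂)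
    (h23 : θ₂ > θ₃) (h31 : θ₃ > θ₁ - 2 * Real.pi) (g1 : 0 < Real.sin (θ₁ + ψ))
    (g2 : 0 < Real.sin (θ₂ + ψ)) (g3 : Real.sin (θ₃ + ψ) < 0) (g4 : Real.sin (θ₄ + ψ) < 0) :
    False := by
  obtain ⟨x, y, z, hx, hxy, hyz, hz, gx, gy, gz⟩ := exists_neg_pos_neg (g := Real.sin)
    (fun x k => Real.sin_sub_int_mul_two_pi x k) (θ₁ := θ₁ + ψ) (θ₂ := θ₂ + ψ) (θ₃ := θ₃ + ψ)
    (θ₄ := θ₄ + ψ) (by linarith) (by linarith) (by linarith) (by linarith) g1 g2 g3 g4 0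
  have h1 : Real.pi < x := by
    by_contra h
    have := Real.sin_nonneg_of_nonneg_of_le_pi hx (not_lt.mp h)
    linarith
  have := Real.sin_neg_of_neg_of_neg_pi_lt (x := y - 2 * Real.pi) (by linarith) (by linarith)
  rw [Real.sin_sub_two_pi] at this
  linarith

theorem quadrantForm_of_bilinear (α β D u v : ℝ) :
    quadrantForm (fun k => (![α, β, -α, -β] : Fin 4 → ℝ) k)
      (fun k => (![D, -D, D, -D] : Fin 4 → ℝ) k) u v = α * u + β * v + D * (u * v) := by
  have hu := max_zero_sub_max_neg_zero_eq_self u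
  have hv := max_zero_sub_max_neg_zero_eq_self v
  change α * max u 0 + β * max v 0 + -α * max (-u) 0 + -β * max (-v) 0 +
    (D * (max u 0 * max v 0) + -D * (max (-u) 0 * max v 0) + D * (max (-u) 0 * max (-v) 0) +
      -D * (max u 0 * max (-v) 0)) = _
  rw [max_comm u, max_comm v, max_comm (-u), max_comm (-v)] at *
  generalize max 0 u = a at *
  generalize max 0 (-u) = b at *
  generalize max 0 v = c at *
  generalize max 0 (-v) = d at *
  subst hu hv
  ring

/-- Around a regular point of a bilinear function its signs on small circles do not alternate. -/
theorem bilinear_not_alternates {α β : ℝ} (D : ℝ) (h : α ≠ 0 ∨ β ≠ 0) :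
    ∃ ε > 0, ∀ r, 0 < r → r < ε → ∀ {θ₁ θ₂ θ₃ θ₄ : ℝ}, θ₁ > θ₄ → θ₄ > θ₂ → θ₂ > θ₃ →
      θ₃ > θ₁ - 2 * Real.pi →
      0 < α * (r * Real.cos θ₁) + β * (r * Real.sin θ₁) +
        D * ((r * Real.cos θ₁) * (r * Real.sin θ₁)) →
      0 < α * (r * Real.cos θ₂) + β * (r * Real.sin θ₂) +
        D * ((r * Real.cos θ₂) * (r * Real.sin θ₂)) →
      α * (r * Real.cos θ₃) + β * (r * Real.sin θ₃) +
        D * ((r * Real.cos θ₃) * (r * Real.sin θ₃)) < 0 →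
      α * (r * Real.cos θ₄) + β * (r * Real.sin θ₄) +
        D * ((r * Real.cos θ₄) * (r * Real.sin θ₄)) < 0 → False := by
  have hsmall : ∀ {γ r : ℝ}, 0 < r → r < |γ| / (|D| + 1) → |D| * r < |γ| := by
    intro γ r h0 h1
    rw [lt_div_iff₀ (by positivity)] at h1
    nlinarith [abs_nonneg D]
  -- If one partial derivative vanishes, the function factors on a small circle as a factor of
  -- constant sign times the sine (or the cosine), which has only two changes of sign.
  by_cases hα : α = 0
  · subst hα
    have hβ : β ≠ 0 := by simpa using h
    refine ⟨|β| / (|D| + 1), by positivity, fun r h0 h1 θ₁ θ₂ θ₃ θ₄ h14 h42 h23 h31 => ?_⟩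
    have hr := hsmall h0 h1
    have hb : ∀ θ, |D * (r * Real.cos θ)| < |β| := by
      intro θ
      rw [abs_mul, abs_mul, abs_of_pos h0]
      have := mul_le_of_le_one_right (mul_nonneg (abs_nonneg D) h0.le) (Real.abs_cos_le_one θ)
      linarith
    have e : ∀ θ, 0 * (r * Real.cos θ) + β * (r * Real.sin θ) +
        D * ((r * Real.cos θ) * (r * Real.sin θ)) =
        (β + D * (r * Real.cos θ)) * r * Real.sin θ := fun θ => by ring
    rw [e, e, e, e]
    intro g1 g2 g3 g4
    rcases hβ.lt_or_gt with hβ | hβ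
    · have hneg : ∀ θ, (β + D * (r * Real.cos θ)) * r < 0 := fun θ => by
        have := (abs_lt.mp (hb θ)).2
        rw [abs_of_neg hβ] at this
        exact mul_neg_of_neg_of_pos (by linarith) h0
      refine not_alternates_sin Real.pi h14 h42 h23 h31 ?_ ?_ ?_ ?_ <;> rw [Real.sin_add_pi]
      · have := neg_of_mul_pos_right g1 (hneg θ₁).le; linarith
      · have := neg_of_mul_pos_right g2 (hneg θ₂).le; linarith
      · have := pos_of_mul_neg_right g3 (hneg θ₃).le; linarith
      · have := pos_of_mul_neg_right g4 (hneg θ₄).le; linarith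
    · have hpos : ∀ θ, 0 < (β + D * (r * Real.cos θ)) * r := fun θ => by
        have := (abs_lt.mp (hb θ)).1
        rw [abs_of_pos hβ] at this
        exact mul_pos (by linarith) h0
      refine not_alternates_sin 0 h14 h42 h23 h31 ?_ ?_ ?_ ?_ <;> rw [add_zero]
      · exact pos_of_mul_pos_right g1 (hpos θ₁).le
      · exact pos_of_mul_pos_right g2 (hpos θ₂).le
      · exact neg_of_mul_neg_right g3 (hpos θ₃).le
      · exact neg_of_mul_neg_right g4 (hpos θ₄).le
  by_cases hβ : β = 0
  · subst hβ
    refine ⟨|α| / (|D| + 1), by positivity, fun r h0 h1 θ₁ θ₂ θ₃ θ₄ h14 h42 h23 h31 => ?_⟩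
    have hr := hsmall h0 h1
    have hb : ∀ θ, |D * (r * Real.sin θ)| < |α| := by
      intro θ
      rw [abs_mul, abs_mul, abs_of_pos h0]
      have := mul_le_of_le_one_right (mul_nonneg (abs_nonneg D) h0.le) (Real.abs_sin_le_one θ)
      linarith
    have e : ∀ θ, α * (r * Real.cos θ) + 0 * (r * Real.sin θ) +
        D * ((r * Real.cos θ) * (r * Real.sin θ)) =
        (α + D * (r * Real.sin θ)) * r * Real.cos θ := fun θ => by ring
    rw [e, e, e, e]
    intro g1 g2 g3 g4
    rcases (show α ≠ 0 from hα).lt_or_gt with hα | hα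
    · have hneg : ∀ θ, (α + D * (r * Real.sin θ)) * r < 0 := fun θ => by
        have := (abs_lt.mp (hb θ)).2
        rw [abs_of_neg hα] at this
        exact mul_neg_of_neg_of_pos (by linarith) h0
      refine not_alternates_sin (-(Real.pi / 2)) h14 h42 h23 h31 ?_ ?_ ?_ ?_ <;>
        rw [← sub_eq_add_neg, Real.sin_sub_pi_div_two]
      · have := neg_of_mul_pos_right g1 (hneg θ₁).le; linarith
      · have := neg_of_mul_pos_right g2 (hneg θ₂).le; linarith
      · have := pos_of_mul_neg_right g3 (hneg θ₃).le; linarith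
      · have := pos_of_mul_neg_right g4 (hneg θ₄).le; linarith
    · have hpos : ∀ θ, 0 < (α + D * (r * Real.sin θ)) * r := fun θ => by
        have := (abs_lt.mp (hb θ)).1
        rw [abs_of_pos hα] at this
        exact mul_pos (by linarith) h0
      refine not_alternates_sin (Real.pi / 2) h14 h42 h23 h31 ?_ ?_ ?_ ?_ <;>
        rw [Real.sin_add_pi_div_two]
      · exact pos_of_mul_pos_right g1 (hpos θ₁).le
      · exact pos_of_mul_pos_right g2 (hpos θ₂).le
      · exact neg_of_mul_neg_right g3 (hpos θ₃).le
      · exact neg_of_mul_neg_right g4 (hpos θ₄).le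
  -- If both are nonzero, opposite axes have opposite coefficients, so the signs along the axes do
  -- not alternate.
  · obtain ⟨ε, hε0, -, hε⟩ := exists_pos_radius (fun k => (![α, β, -α, -β] : Fin 4 → ℝ) k)
      (fun k => (![D, -D, D, -D] : Fin 4 → ℝ) k)
      (forall_zmod_four hα hβ (neg_ne_zero.mpr hα) (neg_ne_zero.mpr hβ))
    refine ⟨ε, hε0, fun r h0 h1 θ₁ θ₂ θ₃ θ₄ h14 h42 h23 h31 g1 g2 g3 g4 => ?_⟩
    rw [← quadrantForm_of_bilinear] at g1 g2 g3 g4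
    have := quadrantForm_alternates h0 (hε r h0 h1) h14 h42 h23 h31 g1 g2 g3 g4
    change (0 < α ∧ β < 0 ∧ 0 < -α ∧ -β < 0) ∨ (α < 0 ∧ 0 < β ∧ -α < 0 ∧ 0 < -β) at this
    rcases this with h | h <;> linarith [h.1, h.2.2.1]

theorem bilin_onCircle (I : Pt → ℝ) (i j : ℤ) (x : ℝ × ℝ) (r θ : ℝ) :
    bilin I i j (onCircle x r θ) = bilin I i j x +
      ((I (i + 1, j) - I (i, j) + (I (i + 1, j + 1) + I (i, j) - I (i + 1, j) - I (i, j + 1)) *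
          (x.2 - j)) * (r * Real.cos θ) +
        (I (i, j + 1) - I (i, j) + (I (i + 1, j + 1) + I (i, j) - I (i + 1, j) - I (i, j + 1)) *
          (x.1 - i)) * (r * Real.sin θ) +
        (I (i + 1, j + 1) + I (i, j) - I (i + 1, j) - I (i, j + 1)) *
          ((r * Real.cos θ) * (r * Real.sin θ))) := by
  simp only [bilin, onCircle]
  ring

/-- Around an inner point of a pixel the interpolation is bilinear. -/
theorem exists_radius_in_pixel {i j : ℤ} {x : ℝ × ℝ} (h1 : (i : ℝ) < x.1)
    (h2 : x.1 < (i : ℝ) + 1) (h3 : (j : ℝ) < x.2) (h4 : x.2 < (j : ℝ) + 1) :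
    ∃ ρ > 0, ∀ r, 0 ≤ r → r ≤ ρ → ∀ θ, ((i : ℝ) ≤ (onCircle x r θ).1 ∧
      (onCircle x r θ).1 ≤ (i : ℝ) + 1 ∧ (j : ℝ) ≤ (onCircle x r θ).2 ∧
      (onCircle x r θ).2 ≤ (j : ℝ) + 1) := by
  refine ⟨min (min (x.1 - i) (i + 1 - x.1)) (min (x.2 - j) (j + 1 - x.2)),
    lt_min (lt_min (by linarith) (by linarith)) (lt_min (by linarith) (by linarith)), ?_⟩
  intro r h0 hr θ
  have r1 := hr.trans ((min_le_left _ _).trans (min_le_left _ _))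
  have r2 := hr.trans ((min_le_left _ _).trans (min_le_right _ _))
  have r3 := hr.trans ((min_le_right _ _).trans (min_le_left _ _))
  have r4 := hr.trans ((min_le_right _ _).trans (min_le_right _ _))
  have c1 := Real.cos_le_one θ
  have c2 := Real.neg_one_le_cos θ
  have s1 := Real.sin_le_one θ
  have s2 := Real.neg_one_le_sin θ
  refine ⟨?_, ?_, ?_, ?_⟩ <;> simp only [onCircle] <;> nlinarith

/-- A saddle inside a pixel is a critical point of the bilinear function. Vanishing of both partial
derivatives expresses every difference along a side as plus or minus the mixed coefficient `D` times
a positive distance, so the sign of `D` orders all four pairs of adjacent corners. `D = 0` would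
make two corner values equal. -/
theorem alternating_of_isSplitPixel {n m : ℕ} {I : Pt → ℝ} (hI : InjOn I (grid n m)) {i j : ℤ}
    (h : IsSplitPixel n m I (i, j)) : PixelIn n m (i, j) ∧
      Alternating (I (i, j)) (I (i + 1, j)) (I (i + 1, j + 1)) (I (i, j + 1)) := by
  obtain ⟨x, h1, h2, h3, h4, hs⟩ := h
  simp only at h1 h2 h3 h4
  obtain ⟨ρ, hρ, hpix⟩ := exists_radius_in_pixel h1 h2 h3 h4
  have hin : PixelIn n m (i, j) := by
    obtain ⟨r, -, -, θ₁, θ₂, θ₃, θ₄, -, -, -, -, ⟨k1, k2, k3, k4⟩, -⟩ := hs.exists_signs one_pos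
    refine ⟨?_, ?_, ?_, ?_⟩ <;> simp only
    · have : (-1 : ℝ) < i := by linarith
      have : -1 < i := by exact_mod_cast this
      omega
    · have : (i : ℝ) + 1 < n := by linarith
      exact_mod_cast this
    · have : (-1 : ℝ) < j := by linarith
      have : -1 < j := by exact_mod_cast this
      omega
    · have : (j : ℝ) + 1 < m := by linarith
      exact_mod_cast this
  refine ⟨hin, ?_⟩
  obtain ⟨i0, i1, j0, j1⟩ := hin
  simp only at i0 i1 j0 j1
  have hval : ∀ r, 0 ≤ r → r ≤ ρ → ∀ θ, interp I (onCircle x r θ) =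
      bilin I i j (onCircle x r θ) := fun r r0 r1 θ => by
    obtain ⟨k1, k2, k3, k4⟩ := hpix r r0 r1 θ
    exact interp_eq_bilin I k1 k2 k3 k4
  have hx : interp I x = bilin I i j x := interp_eq_bilin I h1.le h2.le h3.le h4.le
  by_cases hreg : (I (i + 1, j) - I (i, j) +
        (I (i + 1, j + 1) + I (i, j) - I (i + 1, j) - I (i, j + 1)) * (x.2 - j)) ≠ 0 ∨
      (I (i, j + 1) - I (i, j) +
        (I (i + 1, j + 1) + I (i, j) - I (i + 1, j) - I (i, j + 1)) * (x.1 - i)) ≠ 0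
  · exfalso
    obtain ⟨ε, hε, hno⟩ := bilinear_not_alternates
      (I (i + 1, j + 1) + I (i, j) - I (i + 1, j) - I (i, j + 1)) hreg
    obtain ⟨r, r0, r1, θ₁, θ₂, θ₃, θ₄, h14, h42, h23, h31, -, -, -, -, -, g1, g2, g3, g4⟩ :=
      hs.exists_signs (lt_min hε hρ)
    have rρ := (r1.trans_le (min_le_right _ _)).le
    rw [hx, hval r r0.le rρ, bilin_onCircle] at g1 g2 g3 g4
    exact hno r r0 (r1.trans_le (min_le_left _ _)) h14 h42 h23 h31 (by linarith) (by linarith)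
      (by linarith) (by linarith)
  · push Not at hreg
    obtain ⟨e1, e2⟩ := hreg
    set D := I (i + 1, j + 1) + I (i, j) - I (i + 1, j) - I (i, j + 1) with hD
    have hz0 : 0 < x.1 - i := by linarith
    have hz1 : 0 < 1 - (x.1 - i) := by linarith
    have hw0 : 0 < x.2 - j := by linarith
    have hw1 : 0 < 1 - (x.2 - j) := by linarith
    have d1 : I (i + 1, j) - I (i, j) = - (D * (x.2 - j)) := by linarith
    have d2 : I (i, j + 1) - I (i, j) = - (D * (x.1 - i)) := by linarith
    have d3 : I (i + 1, j + 1) - I (i + 1, j) = D * (1 - (x.1 - i)) := by linarith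
    have d4 : I (i + 1, j + 1) - I (i, j + 1) = D * (1 - (x.2 - j)) := by linarith
    rcases lt_trichotomy D 0 with hD0 | hD0 | hD0
    · right
      have := mul_neg_of_neg_of_pos hD0 hz0
      have := mul_neg_of_neg_of_pos hD0 hz1
      have := mul_neg_of_neg_of_pos hD0 hw0
      have := mul_neg_of_neg_of_pos hD0 hw1
      refine ⟨?_, ?_, ?_, ?_⟩ <;> linarith
    · rw [hD0] at d1
      have := hI (x₁ := (i + 1, j)) (x₂ := (i, j))
        ⟨by simp; omega, by simpa using i1, j0, by simp; omega⟩
        ⟨i0, by simp; omega, j0, by simp; omega⟩ (by linarith)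
      rw [Prod.mk.injEq] at this
      omega
    · left
      have := mul_pos hD0 hz0
      have := mul_pos hD0 hz1
      have := mul_pos hD0 hw0
      have := mul_pos hD0 hw1
      refine ⟨?_, ?_, ?_, ?_⟩ <;> linarith

/-- Alternating corners put the critical point of the bilinear function inside the pixel. From there
the function changes by D/2 · sin(2θ) · t² along the ray at angle θ, so the four rays parallel to
the diagonals are monotone with alternating direction. -/
theorem isSplitPixel_of_alternating {n m : ℕ} {I : Pt → ℝ} {i j : ℤ} (hin : PixelIn n m (i, j))
    (h : Alternating (I (i, j)) (I (i + 1, j)) (I (i + 1, j + 1)) (I (i, j + 1))) :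
    IsSplitPixel n m I (i, j) := by
  have hp := Real.pi_pos
  obtain ⟨i0, i1, j0, j1⟩ := hin
  simp only at i0 i1 j0 j1
  set D := I (i + 1, j + 1) + I (i, j) - I (i + 1, j) - I (i, j + 1) with hD
  have hz : 0 < (I (i, j) - I (i, j + 1)) / D ∧ (I (i, j) - I (i, j + 1)) / D < 1 := by
    rcases h with ⟨h1, h2, h3, h4⟩ | ⟨h1, h2, h3, h4⟩
    · have hD0 : 0 < D := by linarith
      exact ⟨div_pos (by linarith) hD0, (div_lt_one hD0).mpr (by linarith)⟩
    · have hD0 : D < 0 := by linarith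
      exact ⟨div_pos_of_neg_of_neg (by linarith) hD0, (div_lt_one_of_neg hD0).mpr (by linarith)⟩
  have hw : 0 < (I (i, j) - I (i + 1, j)) / D ∧ (I (i, j) - I (i + 1, j)) / D < 1 := by
    rcases h with ⟨h1, h2, h3, h4⟩ | ⟨h1, h2, h3, h4⟩
    · have hD0 : 0 < D := by linarith
      exact ⟨div_pos (by linarith) hD0, (div_lt_one hD0).mpr (by linarith)⟩
    · have hD0 : D < 0 := by linarith
      exact ⟨div_pos_of_neg_of_neg (by linarith) hD0, (div_lt_one_of_neg hD0).mpr (by linarith)⟩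
  have hDne : D ≠ 0 := by
    rcases h with ⟨h1, h2, h3, h4⟩ | ⟨h1, h2, h3, h4⟩
    · exact (show 0 < D by linarith).ne'
    · exact (show D < 0 by linarith).ne
  -- The offsets `z` and `w` solve the two equations that make the partial derivatives vanish.
  set z := (I (i, j) - I (i, j + 1)) / D with hzd
  set w := (I (i, j) - I (i + 1, j)) / D with hwd
  have ez : D * z = I (i, j) - I (i, j + 1) := by rw [hzd]; field_simp
  have ew : D * w = I (i, j) - I (i + 1, j) := by rw [hwd]; field_simp
  have k1 : (i : ℝ) < i + z := by linarith
  have k2 : (i : ℝ) + z < i + 1 := by linarith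
  have k3 : (j : ℝ) < j + w := by linarith
  have k4 : (j : ℝ) + w < j + 1 := by linarith
  refine ⟨(i + z, j + w), k1, k2, k3, k4, ?_⟩
  obtain ⟨ρ, hρ, hpix⟩ := exists_radius_in_pixel (x := (i + z, j + w)) k1 k2 k3 k4
  have hdom : ∀ t ∈ Icc (0 : ℝ) ρ, ∀ θ, onCircle (i + z, j + w) t θ ∈ domain n m := by
    intro t ht θ
    obtain ⟨q1, q2, q3, q4⟩ := hpix t ht.1 ht.2 θ
    have r1 : (0 : ℝ) ≤ i := by exact_mod_cast i0
    have r2 : (i : ℝ) + 1 ≤ n - 1 := by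
      have : i + 1 + 1 ≤ (n : ℤ) := by omega
      have : (i : ℝ) + 1 + 1 ≤ n := by exact_mod_cast this
      linarith
    have r3 : (0 : ℝ) ≤ j := by exact_mod_cast j0
    have r4 : (j : ℝ) + 1 ≤ m - 1 := by
      have : j + 1 + 1 ≤ (m : ℤ) := by omega
      have : (j : ℝ) + 1 + 1 ≤ m := by exact_mod_cast this
      linarith
    exact ⟨by linarith, by linarith, by linarith, by linarith⟩
  have hval : ∀ t ∈ Icc (0 : ℝ) ρ, ∀ θ, interp I (onCircle (i + z, j + w) t θ) =
      bilin I i j (i + z, j + w) + D / 2 * Real.sin (2 * θ) * t ^ 2 := by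
    intro t ht θ
    obtain ⟨q1, q2, q3, q4⟩ := hpix t ht.1 ht.2 θ
    rw [interp_eq_bilin I q1 q2 q3 q4, bilin_onCircle, Real.sin_two_mul]
    simp only [add_sub_cancel_left]
    rw [← hD, ez, ew]
    ring
  have mono : ∀ θ, 0 < D * Real.sin (2 * θ) →
      StrictMonoOn (fun t => interp I (onCircle (i + z, j + w) t θ)) (Icc 0 ρ) := by
    intro θ h0 s hs t ht hst
    simp only [hval s hs, hval t ht]
    have : s ^ 2 < t ^ 2 := pow_lt_pow_left₀ hst hs.1 two_ne_zero
    nlinarith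
  have anti : ∀ θ, D * Real.sin (2 * θ) < 0 →
      StrictAntiOn (fun t => interp I (onCircle (i + z, j + w) t θ)) (Icc 0 ρ) := by
    intro θ h0 s hs t ht hst
    simp only [hval s hs, hval t ht]
    have : s ^ 2 < t ^ 2 := pow_lt_pow_left₀ hst hs.1 two_ne_zero
    nlinarith
  have s1 : Real.sin (2 * (Real.pi / 4)) = 1 := by
    rw [show 2 * (Real.pi / 4) = Real.pi / 2 by ring, Real.sin_pi_div_two]
  have s2 : Real.sin (2 * (-(Real.pi / 4))) = -1 := by
    rw [show 2 * (-(Real.pi / 4)) = -(Real.pi / 2) by ring, Real.sin_neg, Real.sin_pi_div_two]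
  have s3 : Real.sin (2 * (-(3 * Real.pi / 4))) = 1 := by
    rw [show 2 * (-(3 * Real.pi / 4)) = Real.pi / 2 - 2 * Real.pi by ring, Real.sin_sub_two_pi,
      Real.sin_pi_div_two]
  have s4 : Real.sin (2 * (3 * Real.pi / 4)) = -1 := by
    rw [show 2 * (3 * Real.pi / 4) = Real.pi / 2 + Real.pi by ring, Real.sin_add_pi,
      Real.sin_pi_div_two]
  have s5 : Real.sin (2 * (-(5 * Real.pi / 4))) = -1 := by
    rw [show 2 * (-(5 * Real.pi / 4)) = -(Real.pi / 2) - 2 * Real.pi by ring, Real.sin_sub_two_pi,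
      Real.sin_neg, Real.sin_pi_div_two]
  rcases h with ⟨h1, h2, h3, h4⟩ | ⟨h1, h2, h3, h4⟩
  · have hD0 : 0 < D := by linarith
    exact isSaddle_of_rays hρ (θ₁ := Real.pi / 4) (θ₄ := -(Real.pi / 4))
      (θ₂ := -(3 * Real.pi / 4)) (θ₃ := -(5 * Real.pi / 4)) (by linarith) (by linarith)
      (by linarith) (by linarith) hdom (mono _ (by rw [s1]; linarith))
      (mono _ (by rw [s3]; linarith)) (anti _ (by rw [s5]; linarith))
      (anti _ (by rw [s2]; linarith))
  · have hD0 : D < 0 := by linarith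
    exact isSaddle_of_rays hρ (θ₁ := 3 * Real.pi / 4) (θ₄ := Real.pi / 4)
      (θ₂ := -(Real.pi / 4)) (θ₃ := -(3 * Real.pi / 4)) (by linarith) (by linarith)
      (by linarith) (by linarith) hdom (mono _ (by rw [s4]; linarith))
      (mono _ (by rw [s2]; linarith)) (anti _ (by rw [s3]; linarith))
      (anti _ (by rw [s1]; linarith))

/-! ### Neighborhoods -/

theorem grid_finite (n m : ℕ) : (grid n m).Finite := by
  refine ((finite_Icc (0 : ℤ) n).prod (finite_Icc (0 : ℤ) m)).subset ?_
  rintro ⟨i, j⟩ ⟨h1, h2, h3, h4⟩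
  exact ⟨⟨h1, h2.le⟩, h3, h4.le⟩

theorem nbr_symm {n m : ℕ} {I : Pt → ℝ} {p q : Pt} (hp : p ∈ grid n m) (h : q ∈ nbr n m I p) :
    p ∈ nbr n m I q := by
  obtain ⟨⟨hq, hne, h1, h2⟩, hd⟩ := h
  refine ⟨⟨hp, hne.symm, by rwa [abs_sub_comm], by rwa [abs_sub_comm]⟩, ?_⟩
  rintro ⟨⟨d1, d2⟩, hs⟩
  rw [min_comm, min_comm q.2] at hs
  exact hd ⟨⟨d1.symm, d2.symm⟩, hs⟩

theorem mem_nbr_of_axis {n m : ℕ} {I : Pt → ℝ} {p q : Pt} (hq : q ∈ grid n m) (hne : q ≠ p)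
    (h1 : |q.1 - p.1| ≤ 1) (h2 : |q.2 - p.2| ≤ 1) (h : p.1 = q.1 ∨ p.2 = q.2) :
    q ∈ nbr n m I p := by
  refine ⟨⟨hq, hne, h1, h2⟩, ?_⟩
  rintro ⟨⟨d1, d2⟩, -⟩
  exact h.elim d1 d2

/-! ### The edges of the steepest graph -/

/-- `p` and `q` are joined by an edge, in one of the two directions. -/
def Joined (E : Edges) (p q : Pt) : Prop := (p, q) ∈ E ∨ (q, p) ∈ E

/-- The properties of the edges of a steepest graph on which the shape of the regions depends. -/
structure IsWellJoined (n m : ℕ) (I : Pt → ℝ) (J : Pt → Pt → Prop) : Prop where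
  symm : ∀ {p q}, J p q → J q p
  mem_nbr : ∀ {p q}, J p q → q ∈ nbr n m I p
  not_cross : ∀ {i j : ℤ}, J (i, j) (i + 1, j + 1) → ¬ J (i + 1, j) (i, j + 1)
  up : ∀ {p q}, p ∈ grid n m → q ∈ nbr n m I p → I p < I q → ∃ y, J p y ∧ I p < I y
  down : ∀ {p q}, p ∈ grid n m → q ∈ nbr n m I p → I q < I p → ∃ y, J p y ∧ I y < I p
  mix : ∀ {i j : ℤ}, 0 < i → i + 1 < n → 0 < j → j + 1 < m → MixSigns I i j →
    J (i, j) (i + 1, j) ∧ J (i, j) (i - 1, j) ∧ J (i, j) (i, j + 1) ∧ J (i, j) (i, j - 1)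

/-- The invariants of the construction of a steepest graph. -/
structure EdgeInvariant (n m : ℕ) (I : Pt → ℝ) (E : Edges) : Prop where
  step : ∀ {p q}, (p, q) ∈ E → p ∈ grid n m ∧ q ∈ nbr n m I p ∧ I p < I q
  not_cross : ∀ {p q}, (p, q) ∈ E → IsDiagonal p q →
    ((p.1, q.2), (q.1, p.2)) ∉ E ∧ ((q.1, p.2), (p.1, q.2)) ∉ E
  subset : splitEdges n m I ∪ mixEdges n m I ∪ steepestEdges n m I ⊆ E

theorem steepestEdges_step {n m : ℕ} {I : Pt → ℝ} {p q : Pt} (h : (p, q) ∈ steepestEdges n m I) :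
    p ∈ grid n m ∧ IsSteepestStep n m I p q := by
  obtain ⟨P, ⟨hP, hc⟩, hi⟩ := h
  have := hc.infix hi
  simp only [List.isChain_cons_cons] at this
  exact ⟨hP p (hi.subset (by simp)), this.1⟩

theorem mem_steepestEdges {n m : ℕ} {I : Pt → ℝ} {p q : Pt} (hp : p ∈ grid n m)
    (h : IsSteepestStep n m I p q) : (p, q) ∈ steepestEdges n m I := by
  refine ⟨[p, q], ⟨?_, ?_⟩, List.infix_refl _⟩
  · intro x hx
    simp only [List.mem_cons, List.not_mem_nil, or_false] at hx
    rcases hx with rfl | rfl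
    exacts [hp, h.1.1.1]
  · simp [h]

theorem splitEdges_step {n m : ℕ} {I : Pt → ℝ} (hI : InjOn I (grid n m)) {p q : Pt}
    (h : (p, q) ∈ splitEdges n m I) :
    (p ∈ grid n m ∧ q ∈ nbr n m I p ∧ I p < I q) ∧ ¬ IsDiagonal p q := by
  obtain ⟨i, j, hs, he⟩ := h
  obtain ⟨⟨i0, i1, j0, j1⟩, halt⟩ := alternating_of_isSplitPixel hI hs
  simp only at i0 i1 j0 j1
  have ga : ((i, j) : Pt) ∈ grid n m := ⟨i0, by simp; omega, j0, by simp; omega⟩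
  have gb : ((i + 1, j) : Pt) ∈ grid n m := ⟨by simp; omega, i1, j0, by simp; omega⟩
  have gc : ((i, j + 1) : Pt) ∈ grid n m := ⟨i0, by simp; omega, by simp; omega, j1⟩
  have gd : ((i + 1, j + 1) : Pt) ∈ grid n m := ⟨by simp; omega, i1, by simp; omega, j1⟩
  rcases he with ⟨hP, he⟩ | ⟨hP, he⟩
  · rcases halt with ⟨h1, h2, h3, h4⟩ | ⟨h1, h2, h3, h4⟩
    · exact absurd h1 (not_lt.mpr hP.le)
    simp only [mem_insert_iff, mem_singleton_iff, Prod.mk.injEq] at he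
    rcases he with ⟨rfl, rfl⟩ | ⟨rfl, rfl⟩ | ⟨rfl, rfl⟩ | ⟨rfl, rfl⟩ <;>
      refine ⟨⟨by assumption, mem_nbr_of_axis (by assumption) (by simp) (by simp) (by simp)
        (by simp), by assumption⟩, by simp [IsDiagonal]⟩
  · rcases halt with ⟨h1, h2, h3, h4⟩ | ⟨h1, h2, h3, h4⟩
    swap
    · exact absurd h1 hP
    simp only [Prod.swap_prod_mk, mem_insert_iff, mem_singleton_iff, Prod.mk.injEq] at he
    rcases he with ⟨rfl, rfl⟩ | ⟨rfl, rfl⟩ | ⟨rfl, rfl⟩ | ⟨rfl, rfl⟩ <;>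
      refine ⟨⟨by assumption, mem_nbr_of_axis (by assumption) (by simp) (by simp) (by simp)
        (by simp), by assumption⟩, by simp [IsDiagonal]⟩

theorem mixEdges_step {n m : ℕ} (hn : 2 ≤ n) (hm : 2 ≤ m) {I : Pt → ℝ} (hI : InjOn I (grid n m))
    {p q : Pt} (h : (p, q) ∈ mixEdges n m I) :
    (p ∈ grid n m ∧ q ∈ nbr n m I p ∧ I p < I q) ∧ ¬ IsDiagonal p q := by
  obtain ⟨i, j, hs, he⟩ := h
  obtain ⟨i0, i1, j0, j1, halt⟩ := mixSigns_of_isMixPoint hn hm hI hs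
  have g : ((i, j) : Pt) ∈ grid n m := ⟨i0.le, by simp; omega, j0.le, by simp; omega⟩
  have ga : ((i + 1, j) : Pt) ∈ grid n m := ⟨by simp; omega, i1, j0.le, by simp; omega⟩
  have gb : ((i - 1, j) : Pt) ∈ grid n m := ⟨by simp; omega, by simp; omega, j0.le, by simp; omega⟩
  have gc : ((i, j + 1) : Pt) ∈ grid n m := ⟨i0.le, by simp; omega, by simp; omega, j1⟩
  have gd : ((i, j - 1) : Pt) ∈ grid n m := ⟨i0.le, by simp; omega, by simp; omega, by simp; omega⟩
  rcases he with ⟨hP, he⟩ | ⟨hP, he⟩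
  · rcases halt with ⟨h1, h2, h3, h4⟩ | ⟨h1, h2, h3, h4⟩
    swap
    · exact absurd h1 (not_lt.mpr hP.le)
    simp only [mem_insert_iff, mem_singleton_iff, Prod.mk.injEq] at he
    rcases he with ⟨rfl, rfl⟩ | ⟨rfl, rfl⟩ | ⟨rfl, rfl⟩ | ⟨rfl, rfl⟩ <;>
      refine ⟨⟨by assumption, mem_nbr_of_axis (by assumption) (by simp <;> omega)
        (by simp) (by simp)
        (by simp), by assumption⟩, by simp [IsDiagonal]⟩
  · rcases halt with ⟨h1, h2, h3, h4⟩ | ⟨h1, h2, h3, h4⟩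
    · exact absurd h1 hP
    simp only [Prod.swap_prod_mk, mem_insert_iff, mem_singleton_iff, Prod.mk.injEq] at he
    rcases he with ⟨rfl, rfl⟩ | ⟨rfl, rfl⟩ | ⟨rfl, rfl⟩ | ⟨rfl, rfl⟩ <;>
      refine ⟨⟨by assumption, mem_nbr_of_axis (by assumption) (by simp <;> omega)
        (by simp) (by simp)
        (by simp), by assumption⟩, by simp [IsDiagonal]⟩

/-- The two other corners of the pixel with diagonal `p q` are neighbors of `p` and of `q`. -/
theorem corner_mem_nbr {n m : ℕ} {I : Pt → ℝ} {p q : Pt} (hp : p ∈ grid n m)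
    (hq : q ∈ nbr n m I p) (hd : IsDiagonal p q) :
    (p.1, q.2) ∈ grid n m ∧ (p.1, q.2) ∈ nbr n m I p ∧ q ∈ nbr n m I (p.1, q.2) := by
  obtain ⟨⟨⟨q1, q2, q3, q4⟩, hne, h1, h2⟩, -⟩ := hq
  obtain ⟨p1, p2, p3, p4⟩ := hp
  have hg : ((p.1, q.2) : Pt) ∈ grid n m := ⟨p1, p2, q3, q4⟩
  refine ⟨hg, mem_nbr_of_axis hg ?_ (by simp) (by simpa using h2) (by simp),
    mem_nbr_of_axis ⟨q1, q2, q3, q4⟩ ?_ (by simpa using h1) (by simp) (by simp)⟩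
  · intro h
    exact hd.2 (congrArg Prod.snd h).symm
  · intro h
    exact hd.1 (congrArg Prod.fst h).symm

theorem corner_mem_nbr' {n m : ℕ} {I : Pt → ℝ} {p q : Pt} (hp : p ∈ grid n m)
    (hq : q ∈ nbr n m I p) (hd : IsDiagonal p q) :
    (q.1, p.2) ∈ grid n m ∧ (q.1, p.2) ∈ nbr n m I p ∧ q ∈ nbr n m I (q.1, p.2) := by
  obtain ⟨⟨⟨q1, q2, q3, q4⟩, hne, h1, h2⟩, -⟩ := hq
  obtain ⟨p1, p2, p3, p4⟩ := hp
  have hg : ((q.1, p.2) : Pt) ∈ grid n m := ⟨q1, q2, p3, p4⟩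
  refine ⟨hg, mem_nbr_of_axis hg ?_ (by simpa using h1) (by simp) (by simp),
    mem_nbr_of_axis ⟨q1, q2, q3, q4⟩ ?_ (by simp) (by simpa using h2) (by simp)⟩
  · intro h
    exact hd.1 (congrArg Prod.fst h).symm
  · intro h
    exact hd.2 (congrArg Prod.snd h).symm

/-- For two steepest steps along the diagonals of one pixel, the end of each is joined to the start
of the other by a pixel side. Each end is thus at least as high as the other, and the two would
coincide. -/
theorem steepest_not_cross {n m : ℕ} {I : Pt → ℝ} (hI : InjOn I (grid n m)) {p q b c : Pt}
    (hpq : IsSteepestStep n m I p q) (hbc : IsSteepestStep n m I b c) (hqc : q ≠ c)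
    (hc : c ∈ nbr n m I p) (hq : q ∈ nbr n m I b) : False := by
  have h1 : ¬ I q < I c := fun h => hpq.2.2 ⟨c, hc, h⟩
  have h2 : ¬ I c < I q := fun h => hbc.2.2 ⟨q, hq, h⟩
  exact hqc (hI hpq.1.1.1 hc.1.1 (le_antisymm (not_lt.mp h2) (not_lt.mp h1)))

theorem edgeInvariant_init {n m : ℕ} (hn : 2 ≤ n) (hm : 2 ≤ m) {I : Pt → ℝ}
    (hI : InjOn I (grid n m)) :
    EdgeInvariant n m I (splitEdges n m I ∪ mixEdges n m I ∪ steepestEdges n m I) where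
  step h := by
    rcases h with (h | h) | h
    · exact (splitEdges_step hI h).1
    · exact (mixEdges_step hn hm hI h).1
    · have := steepestEdges_step h
      exact ⟨this.1, this.2.1, this.2.2.1⟩
  subset := Subset.rfl
  not_cross {p q} h hd := by
    -- Edges of split pixels and mix points are pixel sides, so a diagonal edge can only come from a
    -- steepest path.
    have steep : ∀ {p q}, (p, q) ∈ splitEdges n m I ∪ mixEdges n m I ∪ steepestEdges n m I →
        IsDiagonal p q → p ∈ grid n m ∧ IsSteepestStep n m I p q := by
      intro p q h hd
      rcases h with (h | h) | h
      · exact absurd hd (splitEdges_step hI h).2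
      · exact absurd hd (mixEdges_step hn hm hI h).2
      · exact steepestEdges_step h
    obtain ⟨hp, hs⟩ := steep h hd
    have c1 := corner_mem_nbr hp hs.1 hd
    have c2 := corner_mem_nbr' hp hs.1 hd
    refine ⟨fun hx => ?_, fun hx => ?_⟩
    · obtain ⟨hp', hs'⟩ := steep hx ⟨hd.1, hd.2.symm⟩
      exact steepest_not_cross hI hs hs' (fun h => hd.2 (congrArg Prod.snd h).symm) c2.2.1 c1.2.2
    · obtain ⟨hp', hs'⟩ := steep hx ⟨hd.1.symm, hd.2⟩
      exact steepest_not_cross hI hs hs' (fun h => hd.1 (congrArg Prod.fst h).symm) c1.2.1 c2.2.2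

/-- The neighborhood `nbrFree` omits exactly the diagonals that cross an edge already present. The
new edge may be either of the two crossing diagonals, hence the two symmetric checks. -/
theorem EdgeInvariant.joinStep {n m : ℕ} {I : Pt → ℝ} {E E' : Edges} (h : EdgeInvariant n m I E)
    (hj : JoinStep n m I E E') : EdgeInvariant n m I E' := by
  obtain ⟨p, hp, -, -, q, ⟨hq, hfree⟩, hlt, -, rfl⟩ := hj
  refine ⟨?_, ?_, h.subset.trans (subset_insert _ _)⟩
  · rintro a b (hab | hab)
    · rw [Prod.mk.injEq] at hab
      obtain ⟨rfl, rfl⟩ := hab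
      exact ⟨hq.1.1, nbr_symm hp hq, hlt⟩
    · exact h.step hab
  · rintro a b (hab | hab) hd
    · rw [Prod.mk.injEq] at hab
      obtain ⟨rfl, rfl⟩ := hab
      have hf : ¬ (((b.1, a.2), (a.1, b.2)) ∈ E ∨ ((a.1, b.2), (b.1, a.2)) ∈ E) :=
        fun hh => hfree ⟨⟨hd.1.symm, hd.2.symm⟩, hh⟩
      refine ⟨?_, ?_⟩
      · rintro (hx | hx)
        · simp only [Prod.ext_iff] at hx
          exact hd.2 hx.1.2.symm
        · exact hf (Or.inr hx)
      · rintro (hx | hx)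
        · simp only [Prod.ext_iff] at hx
          exact hd.1 hx.1.1.symm
        · exact hf (Or.inl hx)
    · have hx0 := h.not_cross hab hd
      refine ⟨?_, ?_⟩
      · rintro (hx | hx)
        · rw [Prod.mk.injEq] at hx
          obtain ⟨rfl, rfl⟩ := hx
          exact hfree ⟨⟨hd.1.symm, hd.2⟩, Or.inr hab⟩
        · exact hx0.1 hx
      · rintro (hx | hx)
        · rw [Prod.mk.injEq] at hx
          obtain ⟨rfl, rfl⟩ := hx
          exact hfree ⟨⟨hd.1, hd.2.symm⟩, Or.inl hab⟩
        · exact hx0.2 hx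

theorem IsSteepestGraph.edgeInvariant {n m : ℕ} (hn : 2 ≤ n) (hm : 2 ≤ m) {I : Pt → ℝ}
    (hI : InjOn I (grid n m)) {E : Edges} (hE : IsSteepestGraph n m I E) :
    EdgeInvariant n m I E := by
  have key : ∀ E', Relation.ReflTransGen (JoinStep n m I)
      (splitEdges n m I ∪ mixEdges n m I ∪ steepestEdges n m I) E' → EdgeInvariant n m I E' := by
    intro E' h
    induction h with
    | refl => exact edgeInvariant_init hn hm hI
    | tail _ h ih => exact ih.joinStep h
  exact key E hE.1

/-- Steepest paths leave every node that has a greater neighbor, which gives `up`. Completion of the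
joining steps means that a node which is not a local minimum has an incoming edge, which gives
`down`. The edges at mix points give `mix`. -/
theorem IsSteepestGraph.isWellJoined {n m : ℕ} (hn : 2 ≤ n) (hm : 2 ≤ m) {I : Pt → ℝ}
    (hI : InjOn I (grid n m)) {E : Edges} (hE : IsSteepestGraph n m I E) :
    IsWellJoined n m I (Joined E) := by
  have inv := hE.edgeInvariant hn hm hI
  refine ⟨fun h => h.symm, ?_, ?_, ?_, ?_, ?_⟩
  · rintro p q (h | h)
    exacts [(inv.step h).2.1, nbr_symm (inv.step h).1 (inv.step h).2.1]
  · rintro i j (h | h) h'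
    · have := inv.not_cross h ⟨by simp, by simp⟩
      exact h'.elim this.2 this.1
    · have := inv.not_cross h ⟨by simp, by simp⟩
      exact h'.elim this.1 this.2
  · intro p q hp hq hlt
    obtain ⟨y, hy, hmax⟩ := Set.exists_max_image (nbr n m I p) I
      ((grid_finite n m).subset fun x hx => hx.1.1) ⟨q, hq⟩
    have hpy : I p < I y := hlt.trans_le (hmax q hq)
    refine ⟨y, Or.inl (inv.subset (Or.inr (mem_steepestEdges hp ⟨hy, hpy, ?_⟩))), hpy⟩
    rintro ⟨z, hz, h⟩
    exact absurd (hmax z hz) (not_le.mpr h)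
  · intro p q hp hq hlt
    have : ¬ NoIncoming E p := fun h => absurd ((hE.2 p hp h).2 q hq) (not_lt.mpr hlt.le)
    obtain ⟨y, hy⟩ := not_not.mp this
    exact ⟨y, Or.inr hy, (inv.step hy).2.2⟩
  · intro i j i0 i1 j0 j1 hs
    have hmix := isMixPoint_of_mixSigns i0 i1 j0 j1 hs
    have sub : ∀ e, e ∈ orientBy (I (i, j) < I (i + 1, j))
      {(((i, j), (i + 1, j)) : Pt × Pt), ((i, j), (i - 1, j)),
        ((i, j - 1), (i, j)), ((i, j + 1), (i, j))} → e ∈ E := fun e he =>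
      inv.subset (Or.inl (Or.inr ⟨i, j, hmix, he⟩))
    by_cases hP : I (i, j) < I (i + 1, j)
    · exact ⟨Or.inl (sub _ (Or.inl ⟨hP, by simp⟩)), Or.inl (sub _ (Or.inl ⟨hP, by simp⟩)),
        Or.inr (sub _ (Or.inl ⟨hP, by simp⟩)), Or.inr (sub _ (Or.inl ⟨hP, by simp⟩))⟩
    · exact ⟨Or.inr (sub _ (Or.inr ⟨hP, by simp⟩)), Or.inr (sub _ (Or.inr ⟨hP, by simp⟩)),
        Or.inl (sub _ (Or.inr ⟨hP, by simp⟩)), Or.inl (sub _ (Or.inr ⟨hP, by simp⟩))⟩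

/-! ### The union of the min-max paths -/

/-- Values increase strictly along edges and the grid is finite, so following edges ends in a node
that no edge leaves. -/
theorem exists_ascent {n m : ℕ} {I : Pt → ℝ} {E : Edges} (h : EdgeInvariant n m I E) (p : Pt)
    (hp : p ∈ grid n m) : ∃ l : List Pt, (∀ x ∈ p :: l, x ∈ grid n m) ∧
      (p :: l).IsChain (fun p q => (p, q) ∈ E) ∧
      ∀ x ∈ (p :: l).getLast?, ¬ ∃ q, (x, q) ∈ E := by
  have hwf : WellFounded fun a b : grid n m => I b < I a := by
    have : Finite (grid n m) := grid_finite n m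
    have : IsTrans (grid n m) fun a b => I b < I a := ⟨fun a b c h1 h2 => h2.trans h1⟩
    have : Std.Irrefl fun a b : grid n m => I b < I a := ⟨fun a => lt_irrefl _⟩
    exact Finite.wellFounded_of_trans_of_irrefl _
  induction hpp : (⟨p, hp⟩ : grid n m) using hwf.induction generalizing p with
  | _ a ih =>
    subst hpp
    by_cases hex : ∃ q, (p, q) ∈ E
    · obtain ⟨q, hq⟩ := hex
      have hs := h.step hq
      obtain ⟨l, h1, h2, h3⟩ := ih ⟨q, hs.2.1.1.1⟩ hs.2.2 q hs.2.1.1.1 rfl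
      refine ⟨q :: l, ?_, ?_, ?_⟩
      · intro x hx
        rcases List.mem_cons.mp hx with rfl | hx
        exacts [hp, h1 x hx]
      · exact List.isChain_cons_cons.mpr ⟨hq, h2⟩
      · simpa using h3
    · exact ⟨[], by simpa using hp, by simp, by simpa using hex⟩

theorem exists_descent {n m : ℕ} {I : Pt → ℝ} {E : Edges} (h : EdgeInvariant n m I E) (p : Pt)
    (hp : p ∈ grid n m) : ∃ l : List Pt, (∀ x ∈ l ++ [p], x ∈ grid n m) ∧
      (l ++ [p]).IsChain (fun p q => (p, q) ∈ E) ∧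
      ∀ x ∈ (l ++ [p]).head?, ¬ ∃ q, (q, x) ∈ E := by
  have hwf : WellFounded fun a b : grid n m => I a < I b := by
    have : Finite (grid n m) := grid_finite n m
    have : IsTrans (grid n m) fun a b => I a < I b := ⟨fun a b c h1 h2 => h1.trans h2⟩
    have : Std.Irrefl fun a b : grid n m => I a < I b := ⟨fun a => lt_irrefl _⟩
    exact Finite.wellFounded_of_trans_of_irrefl _
  induction hpp : (⟨p, hp⟩ : grid n m) using hwf.induction generalizing p with
  | _ a ih =>
    subst hpp
    by_cases hex : ∃ q, (q, p) ∈ E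
    · obtain ⟨q, hq⟩ := hex
      have hs := h.step hq
      obtain ⟨l, h1, h2, h3⟩ := ih ⟨q, hs.1⟩ hs.2.2 q hs.1 rfl
      refine ⟨l ++ [q], ?_, ?_, ?_⟩
      · intro x hx
        rcases List.mem_append.mp hx with hx | hx
        · exact h1 x hx
        · rw [List.mem_singleton.mp hx]
          exact hp
      · refine List.isChain_append.mpr ⟨h2, by simp, ?_⟩
        simpa using hq
      · intro x hx
        refine h3 x ?_
        cases l <;> simpa using hx
    · exact ⟨[], by simpa using hp, by simp, by simpa using hex⟩

/-- Prolonging an edge downwards and upwards as far as possible makes it part of a min-max path. -/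
theorem exists_minMaxPath {n m : ℕ} {I : Pt → ℝ} {E : Edges} (h : EdgeInvariant n m I E)
    {p q : Pt} (hpq : (p, q) ∈ E) : ∃ P, IsMinMaxPath n m E P ∧ [p, q] <:+: P := by
  have hs := h.step hpq
  obtain ⟨l, h1, h2, h3⟩ := exists_descent h p hs.1
  obtain ⟨l', h1', h2', h3'⟩ := exists_ascent h q hs.2.1.1.1
  refine ⟨(l ++ [p]) ++ (q :: l'), ⟨by simp, ?_, ?_, ?_, ?_⟩, l, l', by simp⟩
  · intro x hx
    rcases List.mem_append.mp hx with hx | hx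
    exacts [h1 x hx, h1' x hx]
  · refine List.isChain_append.mpr ⟨h2, h2', ?_⟩
    simpa using hpq
  · intro x hx
    refine h3 x ?_
    cases l <;> simpa using hx
  · intro x hx
    refine h3' x ?_
    simpa [List.getLast?_append] using hx

/-- The min-max paths cover all nodes and all edges. -/
theorem minMaxLines_eq {n m : ℕ} {I : Pt → ℝ} {E : Edges} (h : EdgeInvariant n m I E) :
    minMaxLines n m E = {x | (∃ p ∈ grid n m, x = toPlane p) ∨
      ∃ p q, Joined E p q ∧ x ∈ segment ℝ (toPlane p) (toPlane q)} := by
  ext x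
  constructor
  · rintro ⟨P, ⟨-, hP, hc, -⟩, ⟨p, hp, rfl⟩ | ⟨p, q, hi, hx⟩⟩
    · exact Or.inl ⟨p, hP p hp, rfl⟩
    · have := hc.infix hi
      simp only [List.isChain_cons_cons] at this
      exact Or.inr ⟨p, q, Or.inl this.1, hx⟩
  · rintro (⟨p, hp, rfl⟩ | ⟨p, q, hpq | hpq, hx⟩)
    · obtain ⟨l, h1, h2, h3⟩ := exists_descent h p hp
      obtain ⟨l', h1', h2', h3'⟩ := exists_ascent h p hp
      refine ⟨l ++ (p :: l'), ⟨by simp, ?_, ?_, ?_, ?_⟩, Or.inl ⟨p, by simp, rfl⟩⟩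
      · intro x hx
        rcases List.mem_append.mp hx with hx | hx
        exacts [h1 x (List.mem_append_left _ hx), h1' x hx]
      · have := List.isChain_append.mp h2
        refine List.isChain_append.mpr ⟨this.1, h2', ?_⟩
        simpa using this.2.2
      · intro x hx
        refine h3 x ?_
        cases l <;> simpa using hx
      · intro x hx
        refine h3' x ?_
        simpa [List.getLast?_append] using hx
    · obtain ⟨P, hP, hi⟩ := exists_minMaxPath h hpq
      exact ⟨P, hP, Or.inr ⟨p, q, hi, hx⟩⟩
    · obtain ⟨P, hP, hi⟩ := exists_minMaxPath h hpq
      exact ⟨P, hP, Or.inr ⟨q, p, hi, by rwa [segment_symm]⟩⟩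

/-! ### The drawing of the graph -/

/-- The union of the grid points and of the segments between joined points. -/
def graphLines (n m : ℕ) (J : Pt → Pt → Prop) : Set (ℝ × ℝ) :=
  {x | (∃ p ∈ grid n m, x = toPlane p) ∨ ∃ p q, J p q ∧ x ∈ segment ℝ (toPlane p) (toPlane q)}

theorem mem_segment_right {i j : ℤ} {x : ℝ × ℝ} :
    x ∈ segment ℝ (toPlane (i, j)) (toPlane (i + 1, j)) ↔
      x.2 = j ∧ (i : ℝ) ≤ x.1 ∧ x.1 ≤ i + 1 := by
  constructor
  · rintro ⟨a, b, ha, hb, hab, rfl⟩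
    obtain rfl : a = 1 - b := by linarith
    simp only [toPlane, Prod.smul_mk, smul_eq_mul, Prod.mk_add_mk]
    push_cast
    refine ⟨by ring, by nlinarith, by nlinarith⟩
  · rintro ⟨h1, h2, h3⟩
    refine ⟨1 - (x.1 - i), x.1 - i, by linarith, by linarith, by ring, ?_⟩
    ext
    · simp [toPlane]; ring
    · simp [toPlane, h1]; ring

theorem mem_segment_up {i j : ℤ} {x : ℝ × ℝ} :
    x ∈ segment ℝ (toPlane (i, j)) (toPlane (i, j + 1)) ↔
      x.1 = i ∧ (j : ℝ) ≤ x.2 ∧ x.2 ≤ j + 1 := by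
  constructor
  · rintro ⟨a, b, ha, hb, hab, rfl⟩
    obtain rfl : a = 1 - b := by linarith
    simp only [toPlane, Prod.smul_mk, smul_eq_mul, Prod.mk_add_mk]
    push_cast
    refine ⟨by ring, by nlinarith, by nlinarith⟩
  · rintro ⟨h1, h2, h3⟩
    refine ⟨1 - (x.2 - j), x.2 - j, by linarith, by linarith, by ring, ?_⟩
    ext
    · simp [toPlane, h1]; ring
    · simp [toPlane]; ring

theorem mem_segment_main {i j : ℤ} {x : ℝ × ℝ} :
    x ∈ segment ℝ (toPlane (i, j)) (toPlane (i + 1, j + 1)) ↔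
      x.2 - j = x.1 - i ∧ (i : ℝ) ≤ x.1 ∧ x.1 ≤ i + 1 := by
  constructor
  · rintro ⟨a, b, ha, hb, hab, rfl⟩
    obtain rfl : a = 1 - b := by linarith
    simp only [toPlane, Prod.smul_mk, smul_eq_mul, Prod.mk_add_mk]
    push_cast
    refine ⟨by ring, by nlinarith, by nlinarith⟩
  · rintro ⟨h1, h2, h3⟩
    refine ⟨1 - (x.1 - i), x.1 - i, by linarith, by linarith, by ring, ?_⟩
    ext
    · simp [toPlane]; ring
    · simp only [toPlane, Prod.smul_mk, smul_eq_mul, Prod.mk_add_mk]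
      push_cast
      linear_combination -h1

theorem mem_segment_anti {i j : ℤ} {x : ℝ × ℝ} :
    x ∈ segment ℝ (toPlane (i + 1, j)) (toPlane (i, j + 1)) ↔
      (x.1 - i) + (x.2 - j) = 1 ∧ (i : ℝ) ≤ x.1 ∧ x.1 ≤ i + 1 := by
  constructor
  · rintro ⟨a, b, ha, hb, hab, rfl⟩
    obtain rfl : a = 1 - b := by linarith
    simp only [toPlane, Prod.smul_mk, smul_eq_mul, Prod.mk_add_mk]
    push_cast
    refine ⟨by ring, by nlinarith, by nlinarith⟩
  · rintro ⟨h1, h2, h3⟩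
    refine ⟨x.1 - i, 1 - (x.1 - i), by linarith, by linarith, by ring, ?_⟩
    ext
    · simp [toPlane]; ring
    · simp only [toPlane, Prod.smul_mk, smul_eq_mul, Prod.mk_add_mk]
      push_cast
      linear_combination -h1

/-- Edges join neighbors, so up to direction there are only four kinds of segment. Each is described
by coordinates for later comparison with the triangles. -/
theorem graphLines_cases {n m : ℕ} {I : Pt → ℝ} {J : Pt → Pt → Prop} (hJ : IsWellJoined n m I J)
    {x : ℝ × ℝ} (hx : x ∈ graphLines n m J) :
    (∃ i j : ℤ, x.1 = i ∧ x.2 = j) ∨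
    (∃ i j : ℤ, J (i, j) (i + 1, j) ∧ x.2 = j ∧ (i : ℝ) ≤ x.1 ∧ x.1 ≤ i + 1) ∨
    (∃ i j : ℤ, J (i, j) (i, j + 1) ∧ x.1 = i ∧ (j : ℝ) ≤ x.2 ∧ x.2 ≤ j + 1) ∨
    (∃ i j : ℤ, J (i, j) (i + 1, j + 1) ∧ x.2 - j = x.1 - i ∧ (i : ℝ) ≤ x.1 ∧ x.1 ≤ i + 1) ∨
    (∃ i j : ℤ, J (i + 1, j) (i, j + 1) ∧ (x.1 - i) + (x.2 - j) = 1 ∧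
      (i : ℝ) ≤ x.1 ∧ x.1 ≤ i + 1) := by
  rcases hx with ⟨⟨i, j⟩, -, rfl⟩ | ⟨⟨i, j⟩, ⟨k, l⟩, hj, hx⟩
  · exact Or.inl ⟨i, j, rfl, rfl⟩
  right
  obtain ⟨⟨-, hne, h1, h2⟩, -⟩ := hJ.mem_nbr hj
  simp only at h1 h2
  rw [abs_le] at h1 h2
  obtain hk | hk | hk : k = i - 1 ∨ k = i ∨ k = i + 1 := by omega
  · obtain rfl : i = k + 1 := by omega
    obtain hl | hl | hl : l = j - 1 ∨ l = j ∨ l = j + 1 := by omega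
    · obtain rfl : j = l + 1 := by omega
      rw [segment_symm] at hx
      exact Or.inr (Or.inr (Or.inl ⟨k, l, hJ.symm hj, mem_segment_main.mp hx⟩))
    · subst hl
      rw [segment_symm] at hx
      exact Or.inl ⟨k, l, hJ.symm hj, mem_segment_right.mp hx⟩
    · subst hl
      exact Or.inr (Or.inr (Or.inr ⟨k, j, hj, mem_segment_anti.mp hx⟩))
  · subst hk
    obtain hl | hl | hl : l = j - 1 ∨ l = j ∨ l = j + 1 := by omega
    · obtain rfl : j = l + 1 := by omega
      rw [segment_symm] at hx
      exact Or.inr (Or.inl ⟨k, l, hJ.symm hj, mem_segment_up.mp hx⟩)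
    · subst hl
      exact absurd rfl hne
    · subst hl
      exact Or.inr (Or.inl ⟨k, j, hj, mem_segment_up.mp hx⟩)
  · subst hk
    obtain hl | hl | hl : l = j - 1 ∨ l = j ∨ l = j + 1 := by omega
    · obtain rfl : j = l + 1 := by omega
      rw [segment_symm] at hx
      exact Or.inr (Or.inr (Or.inr ⟨i, l, hJ.symm hj, mem_segment_anti.mp hx⟩))
    · subst hl
      exact Or.inl ⟨i, l, hj, mem_segment_right.mp hx⟩
    · subst hl
      exact Or.inr (Or.inr (Or.inl ⟨i, j, hj, mem_segment_main.mp hx⟩))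

theorem int_eq_of_lt {i k : ℤ} {t : ℝ} (h1 : (i : ℝ) < t) (h2 : t < i + 1) (h3 : (k : ℝ) ≤ t)
    (h4 : t ≤ k + 1) : k = i := by
  have a : (k : ℝ) < i + 1 := by linarith
  have b : (i : ℝ) < k + 1 := by linarith
  have a' : k < i + 1 := by exact_mod_cast a
  have b' : i < k + 1 := by exact_mod_cast b
  omega

theorem not_int_of_lt {i k : ℤ} {t : ℝ} (h1 : (i : ℝ) < t) (h2 : t < i + 1) : t ≠ k := by
  intro h
  rw [h] at h1 h2
  have a' : i < k := by exact_mod_cast h1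
  have b' : k < i + 1 := by exact_mod_cast h2
  omega

/-! ### Cells -/

/-- A cell is one of the two triangles into which a diagonal divides a pixel. -/
abbrev Cell := Pt × Bool

open Classical in
/-- The diagonal that divides a pixel runs from the upper left to the lower right corner. -/
noncomputable def anti (J : Pt → Pt → Prop) (p : Pt) : Bool :=
  decide (J (p.1 + 1, p.2) (p.1, p.2 + 1))

theorem anti_eq_true {J : Pt → Pt → Prop} {p : Pt} :
    anti J p = true ↔ J (p.1 + 1, p.2) (p.1, p.2 + 1) := by simp [anti]

theorem anti_eq_false {J : Pt → Pt → Prop} {p : Pt} :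
    anti J p = false ↔ ¬ J (p.1 + 1, p.2) (p.1, p.2 + 1) := by simp [anti]

/-- A linear function that is positive in one of the triangles of a unit square, and negative in
the other one. -/
def cellSide : Bool → Bool → ℝ → ℝ → ℝ
  | true, true, z, w => z + w - 1
  | true, false, z, w => 1 - z - w
  | false, true, z, w => w - z
  | false, false, z, w => z - w

/-- The closed triangle of a cell. The cell `(p, false)` contains the lower side of the pixel `p`
and the cell `(p, true)` the upper side. -/
def closedCell (J : Pt → Pt → Prop) (c : Cell) : Set (ℝ × ℝ) :=
  {x | (c.1.1 : ℝ) ≤ x.1 ∧ x.1 ≤ c.1.1 + 1 ∧ (c.1.2 : ℝ) ≤ x.2 ∧ x.2 ≤ c.1.2 + 1 ∧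
    0 ≤ cellSide (anti J c.1) c.2 (x.1 - c.1.1) (x.2 - c.1.2)}

/-- The open triangle of a cell. -/
def openCell (J : Pt → Pt → Prop) (c : Cell) : Set (ℝ × ℝ) :=
  {x | (c.1.1 : ℝ) < x.1 ∧ x.1 < c.1.1 + 1 ∧ (c.1.2 : ℝ) < x.2 ∧ x.2 < c.1.2 + 1 ∧
    0 < cellSide (anti J c.1) c.2 (x.1 - c.1.1) (x.2 - c.1.2)}

variable {n m : ℕ} {I : Pt → ℝ} {J : Pt → Pt → Prop}

theorem cellSide_convex (a b : Bool) (s t z w z' w' : ℝ) (h : s + t = 1) :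
    cellSide a b (s * z + t * z') (s * w + t * w') =
      s * cellSide a b z w + t * cellSide a b z' w' := by
  cases a <;> cases b <;> simp only [cellSide] <;>
    first | linear_combination h | linear_combination -h | linear_combination 0 * h

theorem continuous_cellSide (a b : Bool) : Continuous fun x : ℝ × ℝ => cellSide a b x.1 x.2 := by
  cases a <;> cases b <;> simp only [cellSide] <;> fun_prop

theorem openCell_subset_closedCell (c : Cell) : openCell J c ⊆ closedCell J c :=
  fun _ ⟨h1, h2, h3, h4, h5⟩ => ⟨h1.le, h2.le, h3.le, h4.le, h5.le⟩

theorem isClosed_closedCell (c : Cell) : IsClosed (closedCell J c) := by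
  have h := (continuous_cellSide (anti J c.1) c.2).comp
    (show Continuous fun x : ℝ × ℝ => (x.1 - c.1.1, x.2 - c.1.2) by fun_prop)
  refine (isClosed_le continuous_const continuous_fst).inter
    ((isClosed_le continuous_fst continuous_const).inter
      ((isClosed_le continuous_const continuous_snd).inter
        ((isClosed_le continuous_snd continuous_const).inter
          (isClosed_le continuous_const h))))

/-- A segment from a point of the closed triangle to a point of the open one runs in the open
triangle. -/
theorem openSegment_subset_openCell {c : Cell} {x y : ℝ × ℝ} (hx : x ∈ closedCell J c)
    (hy : y ∈ openCell J c) : openSegment ℝ x y ⊆ openCell J c := by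
  rintro z ⟨a, b, ha, hb, hab, rfl⟩
  obtain ⟨h1, h2, h3, h4, h5⟩ := hx
  obtain ⟨k1, k2, k3, k4, k5⟩ := hy
  have e1 : (a • x + b • y).1 = a * x.1 + b * y.1 := rfl
  have e2 : (a • x + b • y).2 = a * x.2 + b * y.2 := rfl
  have f1 : a * x.1 + b * y.1 - c.1.1 = a * (x.1 - c.1.1) + b * (y.1 - c.1.1) := by
    linear_combination (c.1.1 : ℝ) * hab
  have f2 : a * x.2 + b * y.2 - c.1.2 = a * (x.2 - c.1.2) + b * (y.2 - c.1.2) := by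
    linear_combination (c.1.2 : ℝ) * hab
  have f3 : c.1.1 + 1 - (a * x.1 + b * y.1) = a * (c.1.1 + 1 - x.1) + b * (c.1.1 + 1 - y.1) := by
    linear_combination (-(c.1.1 : ℝ) - 1) * hab
  have f4 : c.1.2 + 1 - (a * x.2 + b * y.2) = a * (c.1.2 + 1 - x.2) + b * (c.1.2 + 1 - y.2) := by
    linear_combination (-(c.1.2 : ℝ) - 1) * hab
  have pos : ∀ {s t : ℝ}, 0 ≤ s → 0 < t → 0 < a * s + b * t := fun hs ht =>
    add_pos_of_nonneg_of_pos (mul_nonneg ha.le hs) (mul_pos hb ht)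
  refine ⟨?_, ?_, ?_, ?_, ?_⟩
  · rw [e1, ← sub_pos, f1]; exact pos (by linarith) (by linarith)
  · rw [e1, ← sub_pos, f3]; exact pos (by linarith) (by linarith)
  · rw [e2, ← sub_pos, f2]; exact pos (by linarith) (by linarith)
  · rw [e2, ← sub_pos, f4]; exact pos (by linarith) (by linarith)
  · rw [e1, e2, f1, f2, cellSide_convex _ _ _ _ _ _ _ _ hab]
    exact pos h5 k5

theorem openCell_nonempty (c : Cell) : (openCell J c).Nonempty := by
  obtain ⟨p, b⟩ := c
  have key : ∀ a : Bool, ∃ z w : ℝ, 0 < z ∧ z < 1 ∧ 0 < w ∧ w < 1 ∧ 0 < cellSide a b z w := by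
    intro a
    cases a <;> cases b <;> simp only [cellSide]
    · exact ⟨2 / 3, 1 / 3, by norm_num⟩
    · exact ⟨1 / 3, 2 / 3, by norm_num⟩
    · exact ⟨1 / 3, 1 / 3, by norm_num⟩
    · exact ⟨2 / 3, 2 / 3, by norm_num⟩
  obtain ⟨z, w, h1, h2, h3, h4, h5⟩ := key (anti J p)
  exact ⟨(p.1 + z, p.2 + w), by simpa using h1, by simpa using h2, by simpa using h3,
    by simpa using h4, by simpa using h5⟩

theorem isPreconnected_openCell (c : Cell) : IsPreconnected (openCell J c) :=
  (convex_iff_openSegment_subset.mpr fun _ hx _ hy =>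
    openSegment_subset_openCell (openCell_subset_closedCell c hx) hy).isPreconnected

theorem closedCell_subset_closure (c : Cell) : closedCell J c ⊆ closure (openCell J c) := by
  intro x hx
  obtain ⟨y, hy⟩ := openCell_nonempty (J := J) c
  refine closure_mono (openSegment_subset_openCell hx hy) ?_
  rw [closure_openSegment]
  exact left_mem_segment ℝ x y

/-- Only a diagonal edge can enter the interior of a pixel. As edges do not cross, it is the
diagonal along which `anti` cuts the pixel, and this one bounds the open triangle. -/
theorem openCell_disjoint_graphLines (hJ : IsWellJoined n m I J) {c : Cell} {x : ℝ × ℝ}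
    (hx : x ∈ openCell J c) : x ∉ graphLines n m J := by
  intro hG
  obtain ⟨⟨k, l⟩, b⟩ := c
  obtain ⟨h1, h2, h3, h4, h5⟩ := hx
  simp only at h1 h2 h3 h4 h5
  rcases graphLines_cases hJ hG with ⟨i, j, hi, -⟩ | ⟨i, j, -, hi, -⟩ | ⟨i, j, -, hi, -⟩ |
    ⟨i, j, hj, e, hi, hi'⟩ | ⟨i, j, hj, e, hi, hi'⟩
  · exact not_int_of_lt h1 h2 hi
  · exact not_int_of_lt h3 h4 hi
  · exact not_int_of_lt h1 h2 hi
  · obtain rfl := int_eq_of_lt h1 h2 hi hi'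
    obtain rfl := int_eq_of_lt (k := j) h3 h4 (by linarith) (by linarith)
    have := anti_eq_false (p := (i, j)).mpr (hJ.not_cross hj)
    rw [this] at h5
    cases b <;> simp only [cellSide] at h5 <;> linarith
  · obtain rfl := int_eq_of_lt h1 h2 hi hi'
    obtain rfl := int_eq_of_lt (k := j) h3 h4 (by linarith) (by linarith)
    have := anti_eq_true (p := (i, j)).mpr hj
    rw [this] at h5
    cases b <;> simp only [cellSide] at h5 <;> linarith

/-- A triangle without the points of the graph is connected. -/
theorem isPreconnected_closedCell_diff (hJ : IsWellJoined n m I J) (c : Cell) :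
    IsPreconnected (closedCell J c \ graphLines n m J) :=
  (isPreconnected_openCell c).subset_closure
    (fun _ hx => ⟨openCell_subset_closedCell c hx, openCell_disjoint_graphLines hJ hx⟩)
    (sdiff_subset.trans (closedCell_subset_closure c))

/-- Two cells are glued if they have a side in common that is not an edge of the graph. -/
inductive Glued (n m : ℕ) (J : Pt → Pt → Prop) : Cell → Cell → Prop
  | bottom {i j : ℤ} : PixelIn n m (i, j) → PixelIn n m (i, j - 1) → ¬ J (i, j) (i + 1, j) →
      Glued n m J ((i, j), false) ((i, j - 1), true)
  -- The slope of the dividing diagonal decides which triangle has the left side of its pixel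
  -- (`!anti`) and which has the right side (`anti`).
  | left {i j : ℤ} : PixelIn n m (i, j) → PixelIn n m (i - 1, j) → ¬ J (i, j) (i, j + 1) →
      Glued n m J ((i, j), !anti J (i, j)) ((i - 1, j), anti J (i - 1, j))
  -- A pixel without a diagonal edge is still cut, along the diagonal from the lower left corner,
  -- and its halves are glued again.
  | diag {i j : ℤ} : PixelIn n m (i, j) → ¬ J (i, j) (i + 1, j + 1) →
      ¬ J (i + 1, j) (i, j + 1) → Glued n m J ((i, j), false) ((i, j), true)

theorem Glued.pixelIn {c c' : Cell} (h : Glued n m J c c') :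
    PixelIn n m c.1 ∧ PixelIn n m c'.1 := by
  cases h <;> exact ⟨by assumption, by assumption⟩

theorem bottom_mem_closedCell {i j : ℤ} {x : ℝ × ℝ} (h1 : (i : ℝ) ≤ x.1) (h2 : x.1 ≤ i + 1)
    (h3 : x.2 = j) : x ∈ closedCell J ((i, j), false) := by
  refine ⟨h1, h2, h3.ge, by simp only; linarith, ?_⟩
  simp only
  cases anti J (i, j) <;> simp only [cellSide] <;> linarith

theorem top_mem_closedCell {i j : ℤ} {x : ℝ × ℝ} (h1 : (i : ℝ) ≤ x.1) (h2 : x.1 ≤ i + 1)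
    (h3 : x.2 = j + 1) : x ∈ closedCell J ((i, j), true) := by
  refine ⟨h1, h2, by simp only; linarith, by simp only; linarith, ?_⟩
  simp only
  cases anti J (i, j) <;> simp only [cellSide] <;> linarith

theorem left_mem_closedCell {i j : ℤ} {x : ℝ × ℝ} (h1 : (j : ℝ) ≤ x.2) (h2 : x.2 ≤ j + 1)
    (h3 : x.1 = i) : x ∈ closedCell J ((i, j), !anti J (i, j)) := by
  refine ⟨h3.ge, by simp only; linarith, h1, h2, ?_⟩
  simp only
  cases anti J (i, j) <;> simp only [cellSide, Bool.not_true, Bool.not_false] <;> linarith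

theorem right_mem_closedCell {i j : ℤ} {x : ℝ × ℝ} (h1 : (j : ℝ) ≤ x.2) (h2 : x.2 ≤ j + 1)
    (h3 : x.1 = i + 1) : x ∈ closedCell J ((i, j), anti J (i, j)) := by
  refine ⟨by simp only; linarith, by simp only; linarith, h1, h2, ?_⟩
  simp only
  cases anti J (i, j) <;> simp only [cellSide] <;> linarith

/-- Glued cells have a common point outside the graph. -/
theorem Glued.exists_common (hJ : IsWellJoined n m I J) {c c' : Cell} (h : Glued n m J c c') :
    ∃ x, x ∈ closedCell J c ∧ x ∈ closedCell J c' ∧ x ∉ graphLines n m J := by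
  have half : ∀ i : ℤ, (i : ℝ) < i + 1 / 2 ∧ (i : ℝ) + 1 / 2 < i + 1 := fun i =>
    ⟨by linarith, by linarith⟩
  cases h with
  | @bottom k l h1 h2 h3 =>
    refine ⟨(k + 1 / 2, l), bottom_mem_closedCell (half k).1.le (half k).2.le rfl,
      top_mem_closedCell (half k).1.le (half k).2.le (by push_cast; ring), fun hG => ?_⟩
    rcases graphLines_cases hJ hG with ⟨i, j, hi, -⟩ | ⟨i, j, hj, hi, k1, k2⟩ | ⟨i, j, -, hi, -⟩ |
      ⟨i, j, hj, e, hi, hi'⟩ | ⟨i, j, hj, e, hi, hi'⟩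
    · exact not_int_of_lt (half k).1 (half k).2 hi
    · obtain rfl := int_eq_of_lt (half k).1 (half k).2 k1 k2
      obtain rfl : l = j := by simp only at hi; exact_mod_cast hi
      exact h3 hj
    · exact not_int_of_lt (half k).1 (half k).2 hi
    · obtain rfl := int_eq_of_lt (half k).1 (half k).2 hi hi'
      refine not_int_of_lt (half j).1 (half j).2 (k := l) ?_
      simp only at e
      linarith
    · obtain rfl := int_eq_of_lt (half k).1 (half k).2 hi hi'
      refine not_int_of_lt (half j).1 (half j).2 (k := l) ?_
      simp only at e
      linarith
  | @left k l h1 h2 h3 =>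
    refine ⟨(k, l + 1 / 2), left_mem_closedCell (half l).1.le (half l).2.le rfl,
      right_mem_closedCell (half l).1.le (half l).2.le (by push_cast; ring), fun hG => ?_⟩
    rcases graphLines_cases hJ hG with ⟨i, j, -, hi⟩ | ⟨i, j, hj, hi, k1, k2⟩ |
      ⟨i, j, hj, hi, k1, k2⟩ | ⟨i, j, hj, e, hi, hi'⟩ | ⟨i, j, hj, e, hi, hi'⟩
    · exact not_int_of_lt (half l).1 (half l).2 hi
    · exact not_int_of_lt (half l).1 (half l).2 hi
    · obtain rfl := int_eq_of_lt (half l).1 (half l).2 k1 k2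
      obtain rfl : k = i := by simp only at hi; exact_mod_cast hi
      exact h3 hj
    · simp only at e hi hi'
      obtain rfl := int_eq_of_lt (k := j) (half l).1 (half l).2 (by linarith) (by linarith)
      refine not_int_of_lt (half i).1 (half i).2 (k := k) ?_
      linarith
    · simp only at e hi hi'
      obtain rfl := int_eq_of_lt (k := j) (half l).1 (half l).2 (by linarith) (by linarith)
      refine not_int_of_lt (half i).1 (half i).2 (k := k) ?_
      linarith
  | @diag k l h1 h2 h3 =>
    have hm : ∀ b, ((k + 1 / 2 : ℝ), (l + 1 / 2 : ℝ)) ∈ closedCell J ((k, l), b) := by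
      intro b
      refine ⟨(half k).1.le, (half k).2.le, (half l).1.le, (half l).2.le, ?_⟩
      simp only
      cases anti J (k, l) <;> cases b <;> simp only [cellSide] <;> linarith
    refine ⟨(k + 1 / 2, l + 1 / 2), hm _, hm _, fun hG => ?_⟩
    rcases graphLines_cases hJ hG with ⟨i, j, hi, -⟩ | ⟨i, j, hj, hi, k1, k2⟩ |
      ⟨i, j, hj, hi, k1, k2⟩ | ⟨i, j, hj, e, hi, hi'⟩ | ⟨i, j, hj, e, hi, hi'⟩
    · exact not_int_of_lt (half k).1 (half k).2 hi
    · exact not_int_of_lt (half l).1 (half l).2 hi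
    · exact not_int_of_lt (half k).1 (half k).2 hi
    · obtain rfl := int_eq_of_lt (half k).1 (half k).2 hi hi'
      simp only at e
      obtain rfl := int_eq_of_lt (k := j) (half l).1 (half l).2 (by linarith) (by linarith)
      exact h2 hj
    · obtain rfl := int_eq_of_lt (half k).1 (half k).2 hi hi'
      simp only at e
      obtain rfl := int_eq_of_lt (k := j) (half l).1 (half l).2 (by linarith) (by linarith)
      exact h3 hj

theorem PixelIn.corners {i j : ℤ} (h : PixelIn n m (i, j)) :
    ((i, j) : Pt) ∈ grid n m ∧ ((i + 1, j) : Pt) ∈ grid n m ∧ ((i, j + 1) : Pt) ∈ grid n m ∧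
      ((i + 1, j + 1) : Pt) ∈ grid n m := by
  obtain ⟨h1, h2, h3, h4⟩ := h
  simp only at h1 h2 h3 h4
  refine ⟨⟨?_, ?_, ?_, ?_⟩, ⟨?_, ?_, ?_, ?_⟩, ⟨?_, ?_, ?_, ?_⟩, ⟨?_, ?_, ?_, ?_⟩⟩ <;>
    simp only <;> omega

/-! ### Properties of cells that are invariant under gluing. -/

section
variable {P : Cell → Prop} (hP : ∀ {c c'}, Glued n m J c c' → (P c ↔ P c'))
include hP

/-- A point of both triangles is on the dividing diagonal. If it is off the graph, this diagonal is
not an edge and the halves are glued. -/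
theorem iff_of_mem_same {i j : ℤ} (hp : PixelIn n m (i, j)) {x : ℝ × ℝ} {b b' : Bool}
    (hx : x ∈ closedCell J ((i, j), b)) (hx' : x ∈ closedCell J ((i, j), b'))
    (hG : x ∉ graphLines n m J) : P ((i, j), b) ↔ P ((i, j), b') := by
  have key : x ∈ closedCell J ((i, j), false) → x ∈ closedCell J ((i, j), true) →
      (P ((i, j), false) ↔ P ((i, j), true)) := by
    rintro ⟨h1, h2, -, -, h5⟩ ⟨-, -, -, -, h5'⟩
    simp only at h1 h2 h5 h5'
    cases ha : anti J (i, j)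
    · rw [ha] at h5 h5'
      simp only [cellSide] at h5 h5'
      refine hP (Glued.diag hp (fun hj => hG (Or.inr ⟨_, _, hj, ?_⟩)) (anti_eq_false.mp ha))
      exact mem_segment_main.mpr ⟨by linarith, h1, h2⟩
    · rw [ha] at h5 h5'
      simp only [cellSide] at h5 h5'
      exact absurd (Or.inr ⟨_, _, anti_eq_true.mp ha,
        mem_segment_anti.mpr ⟨by linarith, h1, h2⟩⟩) hG
  cases b <;> cases b'
  · rfl
  · exact key hx hx'
  · exact (key hx' hx).symm
  · rfl

theorem iff_of_mem_below {i j : ℤ} (hp : PixelIn n m (i, j)) (hp' : PixelIn n m (i, j - 1))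
    {x : ℝ × ℝ} {b b' : Bool} (hx : x ∈ closedCell J ((i, j), b))
    (hx' : x ∈ closedCell J ((i, j - 1), b')) (hG : x ∉ graphLines n m J) :
    P ((i, j), b) ↔ P ((i, j - 1), b') := by
  obtain ⟨h1, h2, h3, h4, h5⟩ := id hx
  obtain ⟨-, -, -, h4', -⟩ := id hx'
  simp only at h1 h2 h3 h4'
  push_cast at h4'
  have e : x.2 = j := by linarith
  have hj : ¬ J (i, j) (i + 1, j) := fun hj =>
    hG (Or.inr ⟨_, _, hj, mem_segment_right.mpr ⟨e, h1, h2⟩⟩)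
  rw [iff_of_mem_same hP hp hx (bottom_mem_closedCell h1 h2 e) hG,
    iff_of_mem_same hP hp' hx' (top_mem_closedCell h1 h2 (by push_cast; linarith)) hG]
  exact hP (Glued.bottom hp hp' hj)

theorem iff_of_mem_left {i j : ℤ} (hp : PixelIn n m (i, j)) (hp' : PixelIn n m (i - 1, j))
    {x : ℝ × ℝ} {b b' : Bool} (hx : x ∈ closedCell J ((i, j), b))
    (hx' : x ∈ closedCell J ((i - 1, j), b')) (hG : x ∉ graphLines n m J) :
    P ((i, j), b) ↔ P ((i - 1, j), b') := by
  obtain ⟨h1, h2, h3, h4, h5⟩ := id hx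
  obtain ⟨-, h2', -, -, -⟩ := id hx'
  simp only at h1 h3 h4 h2'
  push_cast at h2'
  have e : x.1 = i := by linarith
  have hj : ¬ J (i, j) (i, j + 1) := fun hj =>
    hG (Or.inr ⟨_, _, hj, mem_segment_up.mpr ⟨e, h3, h4⟩⟩)
  rw [iff_of_mem_same hP hp hx (left_mem_closedCell h3 h4 e) hG,
    iff_of_mem_same hP hp' hx' (right_mem_closedCell h3 h4 (by push_cast; linarith)) hG]
  exact hP (Glued.left hp hp' hj)

/-- Cells with a common point outside the graph belong to the same glued part. -/
theorem iff_of_mem_closedCell {c c' : Cell} (hp : PixelIn n m c.1) (hp' : PixelIn n m c'.1)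
    {x : ℝ × ℝ} (hx : x ∈ closedCell J c) (hx' : x ∈ closedCell J c')
    (hG : x ∉ graphLines n m J) : P c ↔ P c' := by
  obtain ⟨⟨i, j⟩, b⟩ := c
  obtain ⟨⟨k, l⟩, b'⟩ := c'
  obtain ⟨h1, h2, h3, h4, -⟩ := id hx
  obtain ⟨h1', h2', h3', h4', -⟩ := id hx'
  simp only at h1 h2 h3 h4 h1' h2' h3' h4' hp hp'
  have a1 : i ≤ k + 1 := by exact_mod_cast (by linarith : (i : ℝ) ≤ k + 1)
  have a2 : k ≤ i + 1 := by exact_mod_cast (by linarith : (k : ℝ) ≤ i + 1)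
  have a3 : j ≤ l + 1 := by exact_mod_cast (by linarith : (j : ℝ) ≤ l + 1)
  have a4 : l ≤ j + 1 := by exact_mod_cast (by linarith : (l : ℝ) ≤ j + 1)
  -- Pixels that touch only diagonally share just a grid node, and this belongs to the graph.
  have node : ∀ {s t : ℤ}, ((s, t) : Pt) ∈ grid n m → x.1 = s → x.2 = t → False := by
    intro s t hg e1 e2
    exact hG (Or.inl ⟨(s, t), hg, Prod.ext e1 e2⟩)
  obtain hk | rfl | hk : k = i - 1 ∨ k = i ∨ k = i + 1 := by omega
  · have e1 : x.1 = i := by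
      subst hk
      push_cast at h2'
      linarith
    obtain hl | rfl | hl : l = j - 1 ∨ l = j ∨ l = j + 1 := by omega
    · refine (node hp.corners.1 e1 ?_).elim
      subst hl
      push_cast at h4'
      linarith
    · subst hk
      exact iff_of_mem_left hP hp hp' hx hx' hG
    · refine (node hp.corners.2.2.1 e1 ?_).elim
      subst hl
      push_cast at h3' ⊢
      linarith
  · obtain hl | rfl | hl : l = j - 1 ∨ l = j ∨ l = j + 1 := by omega
    · subst hl
      exact iff_of_mem_below hP hp hp' hx hx' hG
    · exact iff_of_mem_same hP hp hx hx' hG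
    · obtain rfl : j = l - 1 := by omega
      exact (iff_of_mem_below hP hp' hp hx' hx hG).symm
  · have e1 : x.1 = (i + 1 : ℤ) := by
      subst hk
      push_cast at h1' ⊢
      linarith
    obtain hl | rfl | hl : l = j - 1 ∨ l = j ∨ l = j + 1 := by omega
    · refine (node hp.corners.2.1 e1 ?_).elim
      subst hl
      push_cast at h4'
      linarith
    · obtain rfl : i = k - 1 := by omega
      exact (iff_of_mem_left hP hp' hp hx' hx hG).symm
    · refine (node hp.corners.2.2.2 e1 ?_).elim
      subst hl
      push_cast at h3' ⊢
      linarith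

end

/-! ### Regions as unions of cells -/

/-- The cells inside the set `C`. -/
def regionCells (n m : ℕ) (J : Pt → Pt → Prop) (C : Set (ℝ × ℝ)) : Set Cell :=
  {c | PixelIn n m c.1 ∧ openCell J c ⊆ C}

theorem finite_pixelIn (n m : ℕ) : {c : Cell | PixelIn n m c.1}.Finite := by
  refine ((grid_finite n m).prod (finite_univ (α := Bool))).subset ?_
  rintro ⟨⟨i, j⟩, b⟩ h
  exact ⟨h.corners.1, mem_univ _⟩

theorem finite_regionCells (C : Set (ℝ × ℝ)) : (regionCells n m J C).Finite :=
  (finite_pixelIn n m).subset fun _ h => h.1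

theorem exists_unit_interval {n : ℕ} (hn : 2 ≤ n) {t : ℝ} (h0 : 0 ≤ t) (h1 : t ≤ n - 1) :
    ∃ i : ℤ, 0 ≤ i ∧ i + 1 < n ∧ (i : ℝ) ≤ t ∧ t ≤ i + 1 := by
  -- The minimum assigns the right end t = n - 1 to the last unit interval.
  refine ⟨min ⌊t⌋ (n - 2), le_min (Int.floor_nonneg.mpr h0) (by omega), ?_, ?_, ?_⟩
  · have := min_le_right ⌊t⌋ ((n : ℤ) - 2)
    omega
  · exact le_trans (by exact_mod_cast min_le_left ⌊t⌋ ((n : ℤ) - 2)) (Int.floor_le t)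
  · rcases le_total ⌊t⌋ ((n : ℤ) - 2) with h | h
    · rw [min_eq_left h]
      exact (Int.lt_floor_add_one t).le
    · rw [min_eq_right h]
      push_cast
      linarith

theorem exists_mem_closedCell (hn : 2 ≤ n) (hm : 2 ≤ m) {x : ℝ × ℝ} (hx : x ∈ domain n m) :
    ∃ c, PixelIn n m c.1 ∧ x ∈ closedCell J c := by
  obtain ⟨h1, h2, h3, h4⟩ := hx
  obtain ⟨i, i0, i1, i2, i3⟩ := exists_unit_interval hn h1 h2
  obtain ⟨j, j0, j1, j2, j3⟩ := exists_unit_interval hm h3 h4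
  have : ∃ b, 0 ≤ cellSide (anti J (i, j)) b (x.1 - i) (x.2 - j) := by
    cases anti J (i, j)
    · rcases le_total (x.1 - i) (x.2 - j) with h | h
      exacts [⟨true, by simp only [cellSide]; linarith⟩, ⟨false, by simp only [cellSide]; linarith⟩]
    · rcases le_total (x.1 - i + (x.2 - j)) 1 with h | h
      exacts [⟨false, by simp only [cellSide]; linarith⟩, ⟨true, by simp only [cellSide]; linarith⟩]
  obtain ⟨b, hb⟩ := this
  exact ⟨((i, j), b), ⟨i0, i1, j0, j1⟩, i2, i3, j2, j3, hb⟩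

theorem closedCell_subset_domain {c : Cell} (hc : PixelIn n m c.1) :
    closedCell J c ⊆ domain n m := by
  obtain ⟨h1, h2, h3, h4⟩ := hc
  rintro x ⟨k1, k2, k3, k4, -⟩
  have r1 : (0 : ℝ) ≤ c.1.1 := by exact_mod_cast h1
  have r2 : (c.1.1 : ℝ) + 1 + 1 ≤ n := by
    have : c.1.1 + 1 + 1 ≤ (n : ℤ) := by omega
    exact_mod_cast this
  have r3 : (0 : ℝ) ≤ c.1.2 := by exact_mod_cast h3
  have r4 : (c.1.2 : ℝ) + 1 + 1 ≤ m := by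
    have : c.1.2 + 1 + 1 ≤ (m : ℤ) := by omega
    exact_mod_cast this
  exact ⟨by linarith, by linarith, by linarith, by linarith⟩

/-- `C` is a connected component of the domain without the lines of the graph. -/
def IsComponent (n m : ℕ) (J : Pt → Pt → Prop) (C : Set (ℝ × ℝ)) : Prop :=
  ∃ x ∈ domain n m \ graphLines n m J, C = connectedComponentIn (domain n m \ graphLines n m J) x

namespace IsComponent
variable {C : Set (ℝ × ℝ)} (hC : IsComponent n m J C)
include hC

theorem subset : C ⊆ domain n m \ graphLines n m J := by
  obtain ⟨x, hx, rfl⟩ := hC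
  exact connectedComponentIn_subset _ _

theorem isPreconnected : IsPreconnected C := by
  obtain ⟨x, hx, rfl⟩ := hC
  exact isPreconnected_connectedComponentIn

theorem nonempty : C.Nonempty := by
  obtain ⟨x, hx, rfl⟩ := hC
  exact ⟨x, mem_connectedComponentIn hx⟩

theorem subset_of_isPreconnected {U : Set (ℝ × ℝ)} (hU : IsPreconnected U)
    (hUG : U ⊆ domain n m \ graphLines n m J) {y : ℝ × ℝ} (hy : y ∈ U) (hyC : y ∈ C) : U ⊆ C := by
  obtain ⟨x, hx, rfl⟩ := hC
  rw [connectedComponentIn_eq hyC]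
  exact hU.subset_connectedComponentIn hy hUG

variable (hJ : IsWellJoined n m I J)
include hJ

theorem closedCell_diff_subset_of_mem {c : Cell} (hc : PixelIn n m c.1) {y : ℝ × ℝ}
    (hy : y ∈ closedCell J c) (hyC : y ∈ C) : closedCell J c \ graphLines n m J ⊆ C :=
  hC.subset_of_isPreconnected (isPreconnected_closedCell_diff hJ c)
    (sdiff_subset_sdiff_left (closedCell_subset_domain hc)) ⟨hy, (hC.subset hyC).2⟩ hyC

theorem mem_regionCells_of_mem {c : Cell} (hc : PixelIn n m c.1) {y : ℝ × ℝ}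
    (hy : y ∈ closedCell J c) (hyC : y ∈ C) : c ∈ regionCells n m J C :=
  ⟨hc, fun _ hx => hC.closedCell_diff_subset_of_mem hJ hc hy hyC
    ⟨openCell_subset_closedCell c hx, openCell_disjoint_graphLines hJ hx⟩⟩

theorem closedCell_diff_subset {c : Cell} (hc : c ∈ regionCells n m J C) :
    closedCell J c \ graphLines n m J ⊆ C := by
  obtain ⟨y, hy⟩ := openCell_nonempty (J := J) c
  exact hC.closedCell_diff_subset_of_mem hJ hc.1 (openCell_subset_closedCell c hy) (hc.2 hy)

omit hC hJ in
theorem closedCell_subset_closure {c : Cell} (hc : c ∈ regionCells n m J C) :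
    closedCell J c ⊆ closure C :=
  (ImageGraph.closedCell_subset_closure c).trans (closure_mono hc.2)

theorem glued_iff {c c' : Cell} (h : Glued n m J c c') :
    c ∈ regionCells n m J C ↔ c' ∈ regionCells n m J C := by
  obtain ⟨x, hx, hx', hG⟩ := h.exists_common hJ
  constructor
  · intro hc
    exact hC.mem_regionCells_of_mem hJ h.pixelIn.2 hx' (hC.closedCell_diff_subset hJ hc ⟨hx, hG⟩)
  · intro hc
    exact hC.mem_regionCells_of_mem hJ h.pixelIn.1 hx (hC.closedCell_diff_subset hJ hc ⟨hx', hG⟩)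

variable (hn : 2 ≤ n) (hm : 2 ≤ m)
include hn hm

theorem regionCells_nonempty : (regionCells n m J C).Nonempty := by
  obtain ⟨x, hx⟩ := hC.nonempty
  obtain ⟨c, hc, hxc⟩ := exists_mem_closedCell (J := J) hn hm (hC.subset hx).1
  exact ⟨c, hC.mem_regionCells_of_mem hJ hc hxc hx⟩

/-- The finitely many closed cells of the region form a closed set that contains the region, hence
also its closure. -/
theorem exists_mem_of_mem_closure {x : ℝ × ℝ} (hx : x ∈ closure C) :
    ∃ c ∈ regionCells n m J C, x ∈ closedCell J c := by
  have hcl : IsClosed (⋃ c ∈ regionCells n m J C, closedCell J c) :=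
    (finite_regionCells C).isClosed_biUnion fun c _ => isClosed_closedCell c
  have hsub : C ⊆ ⋃ c ∈ regionCells n m J C, closedCell J c := by
    intro y hy
    obtain ⟨c, hc, hyc⟩ := exists_mem_closedCell (J := J) hn hm (hC.subset hy).1
    exact mem_biUnion (hC.mem_regionCells_of_mem hJ hc hyc hy) hyc
  simpa using closure_minimal hsub hcl hx

omit hJ in
/-- Any two cells of the region are connected by a chain of glued cells. -/
theorem glued_connected {P : Cell → Prop} (hP : ∀ {c c'}, Glued n m J c c' → (P c ↔ P c'))
    {c c' : Cell} (hc : c ∈ regionCells n m J C) (hc' : c' ∈ regionCells n m J C) (h : P c) :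
    P c' := by
  by_contra hcon
  have hcl : ∀ Q : Cell → Prop, IsClosed (⋃ c ∈ {c | PixelIn n m c.1 ∧ Q c}, closedCell J c) :=
    fun Q => ((finite_pixelIn n m).subset fun _ h => h.1).isClosed_biUnion
      fun c _ => isClosed_closedCell c
  have meet : ∀ {Q : Cell → Prop} {c}, c ∈ regionCells n m J C → Q c →
      (C ∩ ⋃ c ∈ {c | PixelIn n m c.1 ∧ Q c}, closedCell J c).Nonempty := by
    intro Q c hc hQ
    obtain ⟨y, hy⟩ := openCell_nonempty (J := J) c
    exact ⟨y, hc.2 hy, mem_biUnion (show c ∈ {c | PixelIn n m c.1 ∧ Q c} from ⟨hc.1, hQ⟩)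
      (openCell_subset_closedCell c hy)⟩
  have hcov : C ⊆ (⋃ c ∈ {c | PixelIn n m c.1 ∧ P c}, closedCell J c) ∪
      ⋃ c ∈ {c | PixelIn n m c.1 ∧ ¬ P c}, closedCell J c := by
    intro y hy
    obtain ⟨d, hd, hyd⟩ := exists_mem_closedCell (J := J) hn hm (hC.subset hy).1
    by_cases hPd : P d
    · exact Or.inl (mem_biUnion (show d ∈ {c | PixelIn n m c.1 ∧ P c} from ⟨hd, hPd⟩) hyd)
    · exact Or.inr (mem_biUnion (show d ∈ {c | PixelIn n m c.1 ∧ ¬ P c} from ⟨hd, hPd⟩) hyd)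
  -- The cells with and without `P` give two closed sets that cover the region and both meet it. By
  -- connectedness they have a common point in it, and a common point off the graph transfers `P`
  -- from one cell to the other.
  obtain ⟨y, hyC, hy1, hy2⟩ := isPreconnected_closed_iff.mp hC.isPreconnected _ _
    (hcl P) (hcl fun c => ¬ P c) hcov (meet hc h) (meet hc' hcon)
  simp only [mem_iUnion, mem_ofPred_eq, exists_prop] at hy1 hy2
  obtain ⟨d, ⟨hd, hPd⟩, hyd⟩ := hy1
  obtain ⟨d', ⟨hd', hPd'⟩, hyd'⟩ := hy2
  exact hPd' ((iff_of_mem_closedCell hP hd hd' hyd hyd' (hC.subset hyC).2).mp hPd)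

end IsComponent

/-! ### The perimeter -/

/-- A side of a cell of the region is on the perimeter if it is an edge of the graph or on the
border of the domain. -/
theorem subset_frontier {C s : Set (ℝ × ℝ)} (hC : IsComponent n m J C) {c : Cell}
    (hc : c ∈ regionCells n m J C) (hs : s ⊆ closedCell J c)
    (hs' : s ⊆ graphLines n m J ∨ Disjoint s (interior (domain n m))) : s ⊆ frontier C := by
  intro x hx
  refine ⟨IsComponent.closedCell_subset_closure hc (hs hx), fun hint => ?_⟩
  rcases hs' with h | h
  · exact (hC.subset (interior_subset hint)).2 (h hx)
  · exact disjoint_left.mp h hx (interior_mono (fun y hy => (hC.subset hy).1) hint)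

theorem interior_domain (n m : ℕ) :
    interior (domain n m) = Ioo 0 ((n : ℝ) - 1) ×ˢ Ioo 0 ((m : ℝ) - 1) := by
  have : domain n m = Icc 0 ((n : ℝ) - 1) ×ˢ Icc 0 ((m : ℝ) - 1) := by
    ext x
    simp only [domain, mem_ofPred_eq, mem_prod, mem_Icc, and_assoc]
  rw [this, interior_prod_eq, interior_Icc, interior_Icc]

/-- A monotonic region contains no cell of a split pixel. -/
theorem not_split_of_monotonic {C : Set (ℝ × ℝ)} (hJ : IsWellJoined n m I J)
    (hC : IsComponent n m J C) (hmono : IsMonotonicRegion n m I C) {c : Cell}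
    (hc : c ∈ regionCells n m J C) : ¬ IsSplitPixel n m I c.1 := by
  obtain ⟨⟨i, j⟩, b⟩ := c
  rintro hsplit
  obtain ⟨x, h1, h2, h3, h4, hs⟩ := id hsplit
  simp only at h1 h2 h3 h4 hsplit
  -- The diagonals of a split pixel do not join neighbors, so no edge cuts it. The region then
  -- contains the whole open pixel, and the saddle is off its perimeter.
  have m1 : ¬ J (i, j) (i + 1, j + 1) := fun hj =>
    (hJ.mem_nbr hj).2 ⟨⟨by simp, by simp⟩, by simpa using hsplit⟩
  have m2 : ¬ J (i + 1, j) (i, j + 1) := fun hj =>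
    (hJ.mem_nbr hj).2 ⟨⟨by simp, by simp⟩, by simpa using hsplit⟩
  have hall : ∀ b', ((i, j), b') ∈ regionCells n m J C := by
    have := hC.glued_iff hJ (Glued.diag hc.1 m1 m2)
    intro b'
    cases b <;> cases b'
    exacts [hc, this.mp hc, this.mpr hc, hc]
  have hsub : Ioo (i : ℝ) (i + 1) ×ˢ Ioo (j : ℝ) (j + 1) ⊆ C := by
    rintro y ⟨⟨k1, k2⟩, k3, k4⟩
    have hG : y ∉ graphLines n m J := by
      intro hG
      rcases graphLines_cases hJ hG with ⟨k, l, hi, -⟩ | ⟨k, l, -, hi, -⟩ | ⟨k, l, -, hi, -⟩ |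
        ⟨k, l, hj, e, hi, hi'⟩ | ⟨k, l, hj, e, hi, hi'⟩
      · exact not_int_of_lt k1 k2 hi
      · exact not_int_of_lt k3 k4 hi
      · exact not_int_of_lt k1 k2 hi
      · obtain rfl := int_eq_of_lt k1 k2 hi hi'
        obtain rfl := int_eq_of_lt (k := l) k3 k4 (by linarith) (by linarith)
        exact m1 hj
      · obtain rfl := int_eq_of_lt k1 k2 hi hi'
        obtain rfl := int_eq_of_lt (k := l) k3 k4 (by linarith) (by linarith)
        exact m2 hj
    have ha := anti_eq_false (p := (i, j)).mpr m2
    rcases le_total (y.1 - i) (y.2 - j) with h | h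
    · refine hC.closedCell_diff_subset hJ (hall true) ⟨⟨k1.le, k2.le, k3.le, k4.le, ?_⟩, hG⟩
      simp only [ha, cellSide]
      linarith
    · refine hC.closedCell_diff_subset hJ (hall false) ⟨⟨k1.le, k2.le, k3.le, k4.le, ?_⟩, hG⟩
      simp only [ha, cellSide]
      linarith
  have hint : x ∈ interior C :=
    interior_maximal hsub (isOpen_Ioo.prod isOpen_Ioo) ⟨⟨h1, h2⟩, h3, h4⟩
  exact hmono x ⟨interior_subset hint, fun h => h.2 hint⟩ hs

/-! ### Signs, walls and regions around a node -/

/-- The values at 0, 1, a, b lie in opposite classes in turn, so there are at least four changes on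
the circle. A diagonal direction between axes of equal sign causes none, so each of the four gaps
between consecutive axes must have axes of different signs. Here the start is an axis; in the
companion lemma it is a diagonal direction. -/
theorem alternates_of_four_changes_even : ∀ s0 s1 s2 s3 s4 s5 s6 s7 : Bool,
    (s0 = s2 → s1 = s0) → (s2 = s4 → s3 = s2) → (s4 = s6 → s5 = s4) → (s6 = s0 → s7 = s6) →
    s0 ≠ s1 → ∀ a b : Fin 8, 1 < a → a < b → ![s0, s1, s2, s3, s4, s5, s6, s7] a ≠ s1 →
    ![s0, s1, s2, s3, s4, s5, s6, s7] b = s1 → s0 ≠ s2 ∧ s2 ≠ s4 ∧ s4 ≠ s6 ∧ s6 ≠ s0 := by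
  decide

theorem alternates_of_four_changes_odd : ∀ s0 s1 s2 s3 s4 s5 s6 s7 : Bool,
    (s1 = s3 → s2 = s1) → (s3 = s5 → s4 = s3) → (s5 = s7 → s6 = s5) → (s7 = s1 → s0 = s7) →
    s0 ≠ s1 → ∀ a b : Fin 8, 1 < a → a < b → ![s0, s1, s2, s3, s4, s5, s6, s7] a ≠ s1 →
    ![s0, s1, s2, s3, s4, s5, s6, s7] b = s1 → s1 ≠ s3 ∧ s3 ≠ s5 ∧ s5 ≠ s7 ∧ s7 ≠ s1 := by
  decide

/-- The situation around a node in eight directions: `s` is the sign of the difference between the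
value of the neighbor and that of the node, `w` tells which directions are walls between regions,
and `r` which of the eight sectors belong to a given region. The sector `i` lies between the
directions `i` and `i + 1`; the even directions are those of the axes. -/
structure NodeFan (s : ZMod 8 → Bool) (w r : ZMod 8 → Prop) : Prop where
  region : ∀ i, ¬ w i → (r (i - 1) ↔ r i)
  diag : ∀ a, s (2 * a) = s (2 * a + 2) → s (2 * a + 1) = s (2 * a)
  mix : (∀ a, s (2 * a) ≠ s (2 * a + 2)) → ∀ a, w (2 * a)
  exists_wall : ∀ a, ¬ w (2 * a) → ∃ t, w t ∧ s t = s (2 * a)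

theorem forall_zmod_eight_even : ∀ i : ZMod 8, (∃ a, i = 2 * a) ∨ ∃ a, i = 2 * a + 1 := by
  decide

theorem exists_nat_add (i t : ZMod 8) : ∃ d : ℕ, d ≤ 7 ∧ t = i + d := by
  refine ⟨(t - i).val, Nat.le_of_lt_succ (ZMod.val_lt (t - i)), ?_⟩
  rw [ZMod.natCast_zmod_val]
  ring

namespace NodeFan
variable {s : ZMod 8 → Bool} {w r : ZMod 8 → Prop} (h : NodeFan s w r)
include h

theorem exists_isWall : ∃ t, w t := by
  by_contra hcon
  push Not at hcon
  obtain ⟨t, ht, -⟩ := h.exists_wall 0 (hcon _)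
  exact hcon t ht

/-- The eight possible starts `j` are rotated to one of the two finite checks, according to their
parity. -/
theorem alternates (j : ZMod 8) (h0 : s j ≠ s (j + 1)) {a b : ℕ} (ha : 1 < a) (hab : a < b)
    (hb : b < 8) (h1 : s (j + a) ≠ s (j + 1)) (h2 : s (j + b) = s (j + 1)) :
    ∀ a, s (2 * a) ≠ s (2 * a + 2) := by
  have hvec : ∀ c : ℕ, ∀ hc : c < 8, ![s j, s (j + 1), s (j + 2), s (j + 3), s (j + 4), s (j + 5),
      s (j + 6), s (j + 7)] ⟨c, hc⟩ = s (j + c) := by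
    intro c hc
    interval_cases c <;> simp
  have key : ∀ {p : ZMod 8 → Prop}, p 0 → p 1 → p 2 → p 3 → p 4 → p 5 → p 6 → p 7 → ∀ a, p a := by
    intro p p0 p1 p2 p3 p4 p5 p6 p7 a
    change Fin 8 at a
    fin_cases a <;> assumption
  have h1' := h1
  have h2' := h2
  rw [← hvec a (by omega)] at h1'
  rw [← hvec b hb] at h2'
  have d0 := h.diag 0
  have d1 := h.diag 1
  have d2 := h.diag 2
  have d3 := h.diag 3
  have fin : s 0 ≠ s 2 ∧ s 2 ≠ s 4 ∧ s 4 ≠ s 6 ∧ s 6 ≠ s 0 → ∀ a, s (2 * a) ≠ s (2 * a + 2) := by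
    rintro ⟨f0, f1, f2, f3⟩
    exact key f0 f1 f2 f3 f0 f1 f2 f3
  apply fin
  have hd : (s 0 = s 2 → s 1 = s 0) ∧ (s 2 = s 4 → s 3 = s 2) ∧ (s 4 = s 6 → s 5 = s 4) ∧
    (s 6 = s 0 → s 7 = s 6) := ⟨d0, d1, d2, d3⟩
  obtain ⟨g0, g1, g2, g3⟩ := hd
  have even := alternates_of_four_changes_even (s j) (s (j + 1)) (s (j + 2)) (s (j + 3))
    (s (j + 4)) (s (j + 5)) (s (j + 6)) (s (j + 7))
  have odd := alternates_of_four_changes_odd (s j) (s (j + 1)) (s (j + 2)) (s (j + 3))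
    (s (j + 4)) (s (j + 5)) (s (j + 6)) (s (j + 7))
  have lt1 : (1 : Fin 8) < ⟨a, by omega⟩ := by
    rw [Fin.lt_def]
    exact ha
  have lt2 : (⟨a, by omega⟩ : Fin 8) < ⟨b, hb⟩ := by
    rw [Fin.lt_def]
    exact hab
  have hj : ∀ j : ZMod 8, j = 0 ∨ j = 1 ∨ j = 2 ∨ j = 3 ∨ j = 4 ∨ j = 5 ∨ j = 6 ∨ j = 7 := by
    decide
  replace hj := hj j
  rcases hj with rfl | rfl | rfl | rfl | rfl | rfl | rfl | rfl
  · exact even g0 g1 g2 g3 h0 _ _ lt1 lt2 h1' h2'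
  · obtain ⟨e0, e1, e2, e3⟩ := odd g1 g2 g3 g0 h0 _ _ lt1 lt2 h1' h2'
    exact ⟨e3, e0, e1, e2⟩
  · obtain ⟨e0, e1, e2, e3⟩ := even g1 g2 g3 g0 h0 _ _ lt1 lt2 h1' h2'
    exact ⟨e3, e0, e1, e2⟩
  · obtain ⟨e0, e1, e2, e3⟩ := odd g2 g3 g0 g1 h0 _ _ lt1 lt2 h1' h2'
    exact ⟨e2, e3, e0, e1⟩
  · obtain ⟨e0, e1, e2, e3⟩ := even g2 g3 g0 g1 h0 _ _ lt1 lt2 h1' h2'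
    exact ⟨e2, e3, e0, e1⟩
  · obtain ⟨e0, e1, e2, e3⟩ := odd g3 g0 g1 g2 h0 _ _ lt1 lt2 h1' h2'
    exact ⟨e1, e2, e3, e0⟩
  · obtain ⟨e0, e1, e2, e3⟩ := even g3 g0 g1 g2 h0 _ _ lt1 lt2 h1' h2'
    exact ⟨e1, e2, e3, e0⟩
  · obtain ⟨e0, e1, e2, e3⟩ := odd g0 g1 g2 g3 h0 _ _ lt1 lt2 h1' h2'
    exact ⟨e0, e1, e2, e3⟩

/-- Between two sectors with a change of the sign there is a wall. -/
theorem not_two_changes (j : ZMod 8) {k : ℕ} (hk : 1 ≤ k)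
    (hw : ∀ l : ℕ, 1 ≤ l → l ≤ k → ¬ w (j + l))
    (h0 : s j ≠ s (j + 1)) (h1 : s (j + k) ≠ s (j + k + 1)) : False := by
  classical
  have hex : ∃ k : ℕ, 1 ≤ k ∧ s (j + k) ≠ s (j + k + 1) := ⟨k, hk, h1⟩
  obtain ⟨hk1, hk2⟩ := Nat.find_spec hex
  have hkk : Nat.find hex ≤ k := Nat.find_le ⟨hk, h1⟩
  -- Let q be the distance to the first further change: the directions j + 1, ..., j + q form a run
  -- of one sign without walls, and both directions next to the run have the other sign.
  have hmin : ∀ l : ℕ, 1 ≤ l → l < Nat.find hex → s (j + l) = s (j + l + 1) := by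
    intro l hl hl'
    by_contra hcon
    exact Nat.find_min hex hl' ⟨hl, hcon⟩
  set q := Nat.find hex
  have hconst : ∀ l : ℕ, 1 ≤ l → l ≤ q → s (j + l) = s (j + 1) := by
    intro l hl hl'
    induction l, hl using Nat.le_induction with
    | base => simp
    | succ l hl ih =>
      rw [← ih (by omega), hmin l hl (by omega)]
      push_cast
      rw [add_assoc]
  have hlast : s (j + q + 1) ≠ s (j + 1) := fun e => hk2 (by rw [hconst q hk1 le_rfl, e])
  -- If the run contains an axis, some wall has the sign of the run. It is outside the run and not
  -- next to it, which makes four changes. So the axes alternate and are walls, also the axis in the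
  -- run.
  by_cases heven : ∃ l : ℕ, 1 ≤ l ∧ l ≤ q ∧ ∃ a, j + l = 2 * a
  · obtain ⟨l, hl, hlq, a, ha⟩ := heven
    have hnw : ¬ w (2 * a) := ha ▸ hw l hl (hlq.trans hkk)
    obtain ⟨t, ht, hst⟩ := h.exists_wall a hnw
    rw [← ha, hconst l hl hlq] at hst
    obtain ⟨e, he, rfl⟩ := exists_nat_add j t
    have he0 : e ≠ 0 := by
      rintro rfl
      apply h0
      simpa using hst
    have heq : q < e := by
      by_contra hcon
      exact hw e (by omega) (by omega) ht
    have heq' : e ≠ q + 1 := by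
      rintro rfl
      apply hlast
      rw [← hst]
      push_cast
      rw [add_assoc]
    refine hnw (h.mix (h.alternates j h0 (a := q + 1) (b := e) (by omega) (by omega) (by omega)
      ?_ hst) a)
    push_cast
    rwa [← add_assoc]
  -- A run without an axis is a single diagonal direction, between two axes of equal sign that
  -- differ from it. This is excluded by `diag`.
  · have hq : q = 1 := by
      by_contra hcon
      rcases forall_zmod_eight_even (j + 1) with ⟨a, ha⟩ | ⟨a, ha⟩
      · exact heven ⟨1, le_rfl, hk1, a, by simpa using ha⟩
      · refine heven ⟨2, by omega, by omega, a + 1, ?_⟩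
        push_cast
        rw [show j + 2 = j + 1 + 1 by ring, ha]
        ring
    rw [hq] at hlast
    rcases forall_zmod_eight_even j with ⟨a, ha⟩ | ⟨a, ha⟩
    · subst ha
      push_cast at hlast
      rw [show 2 * a + 1 + 1 = 2 * a + 2 by ring] at hlast
      by_cases e : s (2 * a) = s (2 * a + 2)
      · exact h0 (h.diag a e).symm
      · revert h0 hlast e
        cases s (2 * a) <;> cases s (2 * a + 1) <;> cases s (2 * a + 2) <;> simp
    · refine heven ⟨1, le_rfl, hk1, a + 1, ?_⟩
      rw [ha]
      push_cast
      ring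

/-- The last wall before a sector. -/
theorem exists_wall_before (i : ZMod 8) : ∃ d : ℕ, w (i - d) ∧
    (∀ e : ℕ, e < d → ¬ w (i - e)) ∧ ∀ e : ℕ, e ≤ d → (r (i - e) ↔ r i) := by
  classical
  have hex : ∃ d : ℕ, w (i - d) := by
    obtain ⟨t, ht⟩ := h.exists_isWall
    obtain ⟨d, -, hd⟩ := exists_nat_add t i
    refine ⟨d, ?_⟩
    rw [hd]
    simpa using ht
  refine ⟨Nat.find hex, Nat.find_spec hex, fun e he => Nat.find_min hex he, ?_⟩
  intro e he
  induction e with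
  | zero => simp
  | succ e ih =>
    have h1 := h.region (i - e) (Nat.find_min hex (by omega))
    rw [← ih (by omega), ← h1]
    push_cast
    rw [sub_sub]

/-- The first wall after a sector. -/
theorem exists_wall_after (i : ZMod 8) : ∃ d : ℕ, w (i + 1 + d) ∧
    (∀ e : ℕ, e < d → ¬ w (i + 1 + e)) ∧ ∀ e : ℕ, e ≤ d → (r (i + e) ↔ r i) := by
  classical
  have hex : ∃ d : ℕ, w (i + 1 + d) := by
    obtain ⟨t, ht⟩ := h.exists_isWall
    obtain ⟨d, -, hd⟩ := exists_nat_add (i + 1) t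
    exact ⟨d, hd ▸ ht⟩
  refine ⟨Nat.find hex, Nat.find_spec hex, fun e he => Nat.find_min hex he, ?_⟩
  intro e he
  induction e with
  | zero => simp
  | succ e ih =>
    have h1 := h.region (i + 1 + e) (Nat.find_min hex (by omega))
    rw [← ih (by omega), show i + (e : ZMod 8) = i + 1 + e - 1 by ring, h1]
    push_cast
    rw [show i + ((e : ZMod 8) + 1) = i + 1 + e by ring]

open Classical in
/-- A region has at least as many walls at a node as it has sectors with a change of the sign. -/
theorem card_changes_le :
    (Finset.univ.filter fun i => r i ∧ s i ≠ s (i + 1)).card ≤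
      (Finset.univ.filter fun i => r i ∧ w i).card := by
  -- Each sector with a change is sent to the last wall at or before its start, which belongs to the
  -- same region. Two changes with the same wall would have no wall between them.
  choose d hd hd' hd'' using h.exists_wall_before
  refine Finset.card_le_card_of_injOn (fun i => i - d i) ?_ ?_
  · intro i hi
    simp only [Finset.coe_filter, Finset.mem_univ, true_and, mem_ofPred_eq] at hi ⊢
    exact ⟨(hd'' i _ le_rfl).mpr hi.1, hd i⟩
  · have key : ∀ i i', s i ≠ s (i + 1) → s i' ≠ s (i' + 1) → i - d i = i' - d i' →
        ¬ d i < d i' := by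
      intro i i' hi hi' heq hlt
      obtain ⟨k, hk⟩ := Nat.exists_eq_add_of_lt hlt
      have hii : i' = i + ((k + 1 : ℕ) : ZMod 8) := by
        rw [hk] at heq
        push_cast at heq ⊢
        linear_combination -heq
      refine h.not_two_changes i (k := k + 1) (by omega) ?_ hi (hii ▸ hi')
      intro l hl hlk
      have := hd' i' (k + 1 - l) (by omega)
      rw [hii] at this
      have e : i + ((k + 1 : ℕ) : ZMod 8) - ((k + 1 - l : ℕ) : ZMod 8) = i + l := by
        rw [Nat.cast_sub hlk]
        ring
      rwa [e] at this
    intro i hi i' hi' heq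
    simp only [Finset.coe_filter, Finset.mem_univ, true_and, mem_ofPred_eq] at hi hi' heq
    have h1 := key i i' hi.2 hi'.2 heq
    have h2 := key i' i hi'.2 hi.2 heq.symm
    have h3 : d i = d i' := by omega
    rw [h3] at heq
    exact sub_left_injective heq

open Classical in
/-- If all walls of the region at a node have the same sign, then there are no changes of the
sign in the region. -/
theorem card_changes_lt {σ : Bool} (hσ : ∀ i, w i → (r i ∨ r (i - 1)) → s i = σ)
    (hr : ∃ i, r i) :
    (Finset.univ.filter fun i => r i ∧ s i ≠ s (i + 1)).card <
      (Finset.univ.filter fun i => r i ∧ w i).card := by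
  -- A change would be the only one between the walls that bound its stretch, so these walls would
  -- have different signs.
  have hno : ∀ i, ¬ (r i ∧ s i ≠ s (i + 1)) := by
    rintro i ⟨hi, hne⟩
    obtain ⟨d, hd, hd', hd''⟩ := h.exists_wall_before i
    obtain ⟨d₁, hd₁, hd₁', hd₁''⟩ := h.exists_wall_after i
    have e1 : ∀ e : ℕ, e ≤ d → s (i - e) = s i := by
      intro e he
      induction e with
      | zero => simp
      | succ e ih =>
        rw [← ih (by omega)]
        by_contra hcon
        have hstep : i - ((e + 1 : ℕ) : ZMod 8) + 1 = i - e := by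
          push_cast
          ring
        refine h.not_two_changes (i - (e + 1 : ℕ)) (k := e + 1) (by omega) ?_
          (by rwa [hstep]) (by rwa [sub_add_cancel])
        intro l hl hle
        have := hd' (e + 1 - l) (by omega)
        rw [Nat.cast_sub hle] at this
        rwa [show i - (((e + 1 : ℕ) : ZMod 8) - l) = i - (e + 1 : ℕ) + l by ring] at this
    have e2 : ∀ e : ℕ, e ≤ d₁ → s (i + 1 + e) = s (i + 1) := by
      intro e he
      induction e with
      | zero => simp
      | succ e ih =>
        rw [← ih (by omega)]
        by_contra hcon
        have hstep : i + ((e + 1 : ℕ) : ZMod 8) = i + 1 + e := by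
          push_cast
          ring
        refine h.not_two_changes i (k := e + 1) (by omega) ?_ hne ?_
        · intro l hl hle
          have := hd₁' (l - 1) (by omega)
          rw [Nat.cast_sub hl] at this
          rwa [show i + 1 + ((l : ZMod 8) - (1 : ℕ)) = i + l by push_cast; ring] at this
        · rw [hstep]
          intro hc
          apply hcon
          rw [hc]
          push_cast
          rw [show i + 1 + ((e : ZMod 8) + 1) = i + 1 + e + 1 by ring]
    have f1 := hσ _ hd (Or.inl ((hd'' d le_rfl).mpr hi))
    have f2 := hσ _ hd₁ (Or.inr (by
      rw [show i + 1 + (d₁ : ZMod 8) - 1 = i + d₁ by ring]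
      exact (hd₁'' d₁ le_rfl).mpr hi))
    rw [e1 d le_rfl] at f1
    rw [e2 d₁ le_rfl] at f2
    exact hne (f1.trans f2.symm)
  -- There are no changes, while the last wall before any sector of the region counts on the right.
  rw [Finset.filter_false_of_mem fun i _ => hno i, Finset.card_empty, Finset.card_pos]
  obtain ⟨i, hi⟩ := hr
  obtain ⟨d, hd, -, hd''⟩ := h.exists_wall_before i
  exact ⟨i - d, by simpa using ⟨(hd'' d le_rfl).mpr hi, hd⟩⟩

end NodeFan

/-! ### The eight directions at a node -/

theorem forall_zmod_eight {P : ZMod 8 → Prop} (h0 : P 0) (h1 : P 1) (h2 : P 2) (h3 : P 3)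
    (h4 : P 4) (h5 : P 5) (h6 : P 6) (h7 : P 7) (k) : P k := by
  change Fin 8 at k
  fin_cases k <;> assumption

/-- The eight points around `p`, counterclockwise from the right. -/
def around (p : Pt) (k : ZMod 8) : Pt :=
  (![(p.1 + 1, p.2), (p.1 + 1, p.2 + 1), (p.1, p.2 + 1), (p.1 - 1, p.2 + 1), (p.1 - 1, p.2),
    (p.1 - 1, p.2 - 1), (p.1, p.2 - 1), (p.1 + 1, p.2 - 1)] : Fin 8 → Pt) k

/-- The cell that contains the sector between the directions `k` and `k + 1` at `p`. -/
noncomputable def sectorCell (J : Pt → Pt → Prop) (p : Pt) (k : ZMod 8) : Cell :=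
  (![((p.1, p.2), false), ((p.1, p.2), !anti J (p.1, p.2)),
    ((p.1 - 1, p.2), anti J (p.1 - 1, p.2)), ((p.1 - 1, p.2), false),
    ((p.1 - 1, p.2 - 1), true), ((p.1 - 1, p.2 - 1), anti J (p.1 - 1, p.2 - 1)),
    ((p.1, p.2 - 1), !anti J (p.1, p.2 - 1)), ((p.1, p.2 - 1), true)] : Fin 8 → Cell) k

/-- The direction `k` at `p` is on the border of the image, or it is that of an edge. -/
def IsWall (n m : ℕ) (J : Pt → Pt → Prop) (p : Pt) (k : ZMod 8) : Prop :=
  ¬ (PixelIn n m (sectorCell J p (k - 1)).1 ∧ PixelIn n m (sectorCell J p k).1 ∧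
    ¬ J p (around p k))

open Classical in
/-- The sign in the direction of an axis; outside the image it is chosen opposite to that of the
opposite direction. -/
noncomputable def axisSign (n m : ℕ) (I : Pt → ℝ) (p q q' : Pt) : Bool :=
  if q ∈ grid n m then decide (I p < I q) else !decide (I p < I q')

open Classical in
/-- The sign in the direction of the diagonal of the pixel `c`, if it is not a split pixel. -/
noncomputable def diagSign (n m : ℕ) (I : Pt → ℝ) (p c q : Pt) (b : Bool) : Bool :=
  if PixelIn n m c ∧ ¬ IsSplitPixel n m I c then decide (I p < I q) else b

/-- The signs of the differences between the values around `p` and that of `p`. -/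
noncomputable def signAround (n m : ℕ) (I : Pt → ℝ) (p : Pt) (k : ZMod 8) : Bool :=
  (![axisSign n m I p (p.1 + 1, p.2) (p.1 - 1, p.2),
    diagSign n m I p (p.1, p.2) (p.1 + 1, p.2 + 1) (axisSign n m I p (p.1 + 1, p.2) (p.1 - 1, p.2)),
    axisSign n m I p (p.1, p.2 + 1) (p.1, p.2 - 1),
    diagSign n m I p (p.1 - 1, p.2) (p.1 - 1, p.2 + 1)
      (axisSign n m I p (p.1, p.2 + 1) (p.1, p.2 - 1)),
    axisSign n m I p (p.1 - 1, p.2) (p.1 + 1, p.2),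
    diagSign n m I p (p.1 - 1, p.2 - 1) (p.1 - 1, p.2 - 1)
      (axisSign n m I p (p.1 - 1, p.2) (p.1 + 1, p.2)),
    axisSign n m I p (p.1, p.2 - 1) (p.1, p.2 + 1),
    diagSign n m I p (p.1, p.2 - 1) (p.1 + 1, p.2 - 1)
      (axisSign n m I p (p.1, p.2 - 1) (p.1, p.2 + 1))] : Fin 8 → Bool) k

/-- Across a direction that is not a wall, the two sectors are in the same cell or in glued cells.
The same cell occurs at the two corners of a pixel that its dividing diagonal does not reach. -/
theorem region_iff {C : Set (ℝ × ℝ)} (hJ : IsWellJoined n m I J) (hC : IsComponent n m J C)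
    (p : Pt) (k : ZMod 8) (hk : ¬ IsWall n m J p k) :
    sectorCell J p (k - 1) ∈ regionCells n m J C ↔ sectorCell J p k ∈ regionCells n m J C := by
  have glue : ∀ {c c'}, Glued n m J c c' → (c ∈ regionCells n m J C ↔ c' ∈ regionCells n m J C) :=
    fun h => hC.glued_iff hJ h
  rw [IsWall, not_not] at hk
  obtain ⟨i, j⟩ := p
  have main : ∀ {k l : ℤ} (b : Bool), PixelIn n m (k, l) → ¬ J (k, l) (k + 1, l + 1) →
      ∀ b', (anti J (k, l) = true → b = b') →
      (((k, l), b) ∈ regionCells n m J C ↔ ((k, l), b') ∈ regionCells n m J C) := by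
    intro k l b hp hj b' hb
    cases ha : anti J (k, l)
    · have := glue (Glued.diag hp hj (anti_eq_false.mp ha))
      cases b <;> cases b'
      exacts [Iff.rfl, this, this.symm, Iff.rfl]
    · rw [hb ha]
  revert k
  refine forall_zmod_eight ?_ ?_ ?_ ?_ ?_ ?_ ?_ ?_ <;> rintro ⟨h1, h2, h3⟩
  · exact (glue (Glued.bottom h2 h1 h3)).symm
  · exact main false h1 h3 _ (fun h => by rw [h]; rfl)
  · exact glue (Glued.left h1 h2 h3)
  · change ¬ J (i, j) (i - 1, j + 1) at h3
    have ha : anti J (i - 1, j) = false := by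
      rw [anti_eq_false]
      simpa using h3
    change ((i - 1, j), anti J (i - 1, j)) ∈ _ ↔ ((i - 1, j), false) ∈ _
    rw [ha]
  · refine glue (Glued.bottom h1 h2 ?_)
    rw [sub_add_cancel]
    exact fun h => h3 (hJ.symm h)
  · refine main true h1 ?_ _ (fun h => by exact h.symm)
    simp only [sub_add_cancel]
    exact fun h => h3 (hJ.symm h)
  · refine (glue (Glued.left h2 h1 ?_)).symm
    rw [sub_add_cancel]
    exact fun h => h3 (hJ.symm h)
  · change ¬ J (i, j) (i + 1, j - 1) at h3
    have ha : anti J (i, j - 1) = false := by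
      rw [anti_eq_false]
      simp only [sub_add_cancel]
      exact fun h => h3 (hJ.symm h)
    change ((i, j - 1), !anti J (i, j - 1)) ∈ _ ↔ ((i, j - 1), true) ∈ _
    rw [ha]
    rfl

theorem alternating_rotate {a b d c : ℝ} : Alternating a b d c ↔ Alternating b d c a := by
  unfold Alternating
  tauto

/-- If both neighbors b, c of the corner a are on one side of it and d is on the other, then a and d
are both above, or both below, b and c. -/
theorem sign_eq_of_not_alternating {a b d c : ℝ} (h : ¬ Alternating a b d c) (hb : a ≠ b)
    (hc : a ≠ c) (hs : (a < b) ↔ (a < c)) : (a < d) ↔ (a < b) := by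
  unfold Alternating at h
  constructor
  · intro hd
    by_contra hcon
    have h1 : b < a := lt_of_le_of_ne (not_lt.mp hcon) hb.symm
    have h2 : c < a := lt_of_le_of_ne (not_lt.mp (fun h' => hcon (hs.mpr h'))) hc.symm
    exact h (Or.inl ⟨h1, h2, h1.trans hd, h2.trans hd⟩)
  · intro hab
    by_contra hcon
    have hda := not_lt.mp hcon
    exact h (Or.inr ⟨hab, hs.mp hab, hda.trans_lt hab, hda.trans_lt (hs.mp hab)⟩)

theorem axisSign_of_mem {p q q' : Pt} (hq : q ∈ grid n m) :
    axisSign n m I p q q' = true ↔ I p < I q := by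
  simp [axisSign, hq]

theorem diagSign_eq (hI : InjOn I (grid n m)) {p c q q₁ q₂ q₁' q₂' : Pt} (hp : p ∈ grid n m)
    (h1 : PixelIn n m c → q₁ ∈ grid n m) (h2 : PixelIn n m c → q₂ ∈ grid n m)
    (hne1 : p ≠ q₁) (hne2 : p ≠ q₂)
    (halt : PixelIn n m c → ¬ IsSplitPixel n m I c → ¬ Alternating (I p) (I q₁) (I q) (I q₂))
    (h : axisSign n m I p q₁ q₁' = axisSign n m I p q₂ q₂') :
    diagSign n m I p c q (axisSign n m I p q₁ q₁') = axisSign n m I p q₁ q₁' := by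
  unfold diagSign
  split_ifs with hc
  · have e1 := axisSign_of_mem (I := I) (p := p) (q' := q₁') (h1 hc.1)
    have e2 := axisSign_of_mem (I := I) (p := p) (q' := q₂') (h2 hc.1)
    rw [Bool.eq_iff_iff, decide_eq_true_iff, e1]
    refine sign_eq_of_not_alternating (halt hc.1 hc.2) (fun e => hne1 (hI hp (h1 hc.1) e))
      (fun e => hne2 (hI hp (h2 hc.1) e)) ?_
    rw [← e1, ← e2, h]
  · rfl

theorem not_alternating_of_not_split {i j : ℤ} (hp : PixelIn n m (i, j))
    (h : ¬ IsSplitPixel n m I (i, j)) :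
    ¬ Alternating (I (i, j)) (I (i + 1, j)) (I (i + 1, j + 1)) (I (i, j + 1)) :=
  fun h' => h (isSplitPixel_of_alternating hp h')

/-- At each corner the pixel is read with a different starting point, hence the rotations of
`Alternating`. If the pixel is split or outside the image, the sign was set to that of the preceding
axis. -/
theorem signAround_diag (hI : InjOn I (grid n m)) {p : Pt} (hp : p ∈ grid n m) (a : ZMod 8)
    (h : signAround n m I p (2 * a) = signAround n m I p (2 * a + 2)) :
    signAround n m I p (2 * a + 1) = signAround n m I p (2 * a) := by
  obtain ⟨i, j⟩ := p
  have d0 : signAround n m I (i, j) 0 = signAround n m I (i, j) 2 →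
      signAround n m I (i, j) 1 = signAround n m I (i, j) 0 := fun h =>
    diagSign_eq hI hp (fun h => h.corners.2.1) (fun h => h.corners.2.2.1) (by simp) (by simp)
      (fun h1 h2 => not_alternating_of_not_split h1 h2) h
  have d1 : signAround n m I (i, j) 2 = signAround n m I (i, j) 4 →
      signAround n m I (i, j) 3 = signAround n m I (i, j) 2 := fun h =>
    diagSign_eq hI hp (fun h => by simpa using h.corners.2.2.2) (fun h => h.corners.1) (by simp)
      (by simp; omega)
      (fun h1 h2 => by simpa using alternating_rotate.not.mp (not_alternating_of_not_split h1 h2)) h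
  have d2 : signAround n m I (i, j) 4 = signAround n m I (i, j) 6 →
      signAround n m I (i, j) 5 = signAround n m I (i, j) 4 := fun h =>
    diagSign_eq hI hp (fun h => by simpa using h.corners.2.2.1)
      (fun h => by simpa using h.corners.2.1) (by simp; omega) (by simp; omega)
      (fun h1 h2 => by
        simpa using alternating_rotate.not.mp
          (alternating_rotate.not.mp (not_alternating_of_not_split h1 h2))) h
  have d3 : signAround n m I (i, j) 6 = signAround n m I (i, j) 0 →
      signAround n m I (i, j) 7 = signAround n m I (i, j) 6 := fun h =>
    diagSign_eq hI hp (fun h => h.corners.1) (fun h => by simpa using h.corners.2.2.2)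
      (by simp; omega)
      (by simp)
      (fun h1 h2 => by
        simpa using alternating_rotate.not.mpr (not_alternating_of_not_split h1 h2)) h
  exact forall_zmod_eight (P := fun a => signAround n m I (i, j) (2 * a) =
    signAround n m I (i, j) (2 * a + 2) → signAround n m I (i, j) (2 * a + 1) =
      signAround n m I (i, j) (2 * a)) d0 d1 d2 d3 d0 d1 d2 d3 a h

/-- Alternating axes have equal signs in opposite directions. A direction out of the image was given
the sign opposite to its counterpart, so all four axis neighbors are in the grid and the node is a
genuine mix point. -/
theorem signAround_mix (hn : 2 ≤ n) (hm : 2 ≤ m) (hI : InjOn I (grid n m))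
    (hJ : IsWellJoined n m I J) {p : Pt} (hp : p ∈ grid n m)
    (h : ∀ a, signAround n m I p (2 * a) ≠ signAround n m I p (2 * a + 2)) (a : ZMod 8) :
    IsWall n m J p (2 * a) := by
  obtain ⟨i, j⟩ := p
  obtain ⟨i0, i1, j0, j1⟩ := id hp
  simp only at i0 i1 j0 j1
  have h0 : axisSign n m I (i, j) (i + 1, j) (i - 1, j) ≠
    axisSign n m I (i, j) (i, j + 1) (i, j - 1) := h 0
  have h1 : axisSign n m I (i, j) (i, j + 1) (i, j - 1) ≠
    axisSign n m I (i, j) (i - 1, j) (i + 1, j) := h 1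
  have h2 : axisSign n m I (i, j) (i - 1, j) (i + 1, j) ≠
    axisSign n m I (i, j) (i, j - 1) (i, j + 1) := h 2
  have e02 : axisSign n m I (i, j) (i + 1, j) (i - 1, j) =
      axisSign n m I (i, j) (i - 1, j) (i + 1, j) := by
    revert h0 h1
    generalize axisSign n m I (i, j) (i + 1, j) (i - 1, j) = a
    generalize axisSign n m I (i, j) (i - 1, j) (i + 1, j) = b
    generalize axisSign n m I (i, j) (i, j + 1) (i, j - 1) = c
    cases a <;> cases b <;> cases c <;> simp
  have e13 : axisSign n m I (i, j) (i, j + 1) (i, j - 1) =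
      axisSign n m I (i, j) (i, j - 1) (i, j + 1) := by
    revert h1 h2
    generalize axisSign n m I (i, j) (i, j + 1) (i, j - 1) = a
    generalize axisSign n m I (i, j) (i - 1, j) (i + 1, j) = b
    generalize axisSign n m I (i, j) (i, j - 1) (i, j + 1) = c
    cases a <;> cases b <;> cases c <;> simp
  have opp : ∀ {q q' : Pt}, (q ∈ grid n m ∨ q' ∈ grid n m) →
      axisSign n m I (i, j) q q' = axisSign n m I (i, j) q' q → q ∈ grid n m ∧ q' ∈ grid n m := by
    intro q q' hor heq
    by_contra hcon
    unfold axisSign at heq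
    by_cases hq : q ∈ grid n m <;> by_cases hq' : q' ∈ grid n m <;> simp_all
  have gE : ((i + 1, j) : Pt) ∈ grid n m ↔ i + 1 < n :=
    ⟨fun h => h.2.1, fun h => ⟨by simp only; omega, h, j0, j1⟩⟩
  have gW : ((i - 1, j) : Pt) ∈ grid n m ↔ 0 < i :=
    ⟨fun h => by have := h.1; simp only at this; omega,
      fun h => ⟨by simp only; omega, by simp only; omega, j0, j1⟩⟩
  have gN : ((i, j + 1) : Pt) ∈ grid n m ↔ j + 1 < m :=
    ⟨fun h => h.2.2.2, fun h => ⟨i0, i1, by simp only; omega, h⟩⟩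
  have gS : ((i, j - 1) : Pt) ∈ grid n m ↔ 0 < j :=
    ⟨fun h => by have := h.2.2.1; simp only at this; omega,
      fun h => ⟨i0, i1, by simp only; omega, by simp only; omega⟩⟩
  obtain ⟨hE, hW⟩ := opp (by rw [gE, gW]; omega) e02
  obtain ⟨hN, hS⟩ := opp (by rw [gN, gS]; omega) e13
  have sE := axisSign_of_mem (I := I) (p := (i, j)) (q' := (i - 1, j)) hE
  have sW := axisSign_of_mem (I := I) (p := (i, j)) (q' := (i + 1, j)) hW
  have sN := axisSign_of_mem (I := I) (p := (i, j)) (q' := (i, j - 1)) hN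
  have sS := axisSign_of_mem (I := I) (p := (i, j)) (q' := (i, j + 1)) hS
  have neg : ∀ {q}, q ∈ grid n m → (i, j) ≠ q → ¬ I (i, j) < I q → I q < I (i, j) :=
    fun hq hne h => lt_of_le_of_ne (not_lt.mp h) fun e => hne (hI hp hq e.symm)
  have hmix : MixSigns I i j := by
    by_cases hlt : I (i, j) < I (i + 1, j)
    · left
      have t0 := sE.mpr hlt
      have t2 := e02 ▸ t0
      have t1 : ¬ axisSign n m I (i, j) (i, j + 1) (i, j - 1) = true := fun e =>
        h0 (t0.trans e.symm)
      exact ⟨hlt, sW.mp t2, neg hN (by simp) fun e => t1 (sN.mpr e),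
        neg hS (by simp; omega) fun e => t1 (e13 ▸ sS.mpr e)⟩
    · right
      have t0 := sE.not.mpr hlt
      have t2 := e02 ▸ t0
      have t1 : axisSign n m I (i, j) (i, j + 1) (i, j - 1) = true := by
        by_contra e
        rw [Bool.not_eq_true] at t0 e
        exact h0 (t0.trans e.symm)
      exact ⟨neg hE (by simp) hlt, neg hW (by simp; omega) (sW.not.mp t2), sN.mp t1,
        sS.mp (e13 ▸ t1)⟩
  obtain ⟨jE, jW, jN, jS⟩ := hJ.mix (gW.mp hW) (gE.mp hE) (gS.mp hS) (gN.mp hN) hmix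
  have w0 : IsWall n m J (i, j) 0 := fun h => h.2.2 jE
  have w2 : IsWall n m J (i, j) 2 := fun h => h.2.2 jN
  have w4 : IsWall n m J (i, j) 4 := fun h => h.2.2 jW
  have w6 : IsWall n m J (i, j) 6 := fun h => h.2.2 jS
  exact forall_zmod_eight (P := fun a => IsWall n m J (i, j) (2 * a)) w0 w2 w4 w6 w0 w2 w4 w6 a

theorem exists_around {p q : Pt} (hq : q ∈ n8 n m p) : ∃ k, q = around p k := by
  obtain ⟨i, j⟩ := p
  obtain ⟨k, l⟩ := q
  obtain ⟨-, hne, h1, h2⟩ := hq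
  simp only at h1 h2
  rw [abs_le] at h1 h2
  obtain rfl | rfl | rfl : k = i - 1 ∨ k = i ∨ k = i + 1 := by omega
  · obtain rfl | rfl | rfl : l = j - 1 ∨ l = j ∨ l = j + 1 := by omega
    exacts [⟨5, rfl⟩, ⟨4, rfl⟩, ⟨3, rfl⟩]
  · obtain rfl | rfl | rfl : l = j - 1 ∨ l = j ∨ l = j + 1 := by omega
    exacts [⟨6, rfl⟩, absurd rfl hne, ⟨2, rfl⟩]
  · obtain rfl | rfl | rfl : l = j - 1 ∨ l = j ∨ l = j + 1 := by omega
    exacts [⟨7, rfl⟩, ⟨0, rfl⟩, ⟨1, rfl⟩]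

/-- Towards neighbors the signs are those of the image. -/
theorem signAround_of_mem_nbr {p : Pt} (hp : p ∈ grid n m) (k : ZMod 8)
    (h : around p k ∈ nbr n m I p) : signAround n m I p k = true ↔ I p < I (around p k) := by
  obtain ⟨i, j⟩ := p
  obtain ⟨i0, i1, j0, j1⟩ := id hp
  simp only at i0 i1 j0 j1
  have diag : ∀ {c q : Pt} {b : Bool}, q ∈ nbr n m I (i, j) → IsDiagonal (i, j) q →
      c = (min i q.1, min j q.2) → PixelIn n m c →
      (diagSign n m I (i, j) c q b = true ↔ I (i, j) < I q) := by
    rintro c q b hq hd rfl hc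
    unfold diagSign
    rw [if_pos ⟨hc, fun hs => hq.2 ⟨hd, hs⟩⟩, decide_eq_true_iff]
  revert k
  refine forall_zmod_eight ?_ ?_ ?_ ?_ ?_ ?_ ?_ ?_ <;> intro h
  · exact axisSign_of_mem h.1.1
  · obtain ⟨k1, k2, k3, k4⟩ : ((i + 1, j + 1) : Pt) ∈ grid n m := h.1.1
    exact diag h ⟨by simp, by simp⟩ (by simp) ⟨i0, k2, j0, k4⟩
  · exact axisSign_of_mem h.1.1
  · obtain ⟨k1, k2, k3, k4⟩ : ((i - 1, j + 1) : Pt) ∈ grid n m := h.1.1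
    exact diag h ⟨by simp; omega, by simp⟩ (by simp)
      ⟨k1, by simpa using i1, j0, k4⟩
  · exact axisSign_of_mem h.1.1
  · obtain ⟨k1, k2, k3, k4⟩ : ((i - 1, j - 1) : Pt) ∈ grid n m := h.1.1
    exact diag h ⟨by simp; omega, by simp; omega⟩ (by simp)
      ⟨k1, by simpa using i1, k3, by simpa using j1⟩
  · exact axisSign_of_mem h.1.1
  · obtain ⟨k1, k2, k3, k4⟩ : ((i + 1, j - 1) : Pt) ∈ grid n m := h.1.1
    exact diag h ⟨by simp, by simp; omega⟩ (by simp)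
      ⟨i0, k2, k3, by simpa using j1⟩

theorem isWall_of_joined {p : Pt} {k : ZMod 8} (h : J p (around p k)) : IsWall n m J p k :=
  fun h' => h'.2.2 h

/-- A direction along an axis that is not a wall leads to a neighbor. -/
theorem around_mem_nbr_of_not_wall {p : Pt} (a : ZMod 8) (h : ¬ IsWall n m J p (2 * a)) :
    around p (2 * a) ∈ nbr n m I p := by
  obtain ⟨i, j⟩ := p
  rw [IsWall, not_not] at h
  have n0 : PixelIn n m (i, j) → ((i + 1, j) : Pt) ∈ nbr n m I (i, j) := fun h =>
    mem_nbr_of_axis h.corners.2.1 (by simp) (by simp) (by simp) (by simp)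
  have n2 : PixelIn n m (i, j) → ((i, j + 1) : Pt) ∈ nbr n m I (i, j) := fun h =>
    mem_nbr_of_axis h.corners.2.2.1 (by simp) (by simp) (by simp) (by simp)
  have n4 : PixelIn n m (i - 1, j) → ((i - 1, j) : Pt) ∈ nbr n m I (i, j) := fun h =>
    mem_nbr_of_axis h.corners.1 (by simp) (by simp) (by simp) (by simp)
  have n6 : PixelIn n m (i, j - 1) → ((i, j - 1) : Pt) ∈ nbr n m I (i, j) := fun h =>
    mem_nbr_of_axis h.corners.1 (by simp) (by simp) (by simp) (by simp)
  revert a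
  exact forall_zmod_eight (fun h => n0 h.2.1) (fun h => n2 h.1) (fun h => n4 h.1)
    (fun h => n6 h.2.1) (fun h => n0 h.2.1) (fun h => n2 h.1) (fun h => n4 h.1)
    (fun h => n6 h.2.1)

/-- Collects what the image and the graph give at a node. The field `exists_wall` is where edges to
greater and to smaller nodes enter: a neighbor along a non-wall axis guarantees an edge of the same
sign. -/
theorem nodeFan {C : Set (ℝ × ℝ)} (hn : 2 ≤ n) (hm : 2 ≤ m) (hI : InjOn I (grid n m))
    (hJ : IsWellJoined n m I J) (hC : IsComponent n m J C) {p : Pt} (hp : p ∈ grid n m) :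
    NodeFan (signAround n m I p) (IsWall n m J p)
      (fun k => sectorCell J p k ∈ regionCells n m J C) where
  region k hk := region_iff hJ hC p k hk
  diag a h := signAround_diag hI hp a h
  mix h a := signAround_mix hn hm hI hJ hp h a
  exists_wall a h := by
    have hq := around_mem_nbr_of_not_wall (I := I) a h
    have hs := signAround_of_mem_nbr hp _ hq
    by_cases hlt : I p < I (around p (2 * a))
    · obtain ⟨y, hy, hlt'⟩ := hJ.up hp hq hlt
      have hy' := hJ.mem_nbr hy
      obtain ⟨k, rfl⟩ := exists_around hy'.1
      refine ⟨k, isWall_of_joined hy, ?_⟩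
      rw [hs.mpr hlt]
      exact (signAround_of_mem_nbr hp _ hy').mpr hlt'
    · have hlt2 := lt_of_le_of_ne (not_lt.mp hlt) fun e => hq.1.2.1 (hI hq.1.1 hp e)
      obtain ⟨y, hy, hlt'⟩ := hJ.down hp hq hlt2
      have hy' := hJ.mem_nbr hy
      obtain ⟨k, rfl⟩ := exists_around hy'.1
      refine ⟨k, isWall_of_joined hy, ?_⟩
      have t1 := hs.not.mpr hlt
      have t2 := (signAround_of_mem_nbr hp _ hy').not.mpr (not_lt.mpr hlt'.le)
      rw [Bool.not_eq_true] at t1 t2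
      rw [t1, t2]

variable {C : Set (ℝ × ℝ)}

/-! ### Walls and the perimeter -/

/-- A horizontal wall is either an edge, which the region misses, or has a pixel on one side only
and lies on the border of the domain. Both make it part of the frontier of a region that has a cell
along it. -/
theorem segment_right_subset_frontier (hC : IsComponent n m J C) {i j : ℤ}
    (hS : ((i, j), false) ∈ regionCells n m J C ∨ ((i, j - 1), true) ∈ regionCells n m J C)
    (hw : ¬ (PixelIn n m (i, j) ∧ PixelIn n m (i, j - 1) ∧ ¬ J (i, j) (i + 1, j))) :
    ((i, j) ∈ grid n m ∧ (i + 1, j) ∈ grid n m) ∧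
      segment ℝ (toPlane (i, j)) (toPlane (i + 1, j)) ⊆ frontier C := by
  have hor : segment ℝ (toPlane (i, j)) (toPlane (i + 1, j)) ⊆ graphLines n m J ∨
      ¬ (PixelIn n m (i, j) ∧ PixelIn n m (i, j - 1)) := by
    by_cases hj : J (i, j) (i + 1, j)
    · exact Or.inl fun x hx => Or.inr ⟨_, _, hj, hx⟩
    · exact Or.inr fun h => hw ⟨h.1, h.2, hj⟩
  rcases hS with hS | hS
  · refine ⟨⟨hS.1.corners.1, hS.1.corners.2.1⟩, subset_frontier hC hS ?_ (hor.imp_right ?_)⟩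
    · intro x hx
      obtain ⟨h1, h2, h3⟩ := mem_segment_right.mp hx
      exact bottom_mem_closedCell h2 h3 h1
    · intro hno
      rw [disjoint_left]
      rintro x hx hint
      obtain ⟨h1, h2, h3⟩ := mem_segment_right.mp hx
      rw [interior_domain] at hint
      obtain ⟨k1, k2, k3, k4⟩ := hS.1
      simp only at k1 k2 k3 k4
      have : j ≤ 0 := by
        by_contra hcon
        exact hno ⟨hS.1, k1, k2, by simp only; omega, by simp only; omega⟩
      have h0 : (j : ℝ) ≤ 0 := by exact_mod_cast this
      have := hint.2.1
      linarith
  · obtain ⟨k1, k2, k3, k4⟩ := hS.1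
    simp only at k1 k2 k3 k4
    refine ⟨⟨by simpa using hS.1.corners.2.2.1, by simpa using hS.1.corners.2.2.2⟩,
      subset_frontier hC hS ?_ (hor.imp_right ?_)⟩
    · intro x hx
      obtain ⟨h1, h2, h3⟩ := mem_segment_right.mp hx
      exact top_mem_closedCell h2 h3 (by push_cast; linarith)
    · intro hno
      rw [disjoint_left]
      rintro x hx hint
      obtain ⟨h1, h2, h3⟩ := mem_segment_right.mp hx
      rw [interior_domain] at hint
      have : (m : ℤ) ≤ j + 1 := by
        by_contra hcon
        exact hno ⟨⟨k1, k2, by simp only; omega, by simp only; omega⟩, hS.1⟩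
      have h0 : (m : ℝ) ≤ j + 1 := by exact_mod_cast this
      have := hint.2.2
      linarith

theorem segment_up_subset_frontier (hC : IsComponent n m J C) {i j : ℤ}
    (hS : ((i, j), !anti J (i, j)) ∈ regionCells n m J C ∨
      ((i - 1, j), anti J (i - 1, j)) ∈ regionCells n m J C)
    (hw : ¬ (PixelIn n m (i, j) ∧ PixelIn n m (i - 1, j) ∧ ¬ J (i, j) (i, j + 1))) :
    ((i, j) ∈ grid n m ∧ (i, j + 1) ∈ grid n m) ∧
      segment ℝ (toPlane (i, j)) (toPlane (i, j + 1)) ⊆ frontier C := by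
  have hor : segment ℝ (toPlane (i, j)) (toPlane (i, j + 1)) ⊆ graphLines n m J ∨
      ¬ (PixelIn n m (i, j) ∧ PixelIn n m (i - 1, j)) := by
    by_cases hj : J (i, j) (i, j + 1)
    · exact Or.inl fun x hx => Or.inr ⟨_, _, hj, hx⟩
    · exact Or.inr fun h => hw ⟨h.1, h.2, hj⟩
  rcases hS with hS | hS
  · refine ⟨⟨hS.1.corners.1, hS.1.corners.2.2.1⟩, subset_frontier hC hS ?_ (hor.imp_right ?_)⟩
    · intro x hx
      obtain ⟨h1, h2, h3⟩ := mem_segment_up.mp hx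
      exact left_mem_closedCell h2 h3 h1
    · intro hno
      rw [disjoint_left]
      rintro x hx hint
      obtain ⟨h1, h2, h3⟩ := mem_segment_up.mp hx
      rw [interior_domain] at hint
      obtain ⟨k1, k2, k3, k4⟩ := hS.1
      simp only at k1 k2 k3 k4
      have : i ≤ 0 := by
        by_contra hcon
        exact hno ⟨hS.1, by simp only; omega, by simp only; omega, k3, k4⟩
      have h0 : (i : ℝ) ≤ 0 := by exact_mod_cast this
      have := hint.1.1
      linarith
  · obtain ⟨k1, k2, k3, k4⟩ := hS.1
    simp only at k1 k2 k3 k4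
    refine ⟨⟨by simpa using hS.1.corners.2.1, by simpa using hS.1.corners.2.2.2⟩,
      subset_frontier hC hS ?_ (hor.imp_right ?_)⟩
    · intro x hx
      obtain ⟨h1, h2, h3⟩ := mem_segment_up.mp hx
      exact right_mem_closedCell h2 h3 (by push_cast; linarith)
    · intro hno
      rw [disjoint_left]
      rintro x hx hint
      obtain ⟨h1, h2, h3⟩ := mem_segment_up.mp hx
      rw [interior_domain] at hint
      have : (n : ℤ) ≤ i + 1 := by
        by_contra hcon
        exact hno ⟨⟨by simp only; omega, by simp only; omega, k3, k4⟩, hS.1⟩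
      have h0 : (n : ℝ) ≤ i + 1 := by exact_mod_cast this
      have := hint.1.2
      linarith

theorem segment_main_subset_frontier (hJ : IsWellJoined n m I J) (hC : IsComponent n m J C)
    {i j : ℤ} {b : Bool} (hS : ((i, j), b) ∈ regionCells n m J C) (hj : J (i, j) (i + 1, j + 1)) :
    segment ℝ (toPlane (i, j)) (toPlane (i + 1, j + 1)) ⊆ frontier C := by
  refine subset_frontier hC hS ?_ (Or.inl fun x hx => Or.inr ⟨_, _, hj, hx⟩)
  intro x hx
  obtain ⟨h1, h2, h3⟩ := mem_segment_main.mp hx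
  refine ⟨h2, h3, by simp only; linarith, by simp only; linarith, ?_⟩
  simp only
  rw [anti_eq_false (p := (i, j)).mpr (hJ.not_cross hj)]
  cases b <;> simp only [cellSide] <;> linarith

theorem segment_anti_subset_frontier (hC : IsComponent n m J C)
    {i j : ℤ} {b : Bool} (hS : ((i, j), b) ∈ regionCells n m J C) (hj : J (i + 1, j) (i, j + 1)) :
    segment ℝ (toPlane (i + 1, j)) (toPlane (i, j + 1)) ⊆ frontier C := by
  refine subset_frontier hC hS ?_ (Or.inl fun x hx => Or.inr ⟨_, _, hj, hx⟩)
  intro x hx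
  obtain ⟨h1, h2, h3⟩ := mem_segment_anti.mp hx
  refine ⟨h2, h3, by simp only; linarith, by simp only; linarith, ?_⟩
  simp only
  rw [anti_eq_true (p := (i, j)).mpr hj]
  cases b <;> simp only [cellSide] <;> linarith

/-- The walls of a region at a node belong to its perimeter. -/
theorem wall_subset_frontier (hJ : IsWellJoined n m I J) (hC : IsComponent n m J C) (p : Pt)
    (k : ZMod 8) (hw : IsWall n m J p k)
    (hS : sectorCell J p k ∈ regionCells n m J C ∨
      sectorCell J p (k - 1) ∈ regionCells n m J C) :
    around p k ∈ nbr n m I p ∧ segment ℝ (toPlane p) (toPlane (around p k)) ⊆ frontier C := by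
  obtain ⟨i, j⟩ := p
  have main : ∀ {k l : ℤ} {b b' : Bool},
      (((k, l), b) ∈ regionCells n m J C ∨ ((k, l), b') ∈ regionCells n m J C) →
      J (k, l) (k + 1, l + 1) →
      segment ℝ (toPlane (k, l)) (toPlane (k + 1, l + 1)) ⊆ frontier C := fun hS hj =>
    hS.elim (fun h => segment_main_subset_frontier hJ hC h hj)
      (fun h => segment_main_subset_frontier hJ hC h hj)
  have anti : ∀ {k l : ℤ} {b b' : Bool},
      (((k, l), b) ∈ regionCells n m J C ∨ ((k, l), b') ∈ regionCells n m J C) →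
      J (k + 1, l) (k, l + 1) →
      segment ℝ (toPlane (k + 1, l)) (toPlane (k, l + 1)) ⊆ frontier C := fun hS hj =>
    hS.elim (fun h => segment_anti_subset_frontier hC h hj)
      (fun h => segment_anti_subset_frontier hC h hj)
  have joined : ∀ {c : Pt} {b b' : Bool} {q : Pt},
      ((c, b) ∈ regionCells n m J C ∨ (c, b') ∈ regionCells n m J C) →
      ¬ (PixelIn n m c ∧ PixelIn n m c ∧ ¬ J (i, j) q) → J (i, j) q := by
    intro c b b' q hS hw
    by_contra hj
    exact hw ⟨hS.elim (fun h => h.1) (fun h => h.1), hS.elim (fun h => h.1) (fun h => h.1), hj⟩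
  revert k
  refine forall_zmod_eight ?_ ?_ ?_ ?_ ?_ ?_ ?_ ?_ <;> intro hw hS
  · change (i + 1, j) ∈ nbr n m I (i, j) ∧
      segment ℝ (toPlane (i, j)) (toPlane (i + 1, j)) ⊆ frontier C
    obtain ⟨hg, hs⟩ := segment_right_subset_frontier hC (i := i) (j := j) hS
      (fun h => hw ⟨h.2.1, h.1, h.2.2⟩)
    exact ⟨mem_nbr_of_axis hg.2 (by simp) (by simp) (by simp) (by simp), hs⟩
  · change (i + 1, j + 1) ∈ nbr n m I (i, j) ∧
      segment ℝ (toPlane (i, j)) (toPlane (i + 1, j + 1)) ⊆ frontier C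
    have hj : J (i, j) (i + 1, j + 1) := joined hS hw
    exact ⟨hJ.mem_nbr hj, main hS hj⟩
  · change (i, j + 1) ∈ nbr n m I (i, j) ∧
      segment ℝ (toPlane (i, j)) (toPlane (i, j + 1)) ⊆ frontier C
    obtain ⟨hg, hs⟩ := segment_up_subset_frontier hC (i := i) (j := j) hS.symm
      (fun h => hw ⟨h.1, h.2.1, h.2.2⟩)
    exact ⟨mem_nbr_of_axis hg.2 (by simp) (by simp) (by simp) (by simp), hs⟩
  · change (i - 1, j + 1) ∈ nbr n m I (i, j) ∧
      segment ℝ (toPlane (i, j)) (toPlane (i - 1, j + 1)) ⊆ frontier C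
    have hj : J (i, j) (i - 1, j + 1) := joined hS hw
    refine ⟨hJ.mem_nbr hj, ?_⟩
    have := anti hS (by simpa using hj)
    simpa using this
  · change (i - 1, j) ∈ nbr n m I (i, j) ∧
      segment ℝ (toPlane (i, j)) (toPlane (i - 1, j)) ⊆ frontier C
    obtain ⟨hg, hs⟩ := segment_right_subset_frontier hC (i := i - 1) (j := j) hS.symm
      (fun h => hw ⟨h.1, h.2.1, fun hj => h.2.2 (by rw [sub_add_cancel]; exact hJ.symm hj)⟩)
    refine ⟨mem_nbr_of_axis hg.1 (by simp) (by simp) (by simp) (by simp), ?_⟩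
    rw [segment_symm]
    simpa using hs
  · change (i - 1, j - 1) ∈ nbr n m I (i, j) ∧
      segment ℝ (toPlane (i, j)) (toPlane (i - 1, j - 1)) ⊆ frontier C
    have hj : J (i, j) (i - 1, j - 1) := joined hS hw
    refine ⟨hJ.mem_nbr hj, ?_⟩
    have := main hS (by simpa using hJ.symm hj)
    rw [segment_symm]
    simpa using this
  · change (i, j - 1) ∈ nbr n m I (i, j) ∧
      segment ℝ (toPlane (i, j)) (toPlane (i, j - 1)) ⊆ frontier C
    obtain ⟨hg, hs⟩ := segment_up_subset_frontier hC (i := i) (j := j - 1) hS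
      (fun h => hw ⟨h.2.1, h.1, fun hj => h.2.2 (by rw [sub_add_cancel]; exact hJ.symm hj)⟩)
    refine ⟨mem_nbr_of_axis hg.1 (by simp) (by simp) (by simp) (by simp), ?_⟩
    rw [segment_symm]
    simpa using hs
  · change (i + 1, j - 1) ∈ nbr n m I (i, j) ∧
      segment ℝ (toPlane (i, j)) (toPlane (i + 1, j - 1)) ⊆ frontier C
    have hj : J (i, j) (i + 1, j - 1) := joined hS hw
    refine ⟨hJ.mem_nbr hj, ?_⟩
    have := anti hS (by simpa using hJ.symm hj)
    rw [segment_symm]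
    simpa using this

/-- A node on a closed cell is a corner of it. -/
theorem exists_sectorCell {p : Pt} {c : Cell} (h : toPlane p ∈ closedCell J c) :
    ∃ k, c = sectorCell J p k := by
  obtain ⟨⟨i, j⟩, b⟩ := c
  obtain ⟨k, l⟩ := p
  obtain ⟨h1, h2, h3, h4, h5⟩ := h
  simp only [toPlane] at h1 h2 h3 h4 h5
  have a1 : i ≤ k := by exact_mod_cast h1
  have a2 : k ≤ i + 1 := by exact_mod_cast h2
  have a3 : j ≤ l := by exact_mod_cast h3
  have a4 : l ≤ j + 1 := by exact_mod_cast h4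
  have cases : ∀ {d : Pt} {x y : Bool} {s t : ZMod 8}, sectorCell J (k, l) s = (d, x) →
      sectorCell J (k, l) t = (d, y) → (b = x ∨ b = y) → ∃ k', (d, b) = sectorCell J (k, l) k' := by
    rintro d x y s t hs ht (rfl | rfl)
    exacts [⟨s, hs.symm⟩, ⟨t, ht.symm⟩]
  obtain rfl | rfl : i = k ∨ i = k - 1 := by omega
  · obtain rfl | rfl : j = l ∨ j = l - 1 := by omega
    · refine cases (s := 0) (t := 1) rfl rfl ?_
      cases ha : anti J (i, j) <;> cases b <;> simp [ha, cellSide] at h5 ⊢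
      linarith
    · refine cases (s := 6) (t := 7) rfl rfl ?_
      cases ha : anti J (i, l - 1) <;> cases b <;> simp [ha, cellSide] at h5 ⊢
      linarith
  · obtain rfl | rfl : j = l ∨ j = l - 1 := by omega
    · refine cases (s := 2) (t := 3) rfl rfl ?_
      cases ha : anti J (k - 1, j) <;> cases b <;> simp [ha, cellSide] at h5 ⊢
      linarith
    · refine cases (s := 4) (t := 5) rfl rfl ?_
      cases ha : anti J (k - 1, l - 1) <;> cases b <;> simp [ha, cellSide] at h5 ⊢
      linarith

/-! ### Connectedness and the number of glued pairs -/

/-- Reachability from a fixed cell is a property invariant under gluing, so it holds for all cells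
of the region. -/
theorem IsComponent.glued_graph_connected (hn : 2 ≤ n) (hm : 2 ≤ m) (hJ : IsWellJoined n m I J)
    (hC : IsComponent n m J C) :
    (SimpleGraph.fromRel fun x y : regionCells n m J C => Glued n m J x y).Connected := by
  have hne := hC.regionCells_nonempty hJ hn hm
  have : Nonempty (regionCells n m J C) := hne.to_subtype
  refine SimpleGraph.Connected.mk fun x y => ?_
  set H := SimpleGraph.fromRel fun x y : regionCells n m J C => Glued n m J x y
  have step : ∀ {c c'} (h : c ∈ regionCells n m J C) (h' : c' ∈ regionCells n m J C),
      Glued n m J c c' → H.Reachable ⟨c, h⟩ ⟨c', h'⟩ := by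
    intro c c' h h' hg
    by_cases e : c = c'
    · subst e
      rfl
    · refine SimpleGraph.Adj.reachable ?_
      rw [SimpleGraph.fromRel_adj]
      exact ⟨fun h => e (congrArg Subtype.val h), Or.inl hg⟩
  obtain ⟨h, hr⟩ := hC.glued_connected hn hm
    (P := fun c => ∃ h : c ∈ regionCells n m J C, H.Reachable x ⟨c, h⟩)
    (fun {c c'} hg => ⟨fun ⟨h, hr⟩ => ⟨(hC.glued_iff hJ hg).mp h, hr.trans (step _ _ hg)⟩,
      fun ⟨h, hr⟩ => ⟨(hC.glued_iff hJ hg).mpr h, hr.trans (step _ _ hg).symm⟩⟩)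
    x.2 y.2 ⟨x.2, SimpleGraph.Reachable.refl _⟩
  exact hr

/-- This is the inequality between vertices and edges of a connected graph. Gluing of a cell of the
region stays in the region, and the ordered glued pairs map onto the edges. -/
theorem IsComponent.card_cells_le (hn : 2 ≤ n) (hm : 2 ≤ m) (hJ : IsWellJoined n m I J)
    (hC : IsComponent n m J C) :
    (regionCells n m J C).ncard ≤
      {e : Cell × Cell | e.1 ∈ regionCells n m J C ∧ Glued n m J e.1 e.2}.ncard + 1 := by
  have hfin : Finite (regionCells n m J C) := (finite_regionCells C).to_subtype
  have h := (hC.glued_graph_connected hn hm hJ).card_vert_le_card_edgeSet_add_one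
  refine h.trans (Nat.add_le_add_right ?_ 1)
  have hfin' : Finite {e : Cell × Cell | e.1 ∈ regionCells n m J C ∧ Glued n m J e.1 e.2} := by
    refine Set.Finite.to_subtype (Set.Finite.subset
      (s := regionCells n m J C ×ˢ regionCells n m J C)
      ((finite_regionCells C).prod (finite_regionCells C)) ?_)
    rintro ⟨c, c'⟩ ⟨h1, h2⟩
    exact ⟨h1, (hC.glued_iff hJ h2).mp h1⟩
  have hne : ∀ {c c'}, Glued n m J c c' → c ≠ c' := by
    intro c c' hg
    cases hg <;> simp; omega
  refine Nat.card_le_card_of_surjective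
    (fun e : {e : Cell × Cell | e.1 ∈ regionCells n m J C ∧ Glued n m J e.1 e.2} =>
      ⟨s(⟨e.1.1, e.2.1⟩, ⟨e.1.2, (hC.glued_iff hJ e.2.2).mp e.2.1⟩), ?_⟩) ?_
  · rw [SimpleGraph.mem_edgeSet, SimpleGraph.fromRel_adj]
    exact ⟨fun h => hne e.2.2 (congrArg Subtype.val h), Or.inl e.2.2⟩
  · rintro ⟨e, he⟩
    induction e using Sym2.ind with
    | _ x y =>
      rw [SimpleGraph.mem_edgeSet, SimpleGraph.fromRel_adj] at he
      rcases he.2 with hg | hg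
      · exact ⟨⟨(x.1, y.1), x.2, hg⟩, rfl⟩
      · exact ⟨⟨(y.1, x.1), y.2, hg⟩, Subtype.ext Sym2.eq_swap⟩

/-! ### Counting -/

/-- A box that contains the grid and its translates by one step. -/
noncomputable def box (n m : ℕ) : Finset Pt := Finset.Icc (-1) (n : ℤ) ×ˢ Finset.Icc (-1) (m : ℤ)

theorem grid_subset_box : grid n m ⊆ box n m := by
  rintro ⟨i, j⟩ ⟨h1, h2, h3, h4⟩
  simp only at h1 h2 h3 h4
  simp only [box, Finset.coe_product, Finset.coe_Icc, mem_prod, mem_Icc]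
  omega

/-- The box exceeds the grid by one step on every side, so a shift by one moves no nonzero term out
of it. This turns sums over nodes into sums over pixels. -/
theorem sum_box_shift {G : Pt → ℤ} (hG : ∀ p, G p ≠ 0 → p ∈ grid n m) {a b : ℤ} (ha : 0 ≤ a)
    (ha' : a ≤ 1) (hb : 0 ≤ b) (hb' : b ≤ 1) :
    ∑ p ∈ box n m, G p = ∑ p ∈ box n m, G (p.1 + a, p.2 + b) := by
  rw [← finsum_eq_sum_of_support_subset G fun p hp => grid_subset_box (hG p hp),
    ← finsum_eq_sum_of_support_subset (fun p : Pt => G (p.1 + a, p.2 + b)) fun p hp => ?_]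
  · exact (finsum_comp_equiv (f := G) ((Equiv.addRight a).prodCongr (Equiv.addRight b))).symm
  · obtain ⟨h1, h2, h3, h4⟩ := hG _ hp
    simp only at h1 h2 h3 h4
    simp only [box, Finset.coe_product, Finset.coe_Icc, mem_prod, mem_Icc]
    omega

theorem sectorCell_mem_grid {p : Pt} (k : ZMod 8) :
    PixelIn n m (sectorCell J p k).1 → p ∈ grid n m := by
  obtain ⟨i, j⟩ := p
  have key : ∀ {a b : ℤ}, PixelIn n m (a, b) → (a ≤ i ∧ i ≤ a + 1) → (b ≤ j ∧ j ≤ b + 1) →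
      ((i, j) : Pt) ∈ grid n m := by
    rintro a b ⟨h1, h2, h3, h4⟩ h5 h6
    simp only at h1 h2 h3 h4
    exact ⟨by simp only; omega, by simp only; omega, by simp only; omega, by simp only; omega⟩
  have e0 : i ≤ i ∧ i ≤ i + 1 := by omega
  have e1 : i - 1 ≤ i ∧ i ≤ i - 1 + 1 := by omega
  have f0 : j ≤ j ∧ j ≤ j + 1 := by omega
  have f1 : j - 1 ≤ j ∧ j ≤ j - 1 + 1 := by omega
  revert k
  exact forall_zmod_eight (fun h => key h e0 f0) (fun h => key h e0 f0) (fun h => key h e1 f0)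
    (fun h => key h e1 f0) (fun h => key h e1 f1) (fun h => key h e1 f1) (fun h => key h e0 f1)
    (fun h => key h e0 f1)

open Classical in
/-- The value `1` for a sector of the region without a change of the sign. -/
noncomputable def sectorWeight (n m : ℕ) (I : Pt → ℝ) (J : Pt → Pt → Prop) (C : Set (ℝ × ℝ))
    (k : ZMod 8) (p : Pt) : ℤ :=
  if sectorCell J p k ∈ regionCells n m J C ∧ signAround n m I p k = signAround n m I p (k + 1)
  then 1 else 0

open Classical in
/-- The value `1` for a sector of the region that does not start with a wall. -/
noncomputable def gluedWeight (n m : ℕ) (J : Pt → Pt → Prop) (C : Set (ℝ × ℝ))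
    (k : ZMod 8) (p : Pt) : ℤ :=
  if sectorCell J p k ∈ regionCells n m J C ∧ ¬ IsWall n m J p k then 1 else 0

open Classical in
-- Walls minus changes equals unchanged sectors minus sectors without a wall at their start, since
-- both pairs of counts add up to the sectors of the region. The second form can be rearranged by
-- pixels.
theorem card_sub_card_eq (p : Pt) :
    ((Finset.univ.filter fun k => sectorCell J p k ∈ regionCells n m J C ∧
      IsWall n m J p k).card : ℤ) -
    (Finset.univ.filter fun k => sectorCell J p k ∈ regionCells n m J C ∧
      signAround n m I p k ≠ signAround n m I p (k + 1)).card =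
    ∑ k, (sectorWeight n m I J C k p - gluedWeight n m J C k p) := by
  rw [Finset.card_filter, Finset.card_filter]
  push_cast
  rw [← Finset.sum_sub_distrib]
  refine Finset.sum_congr rfl fun k _ => ?_
  unfold sectorWeight gluedWeight
  by_cases h1 : sectorCell J p k ∈ regionCells n m J C <;> by_cases h2 : IsWall n m J p k <;>
    by_cases h3 : signAround n m I p k = signAround n m I p (k + 1) <;> simp [h1, h2, h3]

theorem sum_zmod_eight (f : ZMod 8 → ℤ) :
    ∑ k, f k = f 0 + f 1 + f 2 + f 3 + f 4 + f 5 + f 6 + f 7 :=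
  Fin.sum_univ_eight f

/-! ### Sign changes at the corners of one pixel. -/

/-- The numbers of the corners of the halves of a quadrangle where the sign does not change, for the
signs `x, y, z, w` along the sides and `u, v` along the diagonals of a quadrangle without saddle. -/
theorem triangle_signs : ∀ x y z w u v : Bool, (x = y → u = x) → (w = z → u = !w) →
    (y = z → v = y) → (x = w → v = !x) → ¬ (x = !y ∧ y = !z ∧ z = !w) →
    ((if x = u then (1 : ℤ) else 0) + (if y = v then 1 else 0) + (if v = !x then 1 else 0) +
      (if (!u) = !y then 1 else 0) = 3) ∧
    ((if u = !w then (1 : ℤ) else 0) + (if z = !u then 1 else 0) + (if w = !v then 1 else 0) +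
      (if (!v) = !z then 1 else 0) = 3) ∧
    ((if x = u then (1 : ℤ) else 0) + (if u = !w then 1 else 0) + (if v = !x then 1 else 0) +
      (if w = !v then 1 else 0) = 3) ∧
    ((if y = v then (1 : ℤ) else 0) + (if z = !u then 1 else 0) + (if (!u) = !y then 1 else 0) +
      (if (!v) = !z then 1 else 0) = 3) := by
  decide

theorem decide_lt_eq_not {a b : ℝ} (h : a ≠ b) : decide (b < a) = !decide (a < b) := by
  rcases h.lt_or_gt with h | h <;> simp [h, h.le]

theorem decide_lt_trans {a b c : ℝ} (hab : a ≠ b) (hbc : b ≠ c)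
    (h : decide (a < b) = decide (b < c)) : decide (a < c) = decide (a < b) := by
  rcases hab.lt_or_gt with h1 | h1 <;> rcases hbc.lt_or_gt with h2 | h2
  · simp [h1, h1.trans h2]
  · simp [h1, h2.not_gt] at h
  · simp [h2, h1.not_gt] at h
  · simp [h1.not_gt, (h2.trans h1).not_gt]

/-- The signs at the corners of a pixel that is not split. -/
theorem signAround_pixel {i j : ℤ} (hp : PixelIn n m (i, j)) (hs : ¬ IsSplitPixel n m I (i, j)) :
    (signAround n m I (i, j) 0 = decide (I (i, j) < I (i + 1, j)) ∧
      signAround n m I (i, j) 1 = decide (I (i, j) < I (i + 1, j + 1)) ∧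
      signAround n m I (i, j) 2 = decide (I (i, j) < I (i, j + 1))) ∧
    (signAround n m I (i + 1, j) 2 = decide (I (i + 1, j) < I (i + 1, j + 1)) ∧
      signAround n m I (i + 1, j) 3 = decide (I (i + 1, j) < I (i, j + 1)) ∧
      signAround n m I (i + 1, j) 4 = decide (I (i + 1, j) < I (i, j))) ∧
    (signAround n m I (i + 1, j + 1) 4 = decide (I (i + 1, j + 1) < I (i, j + 1)) ∧
      signAround n m I (i + 1, j + 1) 5 = decide (I (i + 1, j + 1) < I (i, j)) ∧
      signAround n m I (i + 1, j + 1) 6 = decide (I (i + 1, j + 1) < I (i + 1, j))) ∧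
    (signAround n m I (i, j + 1) 6 = decide (I (i, j + 1) < I (i, j)) ∧
      signAround n m I (i, j + 1) 7 = decide (I (i, j + 1) < I (i + 1, j)) ∧
      signAround n m I (i, j + 1) 0 = decide (I (i, j + 1) < I (i + 1, j + 1))) := by
  obtain ⟨ga, gb, gc, gd⟩ := hp.corners
  have axis : ∀ {p q q' r : Pt}, q = r → r ∈ grid n m →
      axisSign n m I p q q' = decide (I p < I r) := by
    rintro p q q' r rfl hq
    rw [Bool.eq_iff_iff, axisSign_of_mem hq, decide_eq_true_iff]
  have diag : ∀ {p c q r : Pt} {b : Bool}, c = (i, j) → q = r →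
      diagSign n m I p c q b = decide (I p < I r) := by
    rintro p c q r b rfl rfl
    unfold diagSign
    rw [if_pos ⟨hp, hs⟩]
  refine ⟨⟨axis rfl gb, diag rfl rfl, axis rfl gc⟩,
    ⟨axis rfl gd, diag (by simp) (by simp), axis (by simp) ga⟩,
    ⟨axis (by simp) gc, diag (by simp) (by simp), axis (by simp) gb⟩,
    ⟨axis (by simp) ga, diag (by simp) (by simp), axis rfl gd⟩⟩

open Classical in
/-- The value `1` for a cell of the region. -/
noncomputable def cellWeight (n m : ℕ) (J : Pt → Pt → Prop) (C : Set (ℝ × ℝ)) (c : Cell) : ℤ :=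
  if c ∈ regionCells n m J C then 1 else 0

open Classical in
/-- The value `1` for a pixel of the region whose cells are glued. -/
noncomputable def diagWeight (n m : ℕ) (J : Pt → Pt → Prop) (C : Set (ℝ × ℝ)) (p : Pt) : ℤ :=
  if (p, false) ∈ regionCells n m J C ∧ ¬ J p (p.1 + 1, p.2 + 1) ∧
    ¬ J (p.1 + 1, p.2) (p.1, p.2 + 1) then 1 else 0

theorem sectorWeight_eq (k : ZMod 8) (p : Pt) :
    sectorWeight n m I J C k p = cellWeight n m J C (sectorCell J p k) *
      if signAround n m I p k = signAround n m I p (k + 1) then 1 else 0 := by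
  unfold sectorWeight cellWeight
  by_cases h1 : sectorCell J p k ∈ regionCells n m J C <;> simp [h1]

/-- The signs are taken around the pixel, so a corner is a local extremum of the cycle exactly when
consecutive signs differ. -/
theorem alternating_of_signs {a b d c : ℝ} (hab : a ≠ b) (hbd : b ≠ d) (hdc : d ≠ c) (hac : a ≠ c)
    (h1 : decide (a < b) = !decide (b < d)) (h2 : decide (b < d) = !decide (d < c))
    (h3 : decide (d < c) = !decide (c < a)) : Alternating a b d c := by
  rw [← decide_lt_eq_not hbd, decide_eq_decide] at h1
  rw [← decide_lt_eq_not hdc, decide_eq_decide] at h2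
  rw [← decide_lt_eq_not hac.symm, decide_eq_decide] at h3
  rcases hab.lt_or_gt with h | h
  · have e1 := h1.mp h
    have e2 : d < c := lt_of_le_of_ne (not_lt.mp fun e => e1.not_gt (h2.mpr e)) hdc
    exact Or.inr ⟨h, h3.mp e2, e1, e2⟩
  · have e1 : b < d := lt_of_le_of_ne (not_lt.mp fun e => h.not_gt (h1.mpr e)) hbd
    have e2 := h2.mp e1
    exact Or.inl ⟨h, lt_of_le_of_ne (not_lt.mp fun e => e2.not_gt (h3.mpr e)) hac.symm, e1, e2⟩

/-- For a diagonal direction both adjacent sectors are in the same pixel, so it is a wall of the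
region only if it is an edge. -/
theorem gluedWeight_eq (k : ZMod 8) (p : Pt) (c : Pt) (b b' : Bool)
    (h : sectorCell J p k = (c, b)) (h' : sectorCell J p (k - 1) = (c, b')) :
    gluedWeight n m J C k p = cellWeight n m J C (c, b) *
      open Classical in if J p (around p k) then 0 else 1 := by
  unfold gluedWeight cellWeight IsWall
  rw [h, h']
  by_cases h1 : (c, b) ∈ regionCells n m J C
  · have := h1.1
    simp only at this
    by_cases hj : J p (around p k) <;> simp [h1, this, hj]
  · simp [h1]

/-- A half of a pixel occupies four sectors: one at each end of the dividing diagonal and two at its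
third corner. By `triangle_signs` three of them have no change. Subtracting the sector after the
undivided direction at the third corner leaves 2 per cell. If no diagonal is an edge, the two ends
of the dividing diagonal are subtracted as well, which is the term with `diagWeight`. -/
theorem pixel_count (hI : InjOn I (grid n m)) (hJ : IsWellJoined n m I J)
    (hC : IsComponent n m J C) {i j : ℤ}
    (hs : ∀ b, ((i, j), b) ∈ regionCells n m J C → ¬ IsSplitPixel n m I (i, j)) :
    sectorWeight n m I J C 0 (i, j) + sectorWeight n m I J C 1 (i, j) +
      sectorWeight n m I J C 2 (i + 1, j) + sectorWeight n m I J C 3 (i + 1, j) +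
      sectorWeight n m I J C 4 (i + 1, j + 1) + sectorWeight n m I J C 5 (i + 1, j + 1) +
      sectorWeight n m I J C 6 (i, j + 1) + sectorWeight n m I J C 7 (i, j + 1) -
      (gluedWeight n m J C 1 (i, j) + gluedWeight n m J C 3 (i + 1, j) +
        gluedWeight n m J C 5 (i + 1, j + 1) + gluedWeight n m J C 7 (i, j + 1)) =
    2 * (cellWeight n m J C ((i, j), false) + cellWeight n m J C ((i, j), true)) -
      2 * diagWeight n m J C (i, j) := by
  have c0 : sectorCell J (i, j) 0 = ((i, j), false) := rfl
  have c1 : sectorCell J (i, j) 1 = ((i, j), !anti J (i, j)) := rfl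
  have c2 : sectorCell J (i + 1, j) 2 = ((i, j), anti J (i, j)) := by
    change ((i + 1 - 1, j), anti J (i + 1 - 1, j)) = _
    rw [add_sub_cancel_right]
  have c3 : sectorCell J (i + 1, j) 3 = ((i, j), false) := by
    change ((i + 1 - 1, j), false) = _
    rw [add_sub_cancel_right]
  have c4 : sectorCell J (i + 1, j + 1) 4 = ((i, j), true) := by
    change ((i + 1 - 1, j + 1 - 1), true) = _
    rw [add_sub_cancel_right, add_sub_cancel_right]
  have c5 : sectorCell J (i + 1, j + 1) 5 = ((i, j), anti J (i, j)) := by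
    change ((i + 1 - 1, j + 1 - 1), anti J (i + 1 - 1, j + 1 - 1)) = _
    rw [add_sub_cancel_right, add_sub_cancel_right]
  have c6 : sectorCell J (i, j + 1) 6 = ((i, j), !anti J (i, j)) := by
    change ((i, j + 1 - 1), !anti J (i, j + 1 - 1)) = _
    rw [add_sub_cancel_right]
  have c7 : sectorCell J (i, j + 1) 7 = ((i, j), true) := by
    change ((i, j + 1 - 1), true) = _
    rw [add_sub_cancel_right]
  have a1 : around (i, j) 1 = (i + 1, j + 1) := rfl
  have a3 : around (i + 1, j) 3 = (i, j + 1) := by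
    change (i + 1 - 1, j + 1) = _
    rw [add_sub_cancel_right]
  have a5 : around (i + 1, j + 1) 5 = (i, j) := by
    change (i + 1 - 1, j + 1 - 1) = _
    rw [add_sub_cancel_right, add_sub_cancel_right]
  have a7 : around (i, j + 1) 7 = (i + 1, j) := by
    change (i + 1, j + 1 - 1) = _
    rw [add_sub_cancel_right]
  rw [gluedWeight_eq 1 (i, j) (i, j) _ _ c1 c0,
    gluedWeight_eq 3 (i + 1, j) (i, j) _ _ c3 c2,
    gluedWeight_eq 5 (i + 1, j + 1) (i, j) _ _ c5 c4,
    gluedWeight_eq 7 (i, j + 1) (i, j) _ _ c7 c6, a1, a3, a5, a7]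
  simp only [sectorWeight_eq]
  rw [c0, c1, c2, c3, c4, c5, c6, c7]
  by_cases hno : ∀ b, ((i, j), b) ∉ regionCells n m J C
  · have : ∀ b, cellWeight n m J C ((i, j), b) = 0 := fun b => if_neg (hno b)
    simp [this, diagWeight, hno]
  push Not at hno
  obtain ⟨b, hb⟩ := hno
  have hp : PixelIn n m (i, j) := hb.1
  have hs := hs b hb
  obtain ⟨ga, gb, gc, gd⟩ := hp.corners
  have nab : I (i, j) ≠ I (i + 1, j) := fun e => by simpa using hI ga gb e
  have nad : I (i, j) ≠ I (i + 1, j + 1) := fun e => by simpa using hI ga gd e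
  have nac : I (i, j) ≠ I (i, j + 1) := fun e => by simpa using hI ga gc e
  have nbd : I (i + 1, j) ≠ I (i + 1, j + 1) := fun e => by simpa using hI gb gd e
  have nbc : I (i + 1, j) ≠ I (i, j + 1) := fun e => by simpa using hI gb gc e
  have ndc : I (i + 1, j + 1) ≠ I (i, j + 1) := fun e => by simpa using hI gd gc e
  obtain ⟨⟨s0, s1, s2⟩, ⟨s3, s4, s5⟩, ⟨s6, s7, s8⟩, ⟨s9, s10, s11⟩⟩ := signAround_pixel hp hs
  have halt := not_alternating_of_not_split hp hs
  -- The first four signs run around the pixel counterclockwise from the lower left corner, the last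
  -- two along its diagonals. The last hypothesis is that the pixel is not split.
  have t1 := triangle_signs (decide (I (i, j) < I (i + 1, j)))
    (decide (I (i + 1, j) < I (i + 1, j + 1))) (decide (I (i + 1, j + 1) < I (i, j + 1)))
    (decide (I (i, j + 1) < I (i, j))) (decide (I (i, j) < I (i + 1, j + 1)))
    (decide (I (i + 1, j) < I (i, j + 1))) (decide_lt_trans nab nbd)
    (fun h => by
      rw [← decide_lt_eq_not nac.symm]
      have := decide_lt_trans nac ndc.symm
      rw [decide_lt_eq_not nac.symm, decide_lt_eq_not ndc] at this
      rw [decide_lt_eq_not nac.symm]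
      exact this (by rw [h]))
    (decide_lt_trans nbd ndc)
    (fun h => by
      have := decide_lt_trans nab.symm nac
      rw [decide_lt_eq_not nac.symm, decide_lt_eq_not nab] at this
      exact this (by rw [h]))
    (by
      rintro ⟨h1, h2, h3⟩
      exact halt (alternating_of_signs nab nbd ndc nac h1 h2 h3))
  rw [show (0 : ZMod 8) + 1 = 1 from rfl, show (1 : ZMod 8) + 1 = 2 from rfl,
    show (2 : ZMod 8) + 1 = 3 from rfl, show (3 : ZMod 8) + 1 = 4 from rfl,
    show (4 : ZMod 8) + 1 = 5 from rfl, show (5 : ZMod 8) + 1 = 6 from rfl,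
    show (6 : ZMod 8) + 1 = 7 from rfl, show (7 : ZMod 8) + 1 = 0 from rfl,
    s0, s1, s2, s3, s4, s5, s6, s7, s8, s9, s10, s11, decide_lt_eq_not nab,
    decide_lt_eq_not nad, decide_lt_eq_not nac.symm, decide_lt_eq_not nbd, decide_lt_eq_not nbc,
    decide_lt_eq_not ndc]
  revert t1
  generalize decide (I (i, j) < I (i + 1, j)) = x
  generalize decide (I (i + 1, j) < I (i + 1, j + 1)) = y
  generalize decide (I (i + 1, j + 1) < I (i, j + 1)) = z
  generalize decide (I (i, j + 1) < I (i, j)) = w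
  generalize decide (I (i, j) < I (i + 1, j + 1)) = u
  generalize decide (I (i + 1, j) < I (i, j + 1)) = v
  rintro ⟨t1, t2, t3, t4⟩
  have hsym : ∀ p q, J p q ↔ J q p := fun p q => ⟨fun h => hJ.symm h, fun h => hJ.symm h⟩
  rw [hsym (i + 1, j + 1) (i, j), hsym (i, j + 1) (i + 1, j)]
  -- The edge on a diagonal, if any, decides which sectors make up each cell and which of the four
  -- diagonal directions are walls.
  by_cases hmain : J (i, j) (i + 1, j + 1)
  · have hanti := hJ.not_cross hmain
    rw [anti_eq_false (p := (i, j)).mpr hanti]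
    have hd : diagWeight n m J C (i, j) = 0 := if_neg fun h => h.2.1 hmain
    rw [hd, if_pos hmain, if_neg hanti]
    simp only [Bool.not_false]
    linear_combination cellWeight n m J C ((i, j), false) * t1 +
      cellWeight n m J C ((i, j), true) * t2
  · by_cases hanti : J (i + 1, j) (i, j + 1)
    · rw [anti_eq_true (p := (i, j)).mpr hanti]
      have hd : diagWeight n m J C (i, j) = 0 := if_neg fun h => h.2.2 hanti
      rw [hd, if_neg hmain, if_pos hanti]
      simp only [Bool.not_true]
      linear_combination cellWeight n m J C ((i, j), false) * t3 +
        cellWeight n m J C ((i, j), true) * t4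
    · rw [anti_eq_false (p := (i, j)).mpr hanti]
      have hg := hC.glued_iff hJ (Glued.diag hp hmain hanti)
      have hd : diagWeight n m J C (i, j) = cellWeight n m J C ((i, j), false) := by
        by_cases hc : ((i, j), false) ∈ regionCells n m J C
        · exact (if_pos ⟨hc, hmain, hanti⟩).trans (if_pos hc).symm
        · exact (if_neg fun h => hc h.1).trans (if_neg hc).symm
      have hd' : cellWeight n m J C ((i, j), true) = cellWeight n m J C ((i, j), false) := by
        by_cases hc : ((i, j), false) ∈ regionCells n m J C
        · exact (if_pos (hg.mp hc)).trans (if_pos hc).symm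
        · exact (if_neg fun h => hc (hg.mpr h)).trans (if_neg hc).symm
      rw [hd, hd', if_neg hmain, if_neg hanti]
      simp only [Bool.not_false, hd']
      linear_combination cellWeight n m J C ((i, j), false) * (t1 + t2)

/-! ### Summation over the nodes and comparison with the glued pairs. -/

open Classical in
-- The glued horizontal side, seen from its right end, has the lower cell as the sector that follows
-- it. Gluing puts both cells into the region together, so the count from either end is the same.
theorem gluedWeight_four (hJ : IsWellJoined n m I J) (hC : IsComponent n m J C) (p : Pt) :
    gluedWeight n m J C 4 (p.1 + 1, p.2) = gluedWeight n m J C 0 p := by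
  obtain ⟨i, j⟩ := p
  unfold gluedWeight
  refine if_congr ?_ rfl rfl
  change ((i + 1 - 1, j - 1), true) ∈ _ ∧ ¬ ¬ (PixelIn n m (i + 1 - 1, j) ∧
      PixelIn n m (i + 1 - 1, j - 1) ∧ ¬ J (i + 1, j) (i + 1 - 1, j)) ↔
    ((i, j), false) ∈ _ ∧ ¬ ¬ (PixelIn n m (i, j - 1) ∧ PixelIn n m (i, j) ∧ ¬ J (i, j) (i + 1, j))
  rw [add_sub_cancel_right, not_not, not_not]
  constructor
  · rintro ⟨h, h1, h2, h3⟩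
    have h3' : ¬ J (i, j) (i + 1, j) := fun h => h3 (hJ.symm h)
    exact ⟨(hC.glued_iff hJ (Glued.bottom h1 h2 h3')).mpr h, h2, h1, h3'⟩
  · rintro ⟨h, h1, h2, h3⟩
    exact ⟨(hC.glued_iff hJ (Glued.bottom h2 h1 h3)).mp h, h2, h1, fun h => h3 (hJ.symm h)⟩

open Classical in
theorem gluedWeight_six (hJ : IsWellJoined n m I J) (hC : IsComponent n m J C) (p : Pt) :
    gluedWeight n m J C 6 (p.1, p.2 + 1) = gluedWeight n m J C 2 p := by
  obtain ⟨i, j⟩ := p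
  unfold gluedWeight
  refine if_congr ?_ rfl rfl
  change ((i, j + 1 - 1), !anti J (i, j + 1 - 1)) ∈ _ ∧ ¬ ¬ (PixelIn n m (i - 1, j + 1 - 1) ∧
      PixelIn n m (i, j + 1 - 1) ∧ ¬ J (i, j + 1) (i, j + 1 - 1)) ↔
    ((i - 1, j), anti J (i - 1, j)) ∈ _ ∧
      ¬ ¬ (PixelIn n m (i, j) ∧ PixelIn n m (i - 1, j) ∧ ¬ J (i, j) (i, j + 1))
  rw [add_sub_cancel_right, not_not, not_not]
  constructor
  · rintro ⟨h, h1, h2, h3⟩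
    have h3' : ¬ J (i, j) (i, j + 1) := fun h => h3 (hJ.symm h)
    exact ⟨(hC.glued_iff hJ (Glued.left h2 h1 h3')).mp h, h2, h1, h3'⟩
  · rintro ⟨h, h1, h2, h3⟩
    exact ⟨(hC.glued_iff hJ (Glued.left h1 h2 h3)).mpr h, h2, h1, fun h => h3 (hJ.symm h)⟩

theorem sectorWeight_support (k : ZMod 8) (p : Pt) (h : sectorWeight n m I J C k p ≠ 0) :
    p ∈ grid n m := by
  unfold sectorWeight at h
  split_ifs at h with hc
  · exact sectorCell_mem_grid k hc.1.1
  · exact absurd rfl h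

theorem gluedWeight_support (k : ZMod 8) (p : Pt) (h : gluedWeight n m J C k p ≠ 0) :
    p ∈ grid n m := by
  unfold gluedWeight at h
  split_ifs at h with hc
  · exact sectorCell_mem_grid k hc.1.1
  · exact absurd rfl h

/-- Shifting the summation collects the eight sectors of each pixel at its lower left corner, where
`pixel_count` applies. The horizontal and vertical directions remain, and each glued side is counted
from both ends, hence the factor 2. -/
theorem sum_weights (hI : InjOn I (grid n m)) (hJ : IsWellJoined n m I J)
    (hC : IsComponent n m J C)
    (hs : ∀ c ∈ regionCells n m J C, ¬ IsSplitPixel n m I c.1) :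
    ∑ p ∈ box n m, ∑ k, (sectorWeight n m I J C k p - gluedWeight n m J C k p) =
      2 * ∑ p ∈ box n m, (cellWeight n m J C (p, false) + cellWeight n m J C (p, true)) -
      2 * ∑ p ∈ box n m, (diagWeight n m J C p + gluedWeight n m J C 0 p +
        gluedWeight n m J C 2 p) := by
  have s10 : ∀ G : Pt → ℤ, (∀ p, G p ≠ 0 → p ∈ grid n m) →
      ∑ p ∈ box n m, G p = ∑ p ∈ box n m, G (p.1 + 1, p.2) := fun G hG => by
    simpa using sum_box_shift hG (a := 1) (b := 0) (by simp) (by simp) (by simp) (by simp)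
  have s01 : ∀ G : Pt → ℤ, (∀ p, G p ≠ 0 → p ∈ grid n m) →
      ∑ p ∈ box n m, G p = ∑ p ∈ box n m, G (p.1, p.2 + 1) := fun G hG => by
    simpa using sum_box_shift hG (a := 0) (b := 1) (by simp) (by simp) (by simp) (by simp)
  have s11 : ∀ G : Pt → ℤ, (∀ p, G p ≠ 0 → p ∈ grid n m) →
      ∑ p ∈ box n m, G p = ∑ p ∈ box n m, G (p.1 + 1, p.2 + 1) := fun G hG =>
    sum_box_shift hG (a := 1) (b := 1) (by simp) (by simp) (by simp) (by simp)
  have key := Finset.sum_congr (rfl : box n m = box n m) fun p _ =>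
    pixel_count hI hJ hC (i := p.1) (j := p.2) fun b hb => hs _ hb
  simp only [Finset.sum_sub_distrib, Finset.sum_add_distrib, ← Finset.mul_sum, Prod.mk.eta] at key
  rw [← s10 _ (sectorWeight_support 2), ← s10 _ (sectorWeight_support 3),
    ← s11 _ (sectorWeight_support 4), ← s11 _ (sectorWeight_support 5),
    ← s01 _ (sectorWeight_support 6), ← s01 _ (sectorWeight_support 7),
    ← s10 _ (gluedWeight_support 3), ← s11 _ (gluedWeight_support 5),
    ← s01 _ (gluedWeight_support 7)] at key
  have e4 := s10 _ (gluedWeight_support (n := n) (m := m) (J := J) (C := C) 4)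
  have e6 := s01 _ (gluedWeight_support (n := n) (m := m) (J := J) (C := C) 6)
  simp only [gluedWeight_four hJ hC, gluedWeight_six hJ hC] at e4 e6
  simp only [sum_zmod_eight, Finset.sum_sub_distrib, Finset.sum_add_distrib]
  linarith

open Classical in
theorem sum_cellWeight_le : ∑ p ∈ box n m, (cellWeight n m J C (p, false) +
    cellWeight n m J C (p, true)) ≤ (regionCells n m J C).ncard := by
  have : ∀ p : Pt, cellWeight n m J C (p, false) + cellWeight n m J C (p, true) =
      ∑ b : Bool, cellWeight n m J C (p, b) := fun p => by
    rw [Fintype.sum_bool, add_comm]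
  simp only [this]
  rw [← Finset.sum_product (box n m) Finset.univ fun c : Cell => cellWeight n m J C c]
  unfold cellWeight
  rw [Finset.sum_boole, ← ncard_coe_finset]
  exact_mod_cast ncard_le_ncard (fun c hc => (Finset.mem_filter.mp hc).2) (finite_regionCells C)

open Classical in
-- Each kind of glued pair is determined by a lower left corner: `f` for halves of one pixel, `g`
-- for horizontal sides, `h` for vertical sides.
theorem ncard_glued_le (hJ : IsWellJoined n m I J) (hC : IsComponent n m J C) :
    ({e : Cell × Cell | e.1 ∈ regionCells n m J C ∧ Glued n m J e.1 e.2}.ncard : ℤ) ≤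
      ∑ p ∈ box n m, (diagWeight n m J C p + gluedWeight n m J C 0 p +
        gluedWeight n m J C 2 p) := by
  unfold diagWeight gluedWeight
  rw [Finset.sum_add_distrib, Finset.sum_add_distrib, Finset.sum_boole, Finset.sum_boole,
    Finset.sum_boole]
  set D := {p ∈ box n m | (p, false) ∈ regionCells n m J C ∧ ¬ J p (p.1 + 1, p.2 + 1) ∧
    ¬ J (p.1 + 1, p.2) (p.1, p.2 + 1)}
  set A := {p ∈ box n m | sectorCell J p 0 ∈ regionCells n m J C ∧ ¬ IsWall n m J p 0}
  set B := {p ∈ box n m | sectorCell J p 2 ∈ regionCells n m J C ∧ ¬ IsWall n m J p 2}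
  let f (p : Pt) : Cell × Cell := ((p, false), (p, true))
  let g (p : Pt) : Cell × Cell := ((p, false), ((p.1, p.2 - 1), true))
  let h (p : Pt) : Cell × Cell := ((p, !anti J p), ((p.1 - 1, p.2), anti J (p.1 - 1, p.2)))
  have hsub : {e : Cell × Cell | e.1 ∈ regionCells n m J C ∧ Glued n m J e.1 e.2} ⊆
      ((D.image f ∪ A.image g ∪ B.image h : Finset (Cell × Cell)) : Set (Cell × Cell)) := by
    rintro ⟨c, c'⟩ ⟨hc, hg⟩
    simp only at hc hg
    have hc' := (hC.glued_iff hJ hg).mp hc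
    rw [Finset.mem_coe, Finset.mem_union, Finset.mem_union]
    have hbox : ∀ {i j : ℤ}, PixelIn n m (i, j) → (i, j) ∈ box n m := fun h =>
      grid_subset_box h.corners.1
    cases hg with
    | @bottom i j h1 h2 h3 =>
      refine Or.inl (Or.inr (Finset.mem_image.mpr ⟨(i, j), Finset.mem_filter.mpr
        ⟨hbox h1, hc, not_not.mpr ⟨h2, h1, h3⟩⟩, rfl⟩))
    | @left i j h1 h2 h3 =>
      refine Or.inr (Finset.mem_image.mpr ⟨(i, j), Finset.mem_filter.mpr
        -- Sector 2 is in the cell to the left of the side, the second of the pair, so its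
        -- membership in the region is the one required.
        ⟨hbox h1, hc', not_not.mpr ⟨h1, h2, h3⟩⟩, rfl⟩)
    | @diag i j h1 h2 h3 =>
      refine Or.inl (Or.inl (Finset.mem_image.mpr ⟨(i, j), Finset.mem_filter.mpr
        ⟨hbox h1, hc, h2, h3⟩, rfl⟩))
  have h1 := ncard_le_ncard hsub (Finset.finite_toSet _)
  rw [ncard_coe_finset] at h1
  have h2 := Finset.card_union_le (D.image f ∪ A.image g) (B.image h)
  have h3 := Finset.card_union_le (D.image f) (A.image g)
  have h4 := Finset.card_image_le (s := D) (f := f)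
  have h5 := Finset.card_image_le (s := A) (f := g)
  have h6 := Finset.card_image_le (s := B) (f := h)
  exact_mod_cast (by omega :
    {e : Cell × Cell | e.1 ∈ regionCells n m J C ∧ Glued n m J e.1 e.2}.ncard ≤
      D.card + A.card + B.card)

/-- Twice the number of cells minus twice the number of glued pairs, for a connected gluing graph.
-/
theorem sum_weights_le (hn : 2 ≤ n) (hm : 2 ≤ m) (hI : InjOn I (grid n m))
    (hJ : IsWellJoined n m I J) (hC : IsComponent n m J C)
    (hs : ∀ c ∈ regionCells n m J C, ¬ IsSplitPixel n m I c.1) :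
    ∑ p ∈ box n m, ∑ k, (sectorWeight n m I J C k p - gluedWeight n m J C k p) ≤ 2 := by
  rw [sum_weights hI hJ hC hs]
  have h1 := sum_cellWeight_le (n := n) (m := m) (J := J) (C := C)
  have h2 := ncard_glued_le hJ hC
  have h3 := hC.card_cells_le hn hm hJ
  zify at h3
  linarith

/-! ### Extrema of the perimeter -/

theorem perimeterAdj_of_isWall (hJ : IsWellJoined n m I J) (hC : IsComponent n m J C) {p : Pt}
    (hp : p ∈ grid n m) {k : ZMod 8} (hw : IsWall n m J p k)
    (hS : sectorCell J p k ∈ regionCells n m J C ∨ sectorCell J p (k - 1) ∈ regionCells n m J C) :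
    around p k ∈ nbr n m I p ∧ PerimeterAdj n m C p (around p k) := by
  obtain ⟨h1, h2⟩ := wall_subset_frontier hJ hC p k hw hS
  exact ⟨h1, hp, h1.1, h2⟩

theorem exists_sector_mem (hn : 2 ≤ n) (hm : 2 ≤ m) (hJ : IsWellJoined n m I J)
    (hC : IsComponent n m J C) {p : Pt} (hp : p ∈ perimeterNodes n m C) :
    ∃ k, sectorCell J p k ∈ regionCells n m J C := by
  obtain ⟨c, hc, hx⟩ := hC.exists_mem_of_mem_closure hJ hn hm (frontier_subset_closure hp.2)
  obtain ⟨k, rfl⟩ := exists_sectorCell hx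
  exact ⟨k, hc⟩

/-- In the grid this is `NodeFan.card_changes_le`; elsewhere all weights vanish. -/
theorem sum_node_nonneg (hn : 2 ≤ n) (hm : 2 ≤ m) (hI : InjOn I (grid n m))
    (hJ : IsWellJoined n m I J) (hC : IsComponent n m J C) (p : Pt) :
    0 ≤ ∑ k, (sectorWeight n m I J C k p - gluedWeight n m J C k p) := by
  classical
  by_cases hp : p ∈ grid n m
  · rw [← card_sub_card_eq]
    have := (nodeFan hn hm hI hJ hC hp).card_changes_le
    rw [sub_nonneg]
    exact_mod_cast this
  · refine (Finset.sum_eq_zero fun k _ => ?_).ge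
    rw [not_ne_iff.mp (mt (sectorWeight_support k p) hp),
      not_ne_iff.mp (mt (gluedWeight_support k p) hp), sub_zero]

/-- Every wall of the region at p leads to a consecutive perimeter node. At an extremum all these
walls have one sign `σ`, and the strict inequality of `NodeFan.card_changes_lt` applies. -/
theorem sum_node_pos {σ : Bool} (hn : 2 ≤ n) (hm : 2 ≤ m) (hI : InjOn I (grid n m))
    (hJ : IsWellJoined n m I J) (hC : IsComponent n m J C) {p : Pt}
    (hp : p ∈ perimeterNodes n m C)
    (h : ∀ q ∈ nbr n m I p, PerimeterAdj n m C p q → (I p < I q ↔ σ = true)) :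
    1 ≤ ∑ k, (sectorWeight n m I J C k p - gluedWeight n m J C k p) := by
  classical
  rw [← card_sub_card_eq]
  have := (nodeFan hn hm hI hJ hC hp.1).card_changes_lt (σ := σ) (fun k hw hr => by
    obtain ⟨h1, h2⟩ := perimeterAdj_of_isWall hJ hC hp.1 hw hr
    rw [Bool.eq_iff_iff, signAround_of_mem_nbr hp.1 k h1]
    exact h _ h1 h2) (exists_sector_mem hn hm hJ hC hp)
  zify at this
  linarith

theorem IsPerimeterMin.one_le_sum (hn : 2 ≤ n) (hm : 2 ≤ m) (hI : InjOn I (grid n m))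
    (hJ : IsWellJoined n m I J) (hC : IsComponent n m J C) {p : Pt}
    (hp : IsPerimeterMin n m I C p) :
    1 ≤ ∑ k, (sectorWeight n m I J C k p - gluedWeight n m J C k p) :=
  sum_node_pos (σ := true) hn hm hI hJ hC hp.1 fun q _ hq => by simp [hp.2 q hq]

theorem IsPerimeterMax.one_le_sum (hn : 2 ≤ n) (hm : 2 ≤ m) (hI : InjOn I (grid n m))
    (hJ : IsWellJoined n m I J) (hC : IsComponent n m J C) {p : Pt}
    (hp : IsPerimeterMax n m I C p) :
    1 ≤ ∑ k, (sectorWeight n m I J C k p - gluedWeight n m J C k p) :=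
  sum_node_pos (σ := false) hn hm hI hJ hC hp.1 fun q _ hq => by simp [(hp.2 q hq).le]

/-- Corners of cells of the region are nodes, hence on the graph and on the perimeter. The lower
left corner serves except for the upper half of a pixel cut along the other diagonal. -/
theorem perimeterNodes_nonempty (hn : 2 ≤ n) (hm : 2 ≤ m) (hJ : IsWellJoined n m I J)
    (hC : IsComponent n m J C) : (perimeterNodes n m C).Nonempty := by
  obtain ⟨⟨⟨i, j⟩, b⟩, hc⟩ := hC.regionCells_nonempty hJ hn hm
  have hp : PixelIn n m (i, j) := hc.1
  obtain ⟨ga, gb, gc, gd⟩ := hp.corners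
  have key : ∀ {p : Pt}, p ∈ grid n m → toPlane p ∈ closedCell J ((i, j), b) →
      p ∈ perimeterNodes n m C := fun hg hx =>
    ⟨hg, subset_frontier hC hc (singleton_subset_iff.mpr hx) (Or.inl (singleton_subset_iff.mpr
      (Or.inl ⟨_, hg, rfl⟩))) rfl⟩
  cases ha : anti J (i, j) <;> cases b
  · exact ⟨_, key ga (by simp [closedCell, toPlane, ha, cellSide])⟩
  · exact ⟨_, key ga (by simp [closedCell, toPlane, ha, cellSide])⟩
  · exact ⟨_, key ga (by simp [closedCell, toPlane, ha, cellSide])⟩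
  · exact ⟨_, key gd (by simp [closedCell, toPlane, ha, cellSide])⟩

/-- Without consecutive nodes the condition of `sum_node_pos` is vacuous. Its conclusion yields a
wall of the region, whose other end is a consecutive node after all. -/
theorem exists_perimeterAdj (hn : 2 ≤ n) (hm : 2 ≤ m) (hI : InjOn I (grid n m))
    (hJ : IsWellJoined n m I J) (hC : IsComponent n m J C) {p : Pt}
    (hp : p ∈ perimeterNodes n m C) : ∃ q, PerimeterAdj n m C p q := by
  classical
  by_contra hcon
  push Not at hcon
  have h1 := sum_node_pos (σ := true) hn hm hI hJ hC hp fun q _ hq => absurd hq (hcon q)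
  rw [← card_sub_card_eq] at h1
  have h2 : 0 < (Finset.univ.filter fun k => sectorCell J p k ∈ regionCells n m J C ∧
      IsWall n m J p k).card := by
    zify
    linarith
  obtain ⟨k, hk⟩ := Finset.card_pos.mp h2
  obtain ⟨-, hk1, hk2⟩ := Finset.mem_filter.mp hk
  exact hcon _ (perimeterAdj_of_isWall hJ hC hp.1 hk2 (Or.inl hk1)).2

theorem PerimeterAdj.mem_perimeterNodes {p q : Pt} (h : PerimeterAdj n m C p q) :
    q ∈ perimeterNodes n m C :=
  ⟨h.2.1.1, h.2.2 (right_mem_segment ℝ _ _)⟩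

theorem finite_perimeterNodes : (perimeterNodes n m C).Finite :=
  (grid_finite n m).subset fun _ h => h.1

theorem exists_isPerimeterMin (hn : 2 ≤ n) (hm : 2 ≤ m) (hI : InjOn I (grid n m))
    (hJ : IsWellJoined n m I J) (hC : IsComponent n m J C) : ∃ p, IsPerimeterMin n m I C p := by
  obtain ⟨p, hp, h⟩ := exists_min_image _ I finite_perimeterNodes
    (perimeterNodes_nonempty hn hm hJ hC)
  exact ⟨p, hp, fun q hq => lt_of_le_of_ne (h q hq.mem_perimeterNodes)
    fun e => hq.2.1.2.1 (hI hp.1 hq.2.1.1 e).symm⟩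

theorem exists_isPerimeterMax (hn : 2 ≤ n) (hm : 2 ≤ m) (hI : InjOn I (grid n m))
    (hJ : IsWellJoined n m I J) (hC : IsComponent n m J C) : ∃ p, IsPerimeterMax n m I C p := by
  obtain ⟨p, hp, h⟩ := exists_max_image _ I finite_perimeterNodes
    (perimeterNodes_nonempty hn hm hJ hC)
  exact ⟨p, hp, fun q hq => lt_of_le_of_ne (h q hq.mem_perimeterNodes)
    fun e => hq.2.1.2.1 (hI hq.2.1.1 hp.1 e)⟩

/-- Each extremum contributes at least 1, no node contributes a negative amount, and the total is at
most 2. -/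
theorem not_three_extrema (hn : 2 ≤ n) (hm : 2 ≤ m) (hI : InjOn I (grid n m))
    (hJ : IsWellJoined n m I J) (hC : IsComponent n m J C)
    (hs : ∀ c ∈ regionCells n m J C, ¬ IsSplitPixel n m I c.1) {T : Finset Pt}
    (hT : ∀ p ∈ T, IsPerimeterMin n m I C p ∨ IsPerimeterMax n m I C p) : T.card ≤ 2 := by
  have h1 := sum_weights_le hn hm hI hJ hC hs
  have h2 : ∑ p ∈ T, ∑ k, (sectorWeight n m I J C k p - gluedWeight n m J C k p) ≤
      ∑ p ∈ box n m, ∑ k, (sectorWeight n m I J C k p - gluedWeight n m J C k p) :=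
    Finset.sum_le_sum_of_subset_of_nonneg
      (fun p hp => grid_subset_box ((hT p hp).elim (fun h => h.1.1) (fun h => h.1.1)))
      fun p _ _ => sum_node_nonneg hn hm hI hJ hC p
  have h3 := Finset.card_nsmul_le_sum T
    (fun p => ∑ k, (sectorWeight n m I J C k p - gluedWeight n m J C k p)) 1 fun p hp =>
      (hT p hp).elim (fun h => h.one_le_sum hn hm hI hJ hC) fun h => h.one_le_sum hn hm hI hJ hC
  rw [nsmul_one] at h3
  exact_mod_cast h3.trans (h2.trans h1)

theorem IsPerimeterMin.ne (hn : 2 ≤ n) (hm : 2 ≤ m) (hI : InjOn I (grid n m))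
    (hJ : IsWellJoined n m I J) (hC : IsComponent n m J C) {p q : Pt}
    (hp : IsPerimeterMin n m I C p) (hq : IsPerimeterMax n m I C q) : p ≠ q := by
  rintro rfl
  obtain ⟨r, hr⟩ := exists_perimeterAdj hn hm hI hJ hC hp.1
  exact lt_asymm (hp.2 r hr) (hq.2 r hr)

/-- One minimum and one maximum already exhaust the total of 2, so any further extremum coincides
with one of them, necessarily the one of its own kind. -/
theorem existsUnique_perimeter_extrema (hn : 2 ≤ n) (hm : 2 ≤ m) (hI : InjOn I (grid n m))
    (hJ : IsWellJoined n m I J) (hC : IsComponent n m J C)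
    (hs : ∀ c ∈ regionCells n m J C, ¬ IsSplitPixel n m I c.1) :
    (∃! p, IsPerimeterMin n m I C p) ∧ ∃! p, IsPerimeterMax n m I C p := by
  obtain ⟨a, ha⟩ := exists_isPerimeterMin hn hm hI hJ hC
  obtain ⟨b, hb⟩ := exists_isPerimeterMax hn hm hI hJ hC
  have hcard : ∀ c, (IsPerimeterMin n m I C c ∨ IsPerimeterMax n m I C c) → c = a ∨ c = b := by
    intro c hc
    by_contra hcon
    push Not at hcon
    have := not_three_extrema hn hm hI hJ hC hs (T := {c, a, b}) (by
      simp only [Finset.mem_insert, Finset.mem_singleton]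
      rintro p (rfl | rfl | rfl)
      exacts [hc, Or.inl ha, Or.inr hb])
    rw [Finset.card_eq_three.mpr ⟨c, a, b, hcon.1, hcon.2, ha.ne hn hm hI hJ hC hb, rfl⟩] at this
    omega
  refine ⟨⟨a, ha, fun c hc => ?_⟩, ⟨b, hb, fun c hc => ?_⟩⟩
  · exact (hcard c (Or.inl hc)).resolve_right (hc.ne hn hm hI hJ hC hb)
  · exact (hcard c (Or.inr hc)).resolve_left (ha.ne hn hm hI hJ hC hc).symm

end ImageGraph

/-- Min-max paths cover all nodes and edges of the graph, so the regions are the components of the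
complement of the graph, and the absence of saddles excludes split pixels. -/
theorem lemma11 (n m : ℕ) (hn : 2 ≤ n) (hm : 2 ≤ m)
    (I : ℤ × ℤ → ℝ) (hI : Set.InjOn I (ImageGraph.grid n m))
    (E : Set ((ℤ × ℤ) × (ℤ × ℤ))) (hE : ImageGraph.IsSteepestGraph n m I E)
    (C : Set (ℝ × ℝ)) (hC : ImageGraph.IsRegion n m E C)
    (hmono : ImageGraph.IsMonotonicRegion n m I C) :
    (∃! p, ImageGraph.IsPerimeterMin n m I C p) ∧
      (∃! p, ImageGraph.IsPerimeterMax n m I C p) := by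
  have hJ := hE.isWellJoined hn hm hI
  have hC' : ImageGraph.IsComponent n m (ImageGraph.Joined E) C := by
    unfold ImageGraph.IsRegion at hC
    rw [ImageGraph.minMaxLines_eq (hE.edgeInvariant hn hm hI)] at hC
    exact hC
  exact ImageGraph.existsUnique_perimeter_extrema hn hm hI hJ hC' fun c hc =>
    ImageGraph.not_split_of_monotonic hJ hC' hmono hc
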